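/- Let $z_1>z_2>\dots>z_L$ divide the $z$-axis of $\mathbb{R}^3$ into closed rods $\Gamma_1=[z_1,\infty),\ \Gamma_2=[z_2,z_1],\dots,\Gamma_{L+1}=(-\infty,z_L]$. Each rod has a rod structure $v_l=(v_l^1,v_l^2)\in\mathbb{Z}^2$, which is a pair of coprime integers for an axis rod and $(0,0)$ for a horizon rod; the two semi-infinite rods are axis rods. A corner is a point separating two axis rods, a pole one separating an axis rod from a horizon rod, and neighbouring rod structures at a corner are linearly independent. Let $\Gamma$ be the union of the axis rods. Assume the generalized compatibility condition: for any three consecutive axis rods, $$v_{l-1}^1\,v_{l+1}^1\,\det\begin{pmatrix}v_{l-1}\\ v_l\end{pmatrix}\det\begin{pmatrix}v_l\\ v_{l+1}\end{pmatrix}\le 0 .$$ Let constants $\mathbf a_l\in\mathbb{R}^2$, $\mathbf b_l,\mathbf c_l\in\mathbb{R}$ be given on the axis rods, such that $\mathbf a_l=\mathbf a_{l+1}$ and $\mathbf b_l=\mathbf b_{l+1}$ whenever $\Gamma_l,\Gamma_{l+1}$ share a corner. The symmetric space $G_{2(2)}/SO(4)$ is described by its global coordinates $(F,\zeta,\chi,\psi)$,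 with $F$ a positive definite symmetric $2\times 2$ matrix, $\zeta,\psi\in\mathbb{R}^2$, $\chi\in\mathbb{R}$, and metric $$G=\tfrac12[\mathrm{Tr}(F^{-1}dF)]^2+\tfrac12\mathrm{Tr}[(F^{-1}dF)^2]+f^{-1}\Theta^TF^{-1}\Theta+f^{-1}\Upsilon^2+d\psi^TF^{-1}d\psi,$$ where $f=\det F$, $\Upsilon=d\chi+\frac1{\sqrt3}(\psi_1d\psi_2-\psi_2d\psi_1)$ and $\Theta=d\zeta+\psi\,[d\chi+\frac1{3\sqrt3}(\psi_1d\psi_2-\psi_2d\psi_1)]$. Then there is an axially symmetric map $\Psi_0=(F,\zeta,\chi,\psi):\mathbb{R}^3\setminus\Gamma\to G_{2(2)}/SO(4)$ such that: 1. Its tension field satisfies $|\tau|\le C$ on $\mathbb{R}^3\setminus\Gamma$ and $|\tau|=O(r^{-3})$ as $r=|x|\to\infty$. 2. $F,\zeta,\chi,\psi$ extend smoothly over the whole axis. For $\zeta,\chi,\psi$ this means that they are smooth functions on $\mathbb{R}^3$, and $F$ is smooth on $\mathbb{R}^3$ away from the points $p_i=(0,0,z_i)$. Near $p_i$, $F$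 is a smooth function of the pair $r_i+(z-z_i)$, $r_i-(z-z_i)$, where $r_i=|x-p_i|$; that is, $F$ is smooth on the $\mathbb{R}^4$ of which a neighbourhood of $p_i$ in the half-plane is locally the quotient by $U(1)^2$. 3. $\Psi_0$ has the given rod structure. At each point of the $z$-axis, $\ker F$ is spanned by the rod structures of the rods containing that point, and $\det F$ is comparable to $\rho^2$ near every point of $\Gamma$ that is not a pole, where $\rho$ is the distance to the $z$-axis. 4. On each axis rod $\Gamma_l$, with $\hat v=(-v^2,v^1)$, one has $v_l\cdot\psi=\mathbf c_l$ and $$\chi=\mathbf b_l+h_{v_l}(\psi)+\beta_l,\qquad \zeta=\mathbf a_l+k_{v_l}(\psi)+\alpha_l,$$ where $$h_v(\psi)=-\frac{(\psi\cdot v)(\psi\cdot\hat v)}{\sqrt3\,|v|^2},\qquad k_v(\psi)=\frac{2(\psi\cdot v)^2(\psi\cdot\hat v)}{3\sqrt3\,|v|^4}\,v+\frac{(\psi\cdot v)(\psi\cdot\hat v)^2}{3\sqrt3\,|v|^4}\,\hat v .$$ Here $\beta_l,\alpha_l$ are determined by the rod structures and the values of $\psi$ at the corners: they vanish on the northernmost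 rod of each connected component of $\Gamma$, and at a corner $p_l$ between $\Gamma_l$ and $\Gamma_{l+1}$ one has $\beta_{l+1}-\beta_l=h_{v_l}(\psi(p_l))-h_{v_{l+1}}(\psi(p_l))$ and $\alpha_{l+1}-\alpha_l=k_{v_l}(\psi(p_l))-k_{v_{l+1}}(\psi(p_l))$. -/

import Mathlib

open scoped Matrix Topology ContDiff Laplacian

noncomputable section

namespace Sugra

/-! ### The target: `G₂₍₂₎/SO(4)` in its global coordinates `(F, ζ, χ, ψ)`

A point is `x : Fin 8 → ℝ` with `x = (f₁₁, f₁₂, f₂₂, ζ₁, ζ₂, χ, ψ₁, ψ₂)`; the symmetric space is the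
open set on which `F = (f_ij)` is positive definite. -/

/-- The symmetric matrix `F = (f_ij)`; also used for the `F`-part of a tangent vector. -/
def fMat (x : Fin 8 → ℝ) : Matrix (Fin 2) (Fin 2) ℝ := !![x 0, x 1; x 1, x 2]

/-- The twist potentials `ζ = (ζ₁, ζ₂)`. -/
def zetaPot (x : Fin 8 → ℝ) : Fin 2 → ℝ := ![x 3, x 4]

/-- The electric potential `χ`. -/
def chiPot (x : Fin 8 → ℝ) : ℝ := x 5

/-- The magnetic potentials `ψ = (ψ₁, ψ₂)`. -/
def psiPot (x : Fin 8 → ℝ) : Fin 2 → ℝ := ![x 6, x 7]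

/-- The symmetric space as a set of coordinates. -/
def target : Set (Fin 8 → ℝ) := {x | (fMat x).PosDef}

/-- The 1-form `ψ₁ dψ₂ - ψ₂ dψ₁` at `x`, applied to the tangent vector `u`. -/
def psiForm (x u : Fin 8 → ℝ) : ℝ := psiPot x 0 * psiPot u 1 - psiPot x 1 * psiPot u 0

/-- The 1-form `Υ = dχ + (1/√3) (ψ₁ dψ₂ - ψ₂ dψ₁)`. -/
def upsilonForm (x u : Fin 8 → ℝ) : ℝ := chiPot u + 1 / √3 * psiForm x u

/-- The 1-forms `Θ_i = dζ_i + ψ_i (dχ + (1/(3√3)) (ψ₁ dψ₂ - ψ₂ dψ₁))`. -/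
def thetaForm (x u : Fin 8 → ℝ) : Fin 2 → ℝ :=
  zetaPot u + (chiPot u + 1 / (3 * √3) * psiForm x u) • psiPot x

/-- The symmetric space metric
`G = ½ (Tr F⁻¹dF)² + ½ Tr (F⁻¹dF)² + f⁻¹ Θᵀ F⁻¹ Θ + f⁻¹ Υ² + dψᵀ F⁻¹ dψ`, `f = det F`,
as a symmetric bilinear form in the tangent vectors `u`, `w` at `x`. -/
def metric (x u w : Fin 8 → ℝ) : ℝ :=
  1 / 2 * ((fMat x)⁻¹ * fMat u).trace * ((fMat x)⁻¹ * fMat w).trace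
    + 1 / 2 * ((fMat x)⁻¹ * fMat u * ((fMat x)⁻¹ * fMat w)).trace
    + (fMat x).det⁻¹ * (thetaForm x u ⬝ᵥ ((fMat x)⁻¹ *ᵥ thetaForm x w))
    + (fMat x).det⁻¹ * (upsilonForm x u * upsilonForm x w)
    + psiPot u ⬝ᵥ ((fMat x)⁻¹ *ᵥ psiPot w)

/-- The components `G_{AB}` of the metric. -/
def gram (x : Fin 8 → ℝ) : Matrix (Fin 8) (Fin 8) ℝ :=
  Matrix.of fun A B => metric x (Pi.single A 1) (Pi.single B 1)

/-- The partial derivative `∂_C G_{AB}`. -/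
def dGram (x : Fin 8 → ℝ) (C A B : Fin 8) : ℝ :=
  lineDeriv ℝ (fun y => gram y A B) x (Pi.single C 1)

/-- The Christoffel symbols `Γ^A_{BC}` of the Levi-Civita connection of `G`. -/
def christoffel (x : Fin 8 → ℝ) (A B C : Fin 8) : ℝ :=
  1 / 2 * ∑ D, (gram x)⁻¹ A D * (dGram x B D C + dGram x C D B - dGram x D B C)

/-! ### Maps from Euclidean 3-space and their tension -/

/-- Euclidean 3-space; the `z`-axis is `{x | x 0 = 0 ∧ x 1 = 0}` and `z = x 2`. -/
abbrev E3 : Type := EuclideanSpace ℝ (Fin 3)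

/-- The partial derivative `∂_a X^A` at `p`. -/
def partialD (X : E3 → Fin 8 → ℝ) (p : E3) (a : Fin 3) (A : Fin 8) : ℝ :=
  lineDeriv ℝ (fun q => X q A) p (EuclideanSpace.single a 1)

/-- The tension field of a map from Euclidean 3-space to the target, in coordinates:
`τ^A = ΔX^A + Γ^A_{BC}(X) ∂_a X^B ∂_a X^C`. -/
def tension (X : E3 → Fin 8 → ℝ) (p : E3) : Fin 8 → ℝ := fun A =>
  (Δ (fun q => X q A)) p
    + ∑ a, ∑ B, ∑ C, christoffel (X p) A B C * partialD X p a B * partialD X p a C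

/-- The length `|τ|` of the tension field with respect to `G`. -/
def tensionNorm (X : E3 → Fin 8 → ℝ) (p : E3) : ℝ :=
  √(metric (X p) (tension X p) (tension X p))

/-- The square `ρ²` of the distance to the `z`-axis. -/
def rhoSq (x : E3) : ℝ := x 0 ^ 2 + x 1 ^ 2

/-- The point with height `h` on the `z`-axis. -/
def axisPt (h : ℝ) : E3 := !₂[0, 0, h]

/-! ### Rod data -/

/-- A subdivision of the `z`-axis by `z 0 > z 1 > … > z (L-1)` into `L + 1` rods, numbered from north
to south, with rod structures `v l` (`v l = 0` for a horizon rod) and potential constants. -/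
structure RodData (L : ℕ) where
  /-- the heights of the points separating the rods -/
  z : Fin L → ℝ
  /-- the rod structures -/
  v : Fin (L + 1) → Fin 2 → ℤ
  /-- the constants for `ζ` -/
  a : Fin (L + 1) → Fin 2 → ℝ
  /-- the constants for `χ` -/
  b : Fin (L + 1) → ℝ
  /-- the constants for `ψ` -/
  c : Fin (L + 1) → ℝ

namespace RodData

variable {L : ℕ} (R : RodData L)

/-- The rod structure as a real vector. -/
def vec (l : Fin (L + 1)) : Fin 2 → ℝ := fun i => (R.v l i : ℝ)

/-- An axis rod (as opposed to a horizon rod). -/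
def IsAxis (l : Fin (L + 1)) : Prop := R.v l ≠ 0

/-- The closed rod `Γ_l`; its upper end point is `z i` for the `i` with `i.succ = l` (none for the
first rod), its lower one is `z i` for the `i` with `i.castSucc = l` (none for the last rod). -/
def rod (l : Fin (L + 1)) : Set E3 :=
  {x | x 0 = 0 ∧ x 1 = 0 ∧ (∀ i : Fin L, i.castSucc = l → R.z i ≤ x 2) ∧
    ∀ i : Fin L, i.succ = l → x 2 ≤ R.z i}

/-- `Γ`, the union of the axis rods. -/
def axis : Set E3 := {x | ∃ l, R.IsAxis l ∧ x ∈ R.rod l}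

/-- The union of the horizon rods. -/
def horizon : Set E3 := {x | ∃ l, ¬ R.IsAxis l ∧ x ∈ R.rod l}

/-- The set of the points separating the rods (corners and poles). -/
def endPts : Set E3 := {x | ∃ i, x = axisPt (R.z i)}

/-- The `i`-th separating point is a corner: it separates two axis rods. -/
def IsCorner (i : Fin L) : Prop := R.IsAxis i.castSucc ∧ R.IsAxis i.succ

/-- The determinant of the two rod structures next to the `i`-th separating point. -/
def cornerDet (i : Fin L) : ℤ :=
  R.v i.castSucc 0 * R.v i.succ 1 - R.v i.castSucc 1 * R.v i.succ 0

/-- The standing conventions on rod data: the rods are numbered from north to south, the rod structure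
of an axis rod is a pair of coprime integers, the two semi-infinite rods are axis rods, neighbouring
rod structures at a corner are linearly independent, and only the constants `c` may change across
a corner. -/
structure IsRodDataSet : Prop where
  z_anti : StrictAnti R.z
  coprime : ∀ l, R.IsAxis l → IsCoprime (R.v l 0) (R.v l 1)
  first_axis : R.IsAxis 0
  last_axis : R.IsAxis (Fin.last L)
  corner_indep : ∀ i, R.IsCorner i → R.cornerDet i ≠ 0
  a_const : ∀ i, R.IsCorner i → R.a i.castSucc = R.a i.succ
  b_const : ∀ i, R.IsCorner i → R.b i.castSucc = R.b i.succ

/-- The generalized compatibility condition: for any three consecutive axis rods `l-1, l, l+1`,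
`v_{l-1}^1 v_{l+1}^1 det(v_{l-1}, v_l) det(v_l, v_{l+1}) ≤ 0`. -/
def GenCompatible : Prop :=
  ∀ i j : Fin L, i.succ = j.castSucc → R.IsCorner i → R.IsCorner j →
    R.v i.castSucc 0 * R.v j.succ 0 * R.cornerDet i * R.cornerDet j ≤ 0

end RodData

/-! ### The values of the potentials on the axis rods -/

/-- `v̂ = (-v₂, v₁)`. -/
def hat (v : Fin 2 → ℝ) : Fin 2 → ℝ := ![-v 1, v 0]

/-- The function `-(ψ·v)(ψ·v̂) / (√3 |v|²)` of `ψ = p`. -/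
def chiProfile (v p : Fin 2 → ℝ) : ℝ :=
  -(1 / √3) * ((p ⬝ᵥ v) * (p ⬝ᵥ hat v)) / (v ⬝ᵥ v)

/-- The vector function of `ψ = p` whose scalar products with `v` and `v̂` are
`2 (ψ·v)² (ψ·v̂) / (3√3 |v|²)` and `(ψ·v) (ψ·v̂)² / (3√3 |v|²)`. -/
def zetaProfile (v p : Fin 2 → ℝ) : Fin 2 → ℝ :=
  (2 / (3 * √3) * ((p ⬝ᵥ v) ^ 2 * (p ⬝ᵥ hat v)) / (v ⬝ᵥ v) ^ 2) • v
    + (1 / (3 * √3) * ((p ⬝ᵥ v) * (p ⬝ᵥ hat v) ^ 2) / (v ⬝ᵥ v) ^ 2) • hat v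

namespace RodData

variable {L : ℕ} (R : RodData L)

open Classical in
/-- The jumps of `chiProfile` at the corners, given the value `p i` of `ψ` at the `i`-th separating
point, summed from the northernmost rod of the connected component of the axis down to the rod `l`. -/
def chiShift (p : Fin L → Fin 2 → ℝ) (l : Fin (L + 1)) : ℝ :=
  Fin.induction (motive := fun _ => ℝ) 0
    (fun i s => if R.IsCorner i then
      s + chiProfile (R.vec i.castSucc) (p i) - chiProfile (R.vec i.succ) (p i) else 0) l

open Classical in
/-- The same for `zetaProfile`. -/
def zetaShift (p : Fin L → Fin 2 → ℝ) (l : Fin (L + 1)) : Fin 2 → ℝ :=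
  Fin.induction (motive := fun _ => Fin 2 → ℝ) 0
    (fun i s => if R.IsCorner i then
      s + zetaProfile (R.vec i.castSucc) (p i) - zetaProfile (R.vec i.succ) (p i) else 0) l

/-! ### Model maps -/

/-- `X = (F, ζ, χ, ψ)` is axially symmetric and restricts to a map `ℝ³ ∖ Γ → G₂₍₂₎/SO(4)`. -/
structure IsAxisymMap (X : E3 → Fin 8 → ℝ) : Prop where
  mapsTo : Set.MapsTo X R.axisᶜ target
  axisym : ∀ x y : E3, rhoSq x = rhoSq y → x 2 = y 2 → X x = X y

/-- `X = (F, ζ, χ, ψ)` is smooth everywhere, also along the axis and at corners and poles: the potentials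
are smooth functions on `ℝ³`, and so is `F` away from the points separating the rods.
Near such a point `p`, `F` is a smooth function of `r + (z - z(p))` and `r - (z - z(p))`,
`r = |x - p|`, that is, of the squared radii in the two orthogonal planes of the `ℝ⁴` of which
a neighbourhood of `p` in the half plane `{ρ ≥ 0}` is the quotient by `U(1)²`. -/
structure IsSmoothMap (X : E3 → Fin 8 → ℝ) : Prop where
  zeta : ContDiff ℝ ∞ fun x => zetaPot (X x)
  chi : ContDiff ℝ ∞ fun x => chiPot (X x)
  psi : ContDiff ℝ ∞ fun x => psiPot (X x)
  f : ∀ i j, ContDiffOn ℝ ∞ (fun x => fMat (X x) i j) R.endPtsᶜ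
  f_endPt : ∀ k : Fin L, ∀ i j, ∃ g : ℝ × ℝ → ℝ, ContDiff ℝ ∞ g ∧
    ∀ᶠ x in 𝓝 (axisPt (R.z k)), fMat (X x) i j =
      g (‖x - axisPt (R.z k)‖ + (x 2 - R.z k), ‖x - axisPt (R.z k)‖ - (x 2 - R.z k))

/-- `X` has the prescribed rod structure: at each point of the `z`-axis the kernel of `F` is spanned by
the rod structures of the rods through that point (so `F` is nondegenerate inside horizon rods and
vanishes at corners), and `det F` is comparable to `ρ²` near each point of `Γ` that is not a pole. -/
structure HasRodStructure (X : E3 → Fin 8 → ℝ) : Prop where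
  ker : ∀ h : ℝ, ∀ w : Fin 2 → ℝ, fMat (X (axisPt h)) *ᵥ w = 0 ↔
    w ∈ Submodule.span ℝ {u | ∃ l, axisPt h ∈ R.rod l ∧ u = R.vec l}
  det : ∀ x ∈ R.axis \ R.horizon, ∃ m > 0, ∃ M > 0, ∀ᶠ y in 𝓝 x,
    m * rhoSq y ≤ (fMat (X y)).det ∧ (fMat (X y)).det ≤ M * rhoSq y

/-- `X` has the prescribed potential constants: on each axis rod `v_l · ψ = c_l`, and `χ`, `ζ` agree
with `b_l`, `a_l` up to explicit functions of `ψ` and the rod structures. -/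
structure HasPotentialConstants (X : E3 → Fin 8 → ℝ) : Prop where
  psi : ∀ l, R.IsAxis l → ∀ x ∈ R.rod l, R.vec l ⬝ᵥ psiPot (X x) = R.c l
  chi : ∀ l, R.IsAxis l → ∀ x ∈ R.rod l, chiPot (X x) =
    R.b l + chiProfile (R.vec l) (psiPot (X x))
      + R.chiShift (fun i => psiPot (X (axisPt (R.z i)))) l
  zeta : ∀ l, R.IsAxis l → ∀ x ∈ R.rod l, zetaPot (X x) =
    R.a l + zetaProfile (R.vec l) (psiPot (X x))
      + R.zetaShift (fun i => psiPot (X (axisPt (R.z i)))) l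

end RodData

end Sugra

end

noncomputable section

namespace Sugra

/-! ### The metric in explicit coordinates -/

/-! The map is glued from explicit models, all of them functions of s = ρ² and z. The difficulty is
that F degenerates on the axis rods, where the metric blows up, so smoothness of the coordinates
does not by itself bound |τ|.

Near a separating point, F = D₁ ααᵀ + D₂ ββᵀ with a constant frame (α, β), each Dᵢ being r + (z -
zᵢ), r - (z - zᵢ) or 1, and the potentials are constant. Since log(r ± (z - zᵢ)) is harmonic, such a
map has zero tension (`logHarmonic_radAdd`, `cylTension_of_logHarmonic`). With rod structures u
above and d below, a corner is modelled by (r - (z - zᵢ)) d̂d̂ᵀ + (r + (z - zᵢ)) ûûᵀ; at a pole one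
of the factors is 1 (`exists_isEndModel`).

Along an axis rod with structure v every model has the form F = s a vvᵀ + s b (vv̂ᵀ + v̂vᵀ) + d
v̂v̂ᵀ with a, b, d smooth and a, d positive on the axis (`RodForm`). For fixed v this class is
convex, as is the class of positive definite matrices, so a partition of unity glues the models
without losing the rod structure (`RodForm.sum`, `Regular.sum`). Near the rod the potentials depend
on z alone and v · ψ is constant; h_v and k_v are exactly the primitives for which Υ and Θ then
vanish. This removes the terms carrying 1 / det F. The poles in s that remain cancel because log ρ²
is harmonic, and |τ|² turns out to be a continuous expression up to s = 0 (`cylNormSq_rodVal`).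

The function ψ is kept constant near each separating point. At a corner the independence of the two
rod structures allows both linear conditions on ψ to be solved there, and the shifts β, α are what
makes χ and ζ match. Hence a single smooth function of z carries all the potentials
(`exists_axisPotentials`).

Near infinity F is the corner model, or ρ² vvᵀ + v̂v̂ᵀ if the two semi-infinite rods have parallel
structures, and the potentials pass from their northern to their southern values as functions of the
polar angle θ. All of the tension comes from this transition, which lies in |cos θ| ≤ 1/2, where 1 /
det F = O(r⁻²); two derivatives of a function of the angle contribute r⁻² more, so |τ|² = O(r⁻⁶).
For this count ψ may change only in the parallel case, and only in the direction v, in which F⁻¹ has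
size r⁻² (`tensionNorm_far`).

The global bound follows from local bounds, compactness of balls and the decay. The computations use
a closed formula `gam` for the quadratic part of the geodesic equation, identified with the
Christoffel symbols through the Koszul formula (`christoffel_eq_gam`), and the isometric action of
GL(2) (`metric_act`), which reduces each model to its own frame. -/

/-- The determinant of `F`. -/
def detF (x : Fin 8 → ℝ) : ℝ := x 0 * x 2 - x 1 ^ 2

/-- The `(0, 0)` entry of `F⁻¹`. -/
def gA (x : Fin 8 → ℝ) : ℝ := x 2 * (detF x)⁻¹
/-- The off-diagonal entry of `F⁻¹`. -/
def gB (x : Fin 8 → ℝ) : ℝ := -x 1 * (detF x)⁻¹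
/-- The `(1, 1)` entry of `F⁻¹`. -/
def gC (x : Fin 8 → ℝ) : ℝ := x 0 * (detF x)⁻¹

/-- The scalar product of `(a₀, a₁)` and `(b₀, b₁)` with respect to `F⁻¹`. -/
def gIn (x : Fin 8 → ℝ) (a₀ a₁ b₀ b₁ : ℝ) : ℝ :=
  gA x * (a₀ * b₀) + gB x * (a₀ * b₁ + a₁ * b₀) + gC x * (a₁ * b₁)

/-- The entries of `F⁻¹ φ`, where `φ` is the `F`-part of `u`. -/
def m00 (x u : Fin 8 → ℝ) : ℝ := gA x * u 0 + gB x * u 1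
/-- The entries of `F⁻¹ φ`, where `φ` is the `F`-part of `u`. -/
def m01 (x u : Fin 8 → ℝ) : ℝ := gA x * u 1 + gB x * u 2
/-- The entries of `F⁻¹ φ`, where `φ` is the `F`-part of `u`. -/
def m10 (x u : Fin 8 → ℝ) : ℝ := gB x * u 0 + gC x * u 1
/-- The entries of `F⁻¹ φ`, where `φ` is the `F`-part of `u`. -/
def m11 (x u : Fin 8 → ℝ) : ℝ := gB x * u 1 + gC x * u 2

/-- `ψ × ψ(u)`. -/
def psiX (x u : Fin 8 → ℝ) : ℝ := x 6 * u 7 - x 7 * u 6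
/-- The form `Υ`. -/
def ups (x u : Fin 8 → ℝ) : ℝ := u 5 + 1 / √3 * psiX x u
/-- The form `dχ + (1 / (3√3)) ψ × dψ`. -/
def chiF (x u : Fin 8 → ℝ) : ℝ := u 5 + 1 / √3 / 3 * psiX x u
/-- The first component of `Θ`. -/
def th0 (x u : Fin 8 → ℝ) : ℝ := u 3 + chiF x u * x 6
/-- The second component of `Θ`. -/
def th1 (x u : Fin 8 → ℝ) : ℝ := u 4 + chiF x u * x 7

theorem inv_fMat (x : Fin 8 → ℝ) : (fMat x)⁻¹ = !![gA x, gB x; gB x, gC x] := by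
  rw [Matrix.inv_def, fMat, Matrix.adjugate_fin_two_of, Matrix.det_fin_two_of, Ring.inverse_eq_inv']
  ext i j
  fin_cases i <;> fin_cases j <;> simp [gA, gB, gC, detF, sq, mul_comm]

theorem det_fMat (x : Fin 8 → ℝ) : (fMat x).det = detF x := by
  rw [fMat, Matrix.det_fin_two_of, detF]; ring

/-- This form is polynomial once `(detF x)⁻¹` is read as a variable. Bilinearity and similar
identities therefore follow by `ring` at every x, degenerate or not. -/
theorem metric_eq (x u w : Fin 8 → ℝ) : metric x u w =
    1 / 2 * ((m00 x u + m11 x u) * (m00 x w + m11 x w))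
    + 1 / 2 * (m00 x u * m00 x w + m01 x u * m10 x w + m10 x u * m01 x w + m11 x u * m11 x w)
    + (detF x)⁻¹ * gIn x (th0 x u) (th1 x u) (th0 x w) (th1 x w)
    + (detF x)⁻¹ * (ups x u * ups x w)
    + gIn x (u 6) (u 7) (w 6) (w 7) := by
  have h3 : (1 : ℝ) / (3 * √3) = 1 / √3 / 3 := by rw [div_div]; ring
  unfold metric
  rw [det_fMat, inv_fMat]
  simp only [fMat, Matrix.mul_fin_two, Matrix.trace_fin_two_of, thetaForm, upsilonForm, psiForm,
    zetaPot, chiPot, psiPot, h3, Matrix.mulVec, dotProduct, Fin.sum_univ_two, Matrix.cons_val_zero,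
    Matrix.cons_val_one, Matrix.of_apply, Pi.add_apply, Pi.smul_apply, smul_eq_mul, Matrix.cons_val',
    Matrix.cons_val_fin_one, gIn, m00, m01, m10, m11, th0, th1, ups, chiF, psiX]
  ring

theorem metric_comm (x u w : Fin 8 → ℝ) : metric x u w = metric x w u := by
  simp only [metric_eq, gIn]; ring

theorem metric_add_left (x u u' w : Fin 8 → ℝ) :
    metric x (u + u') w = metric x u w + metric x u' w := by
  simp only [metric_eq, gIn, m00, m01, m10, m11, th0, th1, ups, chiF, psiX, Pi.add_apply]; ring

theorem metric_smul_left (x u w : Fin 8 → ℝ) (c : ℝ) :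
    metric x (c • u) w = c * metric x u w := by
  simp only [metric_eq, gIn, m00, m01, m10, m11, th0, th1, ups, chiF, psiX, Pi.smul_apply,
    smul_eq_mul]; ring

/-- The metric at `x` as a bilinear form. -/
def metricForm (x : Fin 8 → ℝ) : LinearMap.BilinForm ℝ (Fin 8 → ℝ) :=
  LinearMap.mk₂ ℝ (metric x) (metric_add_left x) (fun c u w => metric_smul_left x u w c)
    (fun u w w' => by
      rw [metric_comm, metric_add_left, metric_comm x w, metric_comm x w'])
    (fun c u w => by rw [metric_comm, metric_smul_left, metric_comm x w]; rfl)

@[simp] theorem metricForm_apply (x u w : Fin 8 → ℝ) : metricForm x u w = metric x u w := rfl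

theorem target_iff (x : Fin 8 → ℝ) : x ∈ target ↔
    ∀ a b : ℝ, (a, b) ≠ (0, 0) → 0 < x 0 * a ^ 2 + 2 * x 1 * (a * b) + x 2 * b ^ 2 := by
  change (fMat x).PosDef ↔ _
  rw [Matrix.posDef_iff_dotProduct_mulVec]
  constructor
  · rintro ⟨-, h⟩ a b hab
    have := h (x := ![a, b]) (by
      intro h0
      apply hab
      have h1 := congrFun h0 0
      have h2 := congrFun h0 1
      simp only [Matrix.cons_val_zero, Matrix.cons_val_one, Pi.zero_apply] at h1 h2
      rw [h1, h2])
    simp only [fMat, Matrix.mulVec, dotProduct, Fin.sum_univ_two, Matrix.of_apply, Pi.star_apply,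
      star_trivial, Matrix.cons_val_zero, Matrix.cons_val_one, Matrix.cons_val',
      Matrix.cons_val_fin_one] at this
    linarith
  · intro h
    refine ⟨?_, ?_⟩
    · ext i j
      fin_cases i <;> fin_cases j <;> simp [fMat]
    · intro y hy
      have := h (y 0) (y 1) (by
        intro h0
        apply hy
        have := Prod.mk.inj h0
        ext i; fin_cases i
        · exact this.1
        · exact this.2)
      simp only [fMat, Matrix.mulVec, dotProduct, Fin.sum_univ_two, Matrix.of_apply, Pi.star_apply,
        star_trivial, Matrix.cons_val_zero, Matrix.cons_val_one, Matrix.cons_val',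
        Matrix.cons_val_fin_one]
      linarith

theorem target_iff_det (x : Fin 8 → ℝ) : x ∈ target ↔ 0 < x 0 ∧ 0 < detF x := by
  rw [target_iff]
  constructor
  · intro h
    have h0 : 0 < x 0 := by
      have := h 1 0 (by simp)
      linarith
    -- On the vector (-f₁₂, f₁₁) the quadratic form takes the value f₁₁ det F.
    have h1 := h (-x 1) (x 0) (by
      intro h; exact h0.ne' (Prod.mk.inj h).2)
    refine ⟨h0, ?_⟩
    have : 0 < x 0 * detF x := by
      unfold detF; linarith
    exact pos_of_mul_pos_right this h0.le
  · rintro ⟨h0, h1⟩ a b hab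
    have key : x 0 * (x 0 * a ^ 2 + 2 * x 1 * (a * b) + x 2 * b ^ 2)
        = (x 0 * a + x 1 * b) ^ 2 + detF x * b ^ 2 := by unfold detF; ring
    have : 0 < (x 0 * a + x 1 * b) ^ 2 + detF x * b ^ 2 := by
      by_cases hb : b = 0
      · have ha : a ≠ 0 := by
          intro ha; exact hab (by rw [ha, hb])
        subst hb
        have : x 0 * a ≠ 0 := mul_ne_zero h0.ne' ha
        simp only [mul_zero, add_zero]
        positivity
      · have : 0 < detF x * b ^ 2 := by positivity
        positivity
    rw [← key] at this
    exact pos_of_mul_pos_right this h0.le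

/-- Completing squares makes each of the summands manifestly nonnegative, so each vanishes. The
system is then triangular: once dψ = 0, Υ reduces to dχ, and after that Θ reduces to dζ.
Definiteness is used both to invert `gram` and to identify vectors by their scalar products. -/
theorem metric_self_eq_zero {x : Fin 8 → ℝ} (hx : x ∈ target) {u : Fin 8 → ℝ}
    (h : metric x u u = 0) : u = 0 := by
  obtain ⟨h0, hf⟩ := (target_iff_det x).1 hx
  have hfe : detF x = x 0 * x 2 - x 1 ^ 2 := rfl
  have quad : ∀ a b : ℝ, gIn x a b a b = (a ^ 2 * detF x + (x 0 * b - x 1 * a) ^ 2) / (x 0 * detF x) := by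
    intro a b
    simp only [gIn, gA, gB, gC]
    field_simp
    rw [hfe]; ring
  have trtr : m00 x u * m00 x u + m01 x u * m10 x u + m10 x u * m01 x u + m11 x u * m11 x u
      = (u 0 / x 0) ^ 2 + 2 * (x 0 * u 1 - x 1 * u 0) ^ 2 / (x 0 ^ 2 * detF x)
        + ((x 0 ^ 2 * u 2 - 2 * x 0 * x 1 * u 1 + x 1 ^ 2 * u 0) / (x 0 * detF x)) ^ 2 := by
    simp only [m00, m01, m10, m11, gA, gB, gC]
    field_simp
    rw [hfe]; ring
  rw [metric_eq, quad, quad, trtr] at h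
  have hx0f : 0 < x 0 * detF x := mul_pos h0 hf
  have e1 : 0 ≤ (m00 x u + m11 x u) * (m00 x u + m11 x u) := mul_self_nonneg _
  have e2 : 0 ≤ (u 0 / x 0) ^ 2 := sq_nonneg _
  have e3 : 0 ≤ 2 * (x 0 * u 1 - x 1 * u 0) ^ 2 / (x 0 ^ 2 * detF x) := by positivity
  have e4 : 0 ≤ ((x 0 ^ 2 * u 2 - 2 * x 0 * x 1 * u 1 + x 1 ^ 2 * u 0) / (x 0 * detF x)) ^ 2 :=
    sq_nonneg _
  have e5 : 0 ≤ (detF x)⁻¹ * (((th0 x u) ^ 2 * detF x + (x 0 * th1 x u - x 1 * th0 x u) ^ 2)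
    / (x 0 * detF x)) := by positivity
  have e6 : 0 ≤ (detF x)⁻¹ * (ups x u * ups x u) :=
    mul_nonneg (inv_nonneg.2 hf.le) (mul_self_nonneg _)
  have e7 : 0 ≤ ((u 6) ^ 2 * detF x + (x 0 * u 7 - x 1 * u 6) ^ 2) / (x 0 * detF x) := by positivity
  have z2 : (u 0 / x 0) ^ 2 = 0 := by linarith
  have z3 : 2 * (x 0 * u 1 - x 1 * u 0) ^ 2 / (x 0 ^ 2 * detF x) = 0 := by linarith
  have z4 : ((x 0 ^ 2 * u 2 - 2 * x 0 * x 1 * u 1 + x 1 ^ 2 * u 0) / (x 0 * detF x)) ^ 2 = 0 := by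
    linarith
  have z5 : (detF x)⁻¹ * (((th0 x u) ^ 2 * detF x + (x 0 * th1 x u - x 1 * th0 x u) ^ 2)
    / (x 0 * detF x)) = 0 := by linarith
  have z6 : (detF x)⁻¹ * (ups x u * ups x u) = 0 := by linarith
  have z7 : ((u 6) ^ 2 * detF x + (x 0 * u 7 - x 1 * u 6) ^ 2) / (x 0 * detF x) = 0 := by linarith
  have pair : ∀ a b : ℝ, a ^ 2 * detF x + (x 0 * b - x 1 * a) ^ 2 = 0 → a = 0 ∧ b = 0 := by
    intro a b hab
    have q1 : 0 ≤ a ^ 2 * detF x := by positivity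
    have q2 : 0 ≤ (x 0 * b - x 1 * a) ^ 2 := sq_nonneg _
    have ha : a = 0 := by
      have : a ^ 2 * detF x = 0 := by linarith
      simpa [hf.ne'] using this
    refine ⟨ha, ?_⟩
    have : (x 0 * b - x 1 * a) ^ 2 = 0 := by linarith
    simpa [ha, h0.ne'] using this
  have u0 : u 0 = 0 := by simpa [h0.ne'] using z2
  have u1 : u 1 = 0 := by simpa [h0.ne', hf.ne', u0] using z3
  have u2 : u 2 = 0 := by simpa [h0.ne', hf.ne', u0, u1] using z4
  obtain ⟨u6, u7⟩ := pair (u 6) (u 7) (by simpa [hx0f.ne', h0.ne', hf.ne'] using z7)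
  obtain ⟨t0, t1⟩ := pair (th0 x u) (th1 x u) (by simpa [hx0f.ne', h0.ne', hf.ne'] using z5)
  have y : ups x u = 0 := by simpa [hf.ne'] using z6
  have u5 : u 5 = 0 := by simpa [ups, psiX, u6, u7] using y
  have u3 : u 3 = 0 := by simpa [th0, chiF, psiX, u6, u7, u5] using t0
  have u4 : u 4 = 0 := by simpa [th1, chiF, psiX, u6, u7, u5] using t1
  ext i
  fin_cases i <;> assumption

theorem metric_eq_gram (x u w : Fin 8 → ℝ) :
    metric x u w = ∑ A, ∑ B, u A * w B * gram x A B := by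
  have := LinearMap.sum_repr_mul_repr_mul (B := metricForm x) (Pi.basisFun ℝ (Fin 8))
    (Pi.basisFun ℝ (Fin 8)) u w
  rw [← metricForm_apply, ← this, Finsupp.sum_fintype _ _ (by simp)]
  refine Finset.sum_congr rfl fun A _ => ?_
  rw [Finsupp.sum_fintype _ _ (by simp)]
  refine Finset.sum_congr rfl fun B _ => ?_
  simp [gram, mul_assoc]

theorem gram_inv_mul {x : Fin 8 → ℝ} (hx : x ∈ target) : IsUnit (gram x).det := by
  rw [isUnit_iff_ne_zero]
  intro h
  obtain ⟨v, hv, hv0⟩ := Matrix.exists_mulVec_eq_zero_iff.2 h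
  apply hv
  apply metric_self_eq_zero hx
  rw [metric_eq_gram]
  refine Finset.sum_eq_zero fun A _ => ?_
  have := congrFun hv0 A
  simp only [Matrix.mulVec, dotProduct, Pi.zero_apply] at this
  calc ∑ B, v A * v B * gram x A B = v A * ∑ B, gram x A B * v B := by
        rw [Finset.mul_sum]; exact Finset.sum_congr rfl fun B _ => by ring
    _ = 0 := by rw [this, mul_zero]

/-! ### The Levi-Civita connection -/

/-- The derivative of the `(0, 0)` entry of `F⁻¹` in the direction `c`. -/
def dgA (x c : Fin 8 → ℝ) : ℝ := -(m00 x c * gA x + m01 x c * gB x)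
/-- The derivative of the off-diagonal entry of `F⁻¹` in the direction `c`. -/
def dgB (x c : Fin 8 → ℝ) : ℝ := -(m00 x c * gB x + m01 x c * gC x)
/-- The derivative of the `(1, 1)` entry of `F⁻¹` in the direction `c`. -/
def dgC (x c : Fin 8 → ℝ) : ℝ := -(m10 x c * gB x + m11 x c * gC x)

/-- The derivative of the metric in the direction `c`. -/
def dMetric (x c u w : Fin 8 → ℝ) : ℝ :=
  1 / 2 * ((dgA x c * u 0 + 2 * dgB x c * u 1 + dgC x c * u 2) * (m00 x w + m11 x w)
    + (m00 x u + m11 x u) * (dgA x c * w 0 + 2 * dgB x c * w 1 + dgC x c * w 2))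
  + 1 / 2 * ((dgA x c * u 0 + dgB x c * u 1) * m00 x w + m00 x u * (dgA x c * w 0 + dgB x c * w 1)
    + (dgA x c * u 1 + dgB x c * u 2) * m10 x w + m01 x u * (dgB x c * w 0 + dgC x c * w 1)
    + (dgB x c * u 0 + dgC x c * u 1) * m01 x w + m10 x u * (dgA x c * w 1 + dgB x c * w 2)
    + (dgB x c * u 1 + dgC x c * u 2) * m11 x w + m11 x u * (dgB x c * w 1 + dgC x c * w 2))
  + (-((detF x)⁻¹ * (m00 x c + m11 x c)) * gIn x (th0 x u) (th1 x u) (th0 x w) (th1 x w)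
    + (detF x)⁻¹ * (dgA x c * (th0 x u * th0 x w)
      + dgB x c * (th0 x u * th1 x w + th1 x u * th0 x w) + dgC x c * (th1 x u * th1 x w)
      + gIn x (1 / √3 / 3 * psiX c u * x 6 + chiF x u * c 6)
          (1 / √3 / 3 * psiX c u * x 7 + chiF x u * c 7) (th0 x w) (th1 x w)
      + gIn x (th0 x u) (th1 x u) (1 / √3 / 3 * psiX c w * x 6 + chiF x w * c 6)
          (1 / √3 / 3 * psiX c w * x 7 + chiF x w * c 7)))
  + (-((detF x)⁻¹ * (m00 x c + m11 x c)) * (ups x u * ups x w)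
    + (detF x)⁻¹ * (1 / √3 * psiX c u * ups x w + ups x u * (1 / √3 * psiX c w)))
  + (dgA x c * (u 6 * w 6) + dgB x c * (u 6 * w 7 + u 7 * w 6) + dgC x c * (u 7 * w 7))

/-- The inputs are d(F⁻¹) = -F⁻¹ dF F⁻¹ and d(det F) = det F · Tr(F⁻¹ dF); the rest is the product
rule along the line x + t c. -/
theorem hasDerivAt_metric {x : Fin 8 → ℝ} (hf : detF x ≠ 0) (c u w : Fin 8 → ℝ) :
    HasDerivAt (fun t : ℝ => metric (x + t • c) u w) (dMetric x c u w) 0 := by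
  have hx : ∀ i, HasDerivAt (fun t : ℝ => (x + t • c) i) (c i) 0 := fun i => by
    simpa using ((hasDerivAt_id (0 : ℝ)).mul_const (c i)).const_add (x i)
  have h0 : ∀ i, (x + (0 : ℝ) • c) i = x i := by simp
  have hz : x + (0 : ℝ) • c = x := by simp
  have hdet : HasDerivAt (fun t : ℝ => detF (x + t • c)) (detF x * (m00 x c + m11 x c)) 0 := by
    have := ((hx 0).mul (hx 2)).sub ((hx 1).pow 2)
    simp only [h0] at this
    refine this.congr_deriv ?_
    simp only [m00, m11, gA, gB, gC]
    field_simp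
    ring
  have he : HasDerivAt (fun t : ℝ => (detF (x + t • c))⁻¹)
      (-((detF x)⁻¹ * (m00 x c + m11 x c))) 0 := by
    have := hdet.inv (by rw [hz]; exact hf)
    rw [hz] at this
    refine this.congr_deriv ?_
    field_simp
  have hA : HasDerivAt (fun t : ℝ => gA (x + t • c)) (dgA x c) 0 := by
    refine ((hx 2).mul he).congr_deriv ?_
    simp only [h0, hz, dgA, m00, m01, m11, gA, gB, gC]
    field_simp
    simp only [detF]; ring
  have hB : HasDerivAt (fun t : ℝ => gB (x + t • c)) (dgB x c) 0 := by
    refine ((hx 1).neg.mul he).congr_deriv ?_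
    simp only [h0, hz, dgB, m00, m01, m11, gA, gB, gC, Pi.neg_apply]
    field_simp
    simp only [detF]; ring
  have hC : HasDerivAt (fun t : ℝ => gC (x + t • c)) (dgC x c) 0 := by
    refine ((hx 0).mul he).congr_deriv ?_
    simp only [h0, hz, dgC, m00, m10, m11, gA, gB, gC]
    field_simp
    simp only [detF]; ring
  have h00 : ∀ u, HasDerivAt (fun t : ℝ => m00 (x + t • c) u) (dgA x c * u 0 + dgB x c * u 1) 0 :=
    fun u => (hA.mul_const _).add (hB.mul_const _)
  have h01 : ∀ u, HasDerivAt (fun t : ℝ => m01 (x + t • c) u) (dgA x c * u 1 + dgB x c * u 2) 0 :=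
    fun u => (hA.mul_const _).add (hB.mul_const _)
  have h10 : ∀ u, HasDerivAt (fun t : ℝ => m10 (x + t • c) u) (dgB x c * u 0 + dgC x c * u 1) 0 :=
    fun u => (hB.mul_const _).add (hC.mul_const _)
  have h11 : ∀ u, HasDerivAt (fun t : ℝ => m11 (x + t • c) u) (dgB x c * u 1 + dgC x c * u 2) 0 :=
    fun u => (hB.mul_const _).add (hC.mul_const _)
  have hpsi : ∀ u, HasDerivAt (fun t : ℝ => psiX (x + t • c) u) (psiX c u) 0 :=
    fun u => ((hx 6).mul_const _).sub ((hx 7).mul_const _)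
  have hups : ∀ u, HasDerivAt (fun t : ℝ => ups (x + t • c) u) (1 / √3 * psiX c u) 0 :=
    fun u => ((hpsi u).const_mul _).const_add _
  have hchi : ∀ u, HasDerivAt (fun t : ℝ => chiF (x + t • c) u) (1 / √3 / 3 * psiX c u) 0 :=
    fun u => ((hpsi u).const_mul _).const_add _
  have hth0 : ∀ u, HasDerivAt (fun t : ℝ => th0 (x + t • c) u)
      (1 / √3 / 3 * psiX c u * x 6 + chiF x u * c 6) 0 := fun u =>
    (((hchi u).mul (hx 6)).const_add (u 3)).congr_deriv (by simp only [h0, hz])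
  have hth1 : ∀ u, HasDerivAt (fun t : ℝ => th1 (x + t • c) u)
      (1 / √3 / 3 * psiX c u * x 7 + chiF x u * c 7) 0 := fun u =>
    (((hchi u).mul (hx 7)).const_add (u 4)).congr_deriv (by simp only [h0, hz])
  have hin : ∀ {a₀ a₁ b₀ b₁ : ℝ → ℝ} {a₀' a₁' b₀' b₁' : ℝ}, HasDerivAt a₀ a₀' 0 →
      HasDerivAt a₁ a₁' 0 → HasDerivAt b₀ b₀' 0 → HasDerivAt b₁ b₁' 0 →
      HasDerivAt (fun t : ℝ => gIn (x + t • c) (a₀ t) (a₁ t) (b₀ t) (b₁ t))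
        (dgA x c * (a₀ 0 * b₀ 0) + dgB x c * (a₀ 0 * b₁ 0 + a₁ 0 * b₀ 0) + dgC x c * (a₁ 0 * b₁ 0)
          + gIn x a₀' a₁' (b₀ 0) (b₁ 0) + gIn x (a₀ 0) (a₁ 0) b₀' b₁') 0 := by
    intro a₀ a₁ b₀ b₁ a₀' a₁' b₀' b₁' k₀ k₁ l₀ l₁
    refine (((hA.mul (k₀.mul l₀)).add (hB.mul ((k₀.mul l₁).add (k₁.mul l₀)))).add
      (hC.mul (k₁.mul l₁))).congr_deriv ?_
    simp only [hz, gIn, Pi.add_apply, Pi.mul_apply]; ring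
  have key := (((((((h00 u).add (h11 u)).mul ((h00 w).add (h11 w))).const_mul (1 / 2)).add
    ((((((h00 u).mul (h00 w)).add ((h01 u).mul (h10 w))).add ((h10 u).mul (h01 w))).add
      ((h11 u).mul (h11 w))).const_mul (1 / 2))).add
    (he.mul (hin (hth0 u) (hth1 u) (hth0 w) (hth1 w)))).add
    (he.mul ((hups u).mul (hups w)))).add
    (hin (hasDerivAt_const 0 (u 6)) (hasDerivAt_const 0 (u 7)) (hasDerivAt_const 0 (w 6))
      (hasDerivAt_const 0 (w 7)))
  have heq : (fun t : ℝ => metric (x + t • c) u w) = _ := funext fun t => metric_eq (x + t • c) u w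
  rw [heq]
  refine key.congr_deriv ?_
  simp only [hz, gIn, Pi.add_apply, Pi.mul_apply, dMetric]
  ring

theorem dMetric_comm (x c u w : Fin 8 → ℝ) : dMetric x c u w = dMetric x c w u := by
  simp only [dMetric, gIn]; ring

theorem dMetric_add_middle (x c u u' w : Fin 8 → ℝ) :
    dMetric x c (u + u') w = dMetric x c u w + dMetric x c u' w := by
  simp only [dMetric, gIn, m00, m01, m10, m11, th0, th1, ups, chiF, psiX, Pi.add_apply]; ring

theorem dMetric_smul_middle (x c : Fin 8 → ℝ) (r : ℝ) (u w : Fin 8 → ℝ) :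
    dMetric x c (r • u) w = r • dMetric x c u w := by
  simp only [dMetric, gIn, m00, m01, m10, m11, th0, th1, ups, chiF, psiX, Pi.smul_apply,
    smul_eq_mul]; ring

theorem dMetric_add_left (x c c' u w : Fin 8 → ℝ) :
    dMetric x (c + c') u w = dMetric x c u w + dMetric x c' u w := by
  simp only [dMetric, dgA, dgB, dgC, gIn, m00, m01, m10, m11, psiX, Pi.add_apply]; ring

theorem dMetric_smul_left (x : Fin 8 → ℝ) (r : ℝ) (c u w : Fin 8 → ℝ) :
    dMetric x (r • c) u w = r • dMetric x c u w := by
  simp only [dMetric, dgA, dgB, dgC, gIn, m00, m01, m10, m11, psiX, Pi.smul_apply, smul_eq_mul]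
  ring

theorem dMetric_eq_sum (x c u w : Fin 8 → ℝ) : dMetric x c u w =
    ∑ C, ∑ A, ∑ B, c C * u A * w B
      * dMetric x (Pi.single C 1) (Pi.single A 1) (Pi.single B 1) := by
  have hl : ∀ u w : Fin 8 → ℝ, dMetric x c u w = ∑ C, c C * dMetric x (Pi.single C 1) u w := by
    intro u w
    let l : (Fin 8 → ℝ) →ₗ[ℝ] ℝ :=
      { toFun := fun c => dMetric x c u w
        map_add' := fun a b => dMetric_add_left x a b u w
        map_smul' := fun r a => dMetric_smul_left x r a u w }
    have := LinearMap.pi_apply_eq_sum_univ l c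
    simp only [smul_eq_mul] at this
    refine this.trans (Finset.sum_congr rfl fun C _ => ?_)
    have hC : (Pi.single C 1 : Fin 8 → ℝ) = fun j => if C = j then 1 else 0 := by
      ext j; simp [Pi.single_apply, eq_comm]
    rw [hC]; rfl
  rw [hl]
  refine Finset.sum_congr rfl fun C _ => ?_
  let Bf : LinearMap.BilinForm ℝ (Fin 8 → ℝ) :=
    LinearMap.mk₂ ℝ (dMetric x (Pi.single C 1)) (dMetric_add_middle x _) (dMetric_smul_middle x _)
      (fun u w w' => by
        rw [dMetric_comm, dMetric_add_middle, dMetric_comm x _ w, dMetric_comm x _ w'])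
      (fun c u w => by rw [dMetric_comm, dMetric_smul_middle, dMetric_comm x _ w])
  have := LinearMap.sum_repr_mul_repr_mul (B := Bf) (Pi.basisFun ℝ (Fin 8))
    (Pi.basisFun ℝ (Fin 8)) u w
  rw [Finsupp.sum_fintype _ _ (by simp)] at this
  have h2 : dMetric x (Pi.single C 1) u w = Bf u w := rfl
  rw [h2, ← this, Finset.mul_sum]
  refine Finset.sum_congr rfl fun A _ => ?_
  rw [Finsupp.sum_fintype _ _ (by simp), Finset.mul_sum]
  refine Finset.sum_congr rfl fun B _ => ?_
  simp [Bf]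
  ring

theorem dGram_eq {x : Fin 8 → ℝ} (hf : detF x ≠ 0) (C A B : Fin 8) :
    dGram x C A B = dMetric x (Pi.single C 1) (Pi.single A 1) (Pi.single B 1) :=
  (hasDerivAt_metric hf _ _ _).deriv

theorem gram_symm (x : Fin 8 → ℝ) : (gram x)ᵀ = gram x := by
  ext A B
  exact metric_comm _ _ _

/-- The Koszul formula on the diagonal. The tension contains only Γ(u, u), which is determined by
its scalar products with all w, so no individual Christoffel symbol has to be computed. -/
theorem metric_christoffel {x : Fin 8 → ℝ} (hx : x ∈ target) (u w : Fin 8 → ℝ) :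
    metric x (fun A => ∑ B, ∑ C, christoffel x A B C * u B * u C) w
      = dMetric x u u w - 1 / 2 * dMetric x w u u := by
  have hf : detF x ≠ 0 := ((target_iff_det x).1 hx).2.ne'
  set N : Fin 8 → ℝ := fun D => 1 / 2 * ∑ B, ∑ C,
    (dGram x B D C + dGram x C D B - dGram x D B C) * u B * u C with hN
  have h1 : (fun A => ∑ B, ∑ C, christoffel x A B C * u B * u C) = (gram x)⁻¹ *ᵥ N := by
    ext A
    simp only [christoffel, Matrix.mulVec, dotProduct, hN, Finset.mul_sum, Finset.sum_mul]
    rw [Finset.sum_comm' (t' := Finset.univ) (s' := fun _ => Finset.univ) (by simp)]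
    conv_rhs => rw [Finset.sum_comm]
    rw [Finset.sum_comm]
    refine Finset.sum_congr rfl fun B _ => ?_
    conv_rhs => rw [Finset.sum_comm]
    refine Finset.sum_congr rfl fun C _ => Finset.sum_congr rfl fun D _ => ?_
    ring
  have h2 : ∀ v w : Fin 8 → ℝ, metric x v w = v ⬝ᵥ (gram x *ᵥ w) := by
    intro v w
    rw [metric_eq_gram]
    simp only [dotProduct, Matrix.mulVec, Finset.mul_sum]
    exact Finset.sum_congr rfl fun A _ => Finset.sum_congr rfl fun B _ => by ring
  rw [h1, h2, Matrix.dotProduct_mulVec, Matrix.vecMul_mulVec, ← gram_symm, ← Matrix.transpose_mul,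
    gram_symm, Matrix.mul_nonsing_inv _ (gram_inv_mul hx), Matrix.transpose_one, Matrix.vecMul_one]
  simp only [dotProduct, hN]
  simp only [dGram_eq hf]
  rw [dMetric_eq_sum x u u w, dMetric_eq_sum x w u u]
  -- Since both lower slots are filled with u, the first two terms of the Christoffel symbol
  -- contribute equally. Together they give the coefficient 1, and the third term gives -1/2.
  have s1 : ∑ D, (1 / 2 * ∑ B, ∑ C, dMetric x (Pi.single B 1) (Pi.single D 1) (Pi.single C 1)
      * u B * u C) * w D = 1 / 2 * ∑ C, ∑ A, ∑ B, u C * u A * w B *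
        dMetric x (Pi.single C 1) (Pi.single A 1) (Pi.single B 1) := by
    simp only [Finset.mul_sum, Finset.sum_mul]
    rw [Finset.sum_comm]
    refine Finset.sum_congr rfl fun B _ => ?_
    rw [Finset.sum_comm]
    refine Finset.sum_congr rfl fun C _ => Finset.sum_congr rfl fun D _ => ?_
    rw [dMetric_comm]; ring
  have s2 : ∑ D, (1 / 2 * ∑ B, ∑ C, dMetric x (Pi.single C 1) (Pi.single D 1) (Pi.single B 1)
      * u B * u C) * w D = 1 / 2 * ∑ C, ∑ A, ∑ B, u C * u A * w B *
        dMetric x (Pi.single C 1) (Pi.single A 1) (Pi.single B 1) := by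
    rw [← s1]
    refine Finset.sum_congr rfl fun D _ => ?_
    rw [Finset.sum_comm]
    congr 2
    exact Finset.sum_congr rfl fun B _ => Finset.sum_congr rfl fun C _ => by ring
  have s3 : ∑ D, (1 / 2 * ∑ B, ∑ C, dMetric x (Pi.single D 1) (Pi.single B 1) (Pi.single C 1)
      * u B * u C) * w D = 1 / 2 * ∑ C, ∑ A, ∑ B, w C * u A * u B *
        dMetric x (Pi.single C 1) (Pi.single A 1) (Pi.single B 1) := by
    simp only [Finset.mul_sum, Finset.sum_mul]
    refine Finset.sum_congr rfl fun D _ => Finset.sum_congr rfl fun B _ =>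
      Finset.sum_congr rfl fun C _ => by ring
  have : ∀ D, (1 / 2 * ∑ B, ∑ C, (dMetric x (Pi.single B 1) (Pi.single D 1) (Pi.single C 1)
      + dMetric x (Pi.single C 1) (Pi.single D 1) (Pi.single B 1)
      - dMetric x (Pi.single D 1) (Pi.single B 1) (Pi.single C 1)) * u B * u C) * w D
      = (1 / 2 * ∑ B, ∑ C, dMetric x (Pi.single B 1) (Pi.single D 1) (Pi.single C 1)
      * u B * u C) * w D + (1 / 2 * ∑ B, ∑ C, dMetric x (Pi.single C 1) (Pi.single D 1)
      (Pi.single B 1) * u B * u C) * w D - (1 / 2 * ∑ B, ∑ C, dMetric x (Pi.single D 1)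
      (Pi.single B 1) (Pi.single C 1) * u B * u C) * w D := by
    intro D
    simp only [add_mul, sub_mul, Finset.sum_add_distrib, Finset.sum_sub_distrib, mul_add, mul_sub]
  simp only [this, Finset.sum_add_distrib, Finset.sum_sub_distrib, s1, s2, s3]
  ring

/-! The quadratic part of the geodesic equation in the coframe `(F⁻¹dF, Θ, Υ, dψ)`. -/

/-- The component `Υ` of the quadratic part of the geodesic equation. -/
def gamUps (x u : Fin 8 → ℝ) : ℝ :=
  -(m00 x u + m11 x u) * ups x u + gIn x (th0 x u) (th1 x u) (u 6) (u 7)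

/-- The first component `Θ` of the quadratic part of the geodesic equation. -/
def gamTh0 (x u : Fin 8 → ℝ) : ℝ :=
  chiF x u * u 6 - (m00 x u + m11 x u) * th0 x u - (m00 x u * th0 x u + m10 x u * th1 x u)

/-- The second component `Θ` of the quadratic part of the geodesic equation. -/
def gamTh1 (x u : Fin 8 → ℝ) : ℝ :=
  chiF x u * u 7 - (m00 x u + m11 x u) * th1 x u - (m01 x u * th0 x u + m11 x u * th1 x u)

/-- The first component of the `ψ`-part of the quadratic part of the geodesic equation. -/
def gamPsi0 (x u : Fin 8 → ℝ) : ℝ :=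
  -(m00 x u * u 6 + m10 x u * u 7) - (detF x)⁻¹ * ups x u * th0 x u
    - 2 * (1 / √3) * (detF x)⁻¹ * ups x u * (x 0 * u 7 - x 1 * u 6)

/-- The second component of the `ψ`-part of the quadratic part of the geodesic equation. -/
def gamPsi1 (x u : Fin 8 → ℝ) : ℝ :=
  -(m01 x u * u 6 + m11 x u * u 7) - (detF x)⁻¹ * ups x u * th1 x u
    - 2 * (1 / √3) * (detF x)⁻¹ * ups x u * (x 1 * u 7 - x 2 * u 6)

/-- The trace term in the `F`-part of the quadratic part of the geodesic equation. -/
def gamTr (x u : Fin 8 → ℝ) : ℝ :=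
  1 / 3 * ((detF x)⁻¹ * ups x u ^ 2 - gIn x (u 6) (u 7) (u 6) (u 7))

/-- The quadratic part of the geodesic equation: the vector `Γ^A_{BC} u^B u^C`. -/
def gam (x u : Fin 8 → ℝ) : Fin 8 → ℝ :=
  let c := gamUps x u - 1 / √3 * (x 6 * gamPsi1 x u - x 7 * gamPsi0 x u)
  let d := c + 1 / √3 / 3 * (x 6 * gamPsi1 x u - x 7 * gamPsi0 x u)
  ![-(m00 x u * u 0 + m10 x u * u 1) + (detF x)⁻¹ * th0 x u ^ 2 + u 6 ^ 2 + gamTr x u * x 0,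
    -(m00 x u * u 1 + m10 x u * u 2) + (detF x)⁻¹ * (th0 x u * th1 x u) + u 6 * u 7
      + gamTr x u * x 1,
    -(m01 x u * u 1 + m11 x u * u 2) + (detF x)⁻¹ * th1 x u ^ 2 + u 7 ^ 2 + gamTr x u * x 2,
    gamTh0 x u - d * x 6, gamTh1 x u - d * x 7, c, gamPsi0 x u, gamPsi1 x u]

@[simp] theorem th0_gam (x u : Fin 8 → ℝ) : th0 x (gam x u) = gamTh0 x u := by
  simp [th0, chiF, psiX, gam]

@[simp] theorem th1_gam (x u : Fin 8 → ℝ) : th1 x (gam x u) = gamTh1 x u := by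
  simp [th1, chiF, psiX, gam]

@[simp] theorem ups_gam (x u : Fin 8 → ℝ) : ups x (gam x u) = gamUps x u := by
  simp [ups, psiX, gam]

@[simp] theorem gam_six (x u : Fin 8 → ℝ) : gam x u 6 = gamPsi0 x u := rfl

@[simp] theorem gam_seven (x u : Fin 8 → ℝ) : gam x u 7 = gamPsi1 x u := rfl

theorem inv_mul_F {x : Fin 8 → ℝ} (hf : detF x ≠ 0) :
    gA x * x 0 + gB x * x 1 = 1 ∧ gA x * x 1 + gB x * x 2 = 0 ∧ gB x * x 0 + gC x * x 1 = 0 ∧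
      gB x * x 1 + gC x * x 2 = 1 := by
  refine ⟨?_, ?_, ?_, ?_⟩ <;> simp only [gA, gB, gC]
  · field_simp; simp only [detF]; ring
  · ring
  · ring
  · field_simp; simp only [detF]; ring

theorem m00_gam {x : Fin 8 → ℝ} (hf : detF x ≠ 0) (u : Fin 8 → ℝ) :
    m00 x (gam x u) = -(m00 x u * m00 x u + m01 x u * m10 x u)
      + (detF x)⁻¹ * ((gA x * th0 x u + gB x * th1 x u) * th0 x u)
      + (gA x * u 6 + gB x * u 7) * u 6 + gamTr x u := by
  obtain ⟨i1, -, -, -⟩ := inv_mul_F hf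
  conv_lhs => simp only [m00, gam, Matrix.cons_val_zero, Matrix.cons_val_one]
  simp only [m00, m01, m10]
  linear_combination gamTr x u * i1

theorem m01_gam {x : Fin 8 → ℝ} (hf : detF x ≠ 0) (u : Fin 8 → ℝ) :
    m01 x (gam x u) = -(m00 x u * m01 x u + m01 x u * m11 x u)
      + (detF x)⁻¹ * ((gA x * th0 x u + gB x * th1 x u) * th1 x u)
      + (gA x * u 6 + gB x * u 7) * u 7 := by
  obtain ⟨-, i2, -, -⟩ := inv_mul_F hf
  conv_lhs => simp only [m01, gam, Matrix.cons_val, Matrix.cons_val_one]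
  simp only [m00, m01, m10, m11]
  linear_combination gamTr x u * i2

theorem m10_gam {x : Fin 8 → ℝ} (hf : detF x ≠ 0) (u : Fin 8 → ℝ) :
    m10 x (gam x u) = -(m10 x u * m00 x u + m11 x u * m10 x u)
      + (detF x)⁻¹ * ((gB x * th0 x u + gC x * th1 x u) * th0 x u)
      + (gB x * u 6 + gC x * u 7) * u 6 := by
  obtain ⟨-, -, i3, -⟩ := inv_mul_F hf
  conv_lhs => simp only [m10, gam, Matrix.cons_val_zero, Matrix.cons_val_one]
  simp only [m00, m10, m11]
  linear_combination gamTr x u * i3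

theorem m11_gam {x : Fin 8 → ℝ} (hf : detF x ≠ 0) (u : Fin 8 → ℝ) :
    m11 x (gam x u) = -(m10 x u * m01 x u + m11 x u * m11 x u)
      + (detF x)⁻¹ * ((gB x * th0 x u + gC x * th1 x u) * th1 x u)
      + (gB x * u 6 + gC x * u 7) * u 7 + gamTr x u := by
  obtain ⟨-, -, -, i4⟩ := inv_mul_F hf
  conv_lhs => simp only [m11, gam, Matrix.cons_val, Matrix.cons_val_one]
  simp only [m00, m01, m10, m11]
  linear_combination gamTr x u * i4

/-- This is the verification that `gam` satisfies the Koszul identity. It is carried out in the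
coframe, where the components of `gam` are short. -/
theorem metric_gam {x : Fin 8 → ℝ} (hf : detF x ≠ 0) (u w : Fin 8 → ℝ) :
    metric x (gam x u) w = dMetric x u u w - 1 / 2 * dMetric x w u u := by
  obtain ⟨i1, i2, i3, i4⟩ := inv_mul_F hf
  -- The last terms of `gamPsi0` and `gamPsi1` are F applied to a rotated dψ. Pairing them through
  -- F⁻¹ needs F⁻¹F = 1, the one relation `ring` cannot supply; afterwards the identity is formal.
  have p0 : gIn x (gamPsi0 x u) (gamPsi1 x u) (w 6) (w 7) =
      gIn x (-(m00 x u * u 6 + m10 x u * u 7) - (detF x)⁻¹ * ups x u * th0 x u)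
        (-(m01 x u * u 6 + m11 x u * u 7) - (detF x)⁻¹ * ups x u * th1 x u) (w 6) (w 7)
      - 2 * (1 / √3) * (detF x)⁻¹ * ups x u * (u 7 * w 6 - u 6 * w 7) := by
    simp only [gIn, gamPsi0, gamPsi1]
    linear_combination (-2 * (1 / √3) * (detF x)⁻¹ * ups x u) *
      (i1 * (u 7 * w 6) + i3 * (u 7 * w 7) - i2 * (u 6 * w 6) - i4 * (u 6 * w 7))
  rw [metric_eq, m00_gam hf, m01_gam hf, m10_gam hf, m11_gam hf, th0_gam, th1_gam, ups_gam, gam_six, gam_seven, p0]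
  simp only [dMetric, dgA, dgB, dgC, gIn, gamTh0, gamTh1, gamUps, gamTr, ups, th0, th1, chiF, psiX,
    m00, m01, m10, m11]
  ring

/-! ### Second order jets -/

/-- `a` and `b` are the first and second derivative of `u` at `t`. -/
def HasJet (u : ℝ → ℝ) (t a b : ℝ) : Prop :=
  ∃ u' : ℝ → ℝ, u' t = a ∧ (∀ᶠ r in 𝓝 t, HasDerivAt u (u' r) r) ∧ HasDerivAt u' b t

namespace HasJet

variable {u v : ℝ → ℝ} {t a b c d : ℝ}

theorem hasDerivAt (h : HasJet u t a b) : HasDerivAt u a t := by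
  obtain ⟨u', rfl, h1, -⟩ := h
  exact h1.self_of_nhds

theorem const (c t : ℝ) : HasJet (fun _ => c) t 0 0 :=
  ⟨fun _ => 0, rfl, Filter.Eventually.of_forall fun r => hasDerivAt_const r c, hasDerivAt_const t 0⟩

theorem id (t : ℝ) : HasJet (fun r => r) t 1 0 :=
  ⟨fun _ => 1, rfl, Filter.Eventually.of_forall fun r => hasDerivAt_id r, hasDerivAt_const t 1⟩

theorem add (h : HasJet u t a b) (k : HasJet v t c d) :
    HasJet (fun r => u r + v r) t (a + c) (b + d) := by
  obtain ⟨u', rfl, h1, h2⟩ := h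
  obtain ⟨v', rfl, k1, k2⟩ := k
  exact ⟨fun r => u' r + v' r, rfl, by filter_upwards [h1, k1] with r x y using x.add y, h2.add k2⟩

theorem mul (h : HasJet u t a b) (k : HasJet v t c d) :
    HasJet (fun r => u r * v r) t (a * v t + u t * c) (b * v t + 2 * (a * c) + u t * d) := by
  have hu := h.hasDerivAt
  have hv := k.hasDerivAt
  obtain ⟨u', rfl, h1, h2⟩ := h
  obtain ⟨v', rfl, k1, k2⟩ := k
  refine ⟨fun r => u' r * v r + u r * v' r, rfl, by
    filter_upwards [h1, k1] with r x y using x.mul y, ?_⟩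
  exact ((h2.mul hv).add (hu.mul k2)).congr_deriv (by ring)

theorem comp {f : ℝ → ℝ} (h : HasJet f (u t) a b) (k : HasJet u t c d) :
    HasJet (fun r => f (u r)) t (a * c) (b * c ^ 2 + a * d) := by
  have hu := k.hasDerivAt
  obtain ⟨f', rfl, h1, h2⟩ := h
  obtain ⟨u', rfl, k1, k2⟩ := k
  refine ⟨fun r => f' (u r) * u' r, rfl, ?_, ?_⟩
  · filter_upwards [hu.continuousAt.eventually h1, k1] with r x y using x.comp r y
  · exact ((h2.comp t hu).mul k2).congr_deriv (by simp only [Function.comp_apply]; ring)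

theorem congr (h : HasJet u t a b) (hv : v =ᶠ[𝓝 t] u) : HasJet v t a b := by
  obtain ⟨u', rfl, h1, h2⟩ := h
  refine ⟨u', rfl, ?_, h2⟩
  filter_upwards [h1, hv.eventuallyEq_nhds] with r x y using x.congr_of_eventuallyEq y

theorem cast (h : HasJet u t a b) (ha : a = c) (hb : b = d) : HasJet u t c d := by
  subst ha hb; exact h

theorem of_contDiffAt (h : ContDiffAt ℝ 2 u t) : HasJet u t (deriv u t) (deriv (deriv u) t) := by
  refine ⟨deriv u, rfl, ?_, ?_⟩
  · filter_upwards [h.eventually (by simp)] with r hr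
    exact (hr.differentiableAt (by simp)).hasDerivAt
  · have : ContDiffAt ℝ 1 (fun r => fderiv ℝ u r 1) t :=
      (h.fderiv_right (m := 1) (by norm_num)).clm_apply contDiffAt_const
    simp only [fderiv_apply_one_eq_deriv] at this
    exact (this.differentiableAt (by simp)).hasDerivAt

end HasJet

/-- The derivatives of a function of `(ρ², z)` which enter the tension. -/
structure CylJet (h : ℝ × ℝ → ℝ) (q : ℝ × ℝ) (hs hz hss hzz : ℝ) : Prop where
  smooth : ContDiffAt ℝ 2 h q
  s : HasJet (fun t => h (t, q.2)) q.1 hs hss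
  z : HasJet (fun t => h (q.1, t)) q.2 hz hzz

namespace CylJet

variable {h k : ℝ × ℝ → ℝ} {q : ℝ × ℝ} {a b c d a' b' c' d' : ℝ}

theorem const (r : ℝ) (q : ℝ × ℝ) : CylJet (fun _ => r) q 0 0 0 0 :=
  ⟨contDiffAt_const, .const _ _, .const _ _⟩

theorem fst (q : ℝ × ℝ) : CylJet (fun p => p.1) q 1 0 0 0 :=
  ⟨contDiffAt_fst, .id _, .const _ _⟩

theorem add (H : CylJet h q a b c d) (K : CylJet k q a' b' c' d') :
    CylJet (fun p => h p + k p) q (a + a') (b + b') (c + c') (d + d') :=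
  ⟨H.smooth.add K.smooth, H.s.add K.s, H.z.add K.z⟩

theorem mul (H : CylJet h q a b c d) (K : CylJet k q a' b' c' d') :
    CylJet (fun p => h p * k p) q (a * k q + h q * a') (b * k q + h q * b')
      (c * k q + 2 * (a * a') + h q * c') (d * k q + 2 * (b * b') + h q * d') :=
  ⟨H.smooth.mul K.smooth, H.s.mul K.s, H.z.mul K.z⟩

theorem congr (H : CylJet h q a b c d) (hk : k =ᶠ[𝓝 q] h) : CylJet k q a b c d := by
  have c1 : ContinuousAt (fun t : ℝ => (t, q.2)) q.1 := by fun_prop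
  have c2 : ContinuousAt (fun t : ℝ => (q.1, t)) q.2 := by fun_prop
  exact ⟨H.smooth.congr_of_eventuallyEq hk, H.s.congr (c1.eventually hk),
    H.z.congr (c2.eventually hk)⟩

theorem cast (H : CylJet h q a b c d) (ha : a = a') (hb : b = b') (hc : c = c') (hd : d = d') :
    CylJet h q a' b' c' d' := by
  subst ha hb hc hd; exact H

theorem const_mul (H : CylJet h q a b c d) (r : ℝ) :
    CylJet (fun p => r * h p) q (r * a) (r * b) (r * c) (r * d) :=
  ((const r q).mul H).cast (by ring) (by ring) (by ring) (by ring)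

theorem add_const (H : CylJet h q a b c d) (r : ℝ) :
    CylJet (fun p => h p + r) q a b c d :=
  (H.add (const r q)).cast (by ring) (by ring) (by ring) (by ring)

theorem comp {f : ℝ → ℝ} {m n : ℝ} (H : CylJet h q a b c d) (hf : ContDiffAt ℝ 2 f (h q))
    (F : HasJet f (h q) m n) :
    CylJet (fun p => f (h p)) q (m * a) (m * b) (n * a ^ 2 + m * c) (n * b ^ 2 + m * d) :=
  ⟨hf.comp q H.smooth, F.comp H.s, F.comp H.z⟩

/-- A function of `z` alone. -/
theorem of_snd {f : ℝ → ℝ} {m n : ℝ} (hf : ContDiffAt ℝ 2 f q.2) (F : HasJet f q.2 m n) :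
    CylJet (fun p => f p.2) q 0 m 0 n :=
  ⟨hf.comp q contDiffAt_snd, HasJet.const (f q.2) q.1, F⟩

end CylJet

/-- The point is the continuity of the derivatives at q₀: it turns a formula for |τ|² in terms of
jets into a local bound. Three derivatives of `h` are used, the last one only to make the second
ones continuous. -/
theorem exists_cylJet {h : ℝ × ℝ → ℝ} {q₀ : ℝ × ℝ} (hh : ContDiffAt ℝ ∞ h q₀) :
    ∃ hs hz hss hzz : ℝ × ℝ → ℝ, ContinuousAt hs q₀ ∧ ContinuousAt hz q₀ ∧ ContinuousAt hss q₀ ∧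
      ContinuousAt hzz q₀ ∧ ∀ᶠ q in 𝓝 q₀, CylJet h q (hs q) (hz q) (hss q) (hzz q) := by
  have dir : ∀ v : ℝ × ℝ, ∃ d d' : ℝ × ℝ → ℝ, ContinuousAt d q₀ ∧ ContinuousAt d' q₀ ∧
      ∀ᶠ q in 𝓝 q₀, (∀ᶠ p in 𝓝 q, HasLineDerivAt ℝ h (d p) p v) ∧ HasLineDerivAt ℝ d (d' q) q v := by
    intro v
    have h3 : ContDiffAt ℝ 3 h q₀ :=
      by exact_mod_cast contDiffAt_infty.1 hh 3
    have h2 : ContDiffAt ℝ 2 (fun q => fderiv ℝ h q v) q₀ :=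
      (h3.fderiv_right (m := 2) (by norm_num)).clm_apply contDiffAt_const
    have h1 : ContDiffAt ℝ 1 (fun q => fderiv ℝ (fun q => fderiv ℝ h q v) q v) q₀ :=
      (h2.fderiv_right (m := 1) (by norm_num)).clm_apply contDiffAt_const
    refine ⟨_, _, h2.continuousAt, h1.continuousAt, ?_⟩
    filter_upwards [(h3.eventually (by simp)).eventually_nhds, h2.eventually (by simp)]
      with q hq hq2
    refine ⟨?_, ((hq2.differentiableAt (by simp)).hasFDerivAt).hasLineDerivAt v⟩
    filter_upwards [hq] with p hp
    exact ((hp.differentiableAt (by simp)).hasFDerivAt).hasLineDerivAt v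
  obtain ⟨ds, ds', c1, c2, hs⟩ := dir (1, 0)
  obtain ⟨dz, dz', c3, c4, hz⟩ := dir (0, 1)
  refine ⟨ds, dz, ds', dz', c1, c3, c2, c4, ?_⟩
  have h2 : ContDiffAt ℝ 2 h q₀ :=
    by exact_mod_cast contDiffAt_infty.1 hh 2
  have lift1 : ∀ {k : ℝ × ℝ → ℝ} {k' : ℝ} {p : ℝ × ℝ}, HasLineDerivAt ℝ k k' p (1, 0) →
      HasDerivAt (fun t => k (t, p.2)) k' p.1 := by
    intro k k' p H
    have H' : HasDerivAt (fun t : ℝ => k (p + t • ((1 : ℝ), (0 : ℝ)))) k' (p.1 - p.1) := by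
      rw [sub_self]; exact H
    refine (H'.comp_sub_const p.1 p.1).congr_of_eventuallyEq (Filter.Eventually.of_forall fun t => ?_)
    change k (t, p.2) = k _
    congr 1
    ext <;> simp
  have lift2 : ∀ {k : ℝ × ℝ → ℝ} {k' : ℝ} {p : ℝ × ℝ}, HasLineDerivAt ℝ k k' p (0, 1) →
      HasDerivAt (fun t => k (p.1, t)) k' p.2 := by
    intro k k' p H
    have H' : HasDerivAt (fun t : ℝ => k (p + t • ((0 : ℝ), (1 : ℝ)))) k' (p.2 - p.2) := by
      rw [sub_self]; exact H
    refine (H'.comp_sub_const p.2 p.2).congr_of_eventuallyEq (Filter.Eventually.of_forall fun t => ?_)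
    change k (p.1, t) = k _
    congr 1
    ext <;> simp
  filter_upwards [hs, hz, h2.eventually (by simp)] with q hq1 hq2 hq
  have k1 : ContinuousAt (fun t : ℝ => (t, q.2)) q.1 := by fun_prop
  have k2 : ContinuousAt (fun t : ℝ => (q.1, t)) q.2 := by fun_prop
  refine ⟨hq, ⟨fun t => ds (t, q.2), rfl, ?_, lift1 hq1.2⟩, ⟨fun t => dz (q.1, t), rfl, ?_, lift2 hq2.2⟩⟩
  · filter_upwards [k1.eventually hq1.1] with t ht using lift1 ht
  · filter_upwards [k2.eventually hq2.1] with t ht using lift2 ht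

/-! ### The tension of maps depending on `(ρ², z)` -/

/-- The coordinates `(ρ², z)`. -/
def cyl (x : E3) : ℝ × ℝ := (rhoSq x, x 2)

theorem contDiff_cyl {n : WithTop ℕ∞} : ContDiff ℝ n cyl := by
  unfold cyl rhoSq
  have h : ∀ i : Fin 3, ContDiff ℝ n fun x : E3 => x i := fun i => contDiff_piLp_apply 2
  exact ((h 0).pow 2 |>.add ((h 1).pow 2)).prodMk (h 2)

theorem fderiv_fderiv_of_hasJet {E : Type*} [NormedAddCommGroup E] [NormedSpace ℝ E] {f : E → ℝ}
    {p v : E} {a b : ℝ} (hf : ContDiffAt ℝ 2 f p)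
    (h : HasJet (fun t => f (p + t • v)) 0 a b) : fderiv ℝ (fderiv ℝ f) p v v = b := by
  obtain ⟨u', -, h1, h2⟩ := h
  have hline : ∀ t : ℝ, HasDerivAt (fun t : ℝ => p + t • v) v t := fun t => by
    simpa using ((hasDerivAt_id t).smul_const v).const_add p
  have hz : p + (0 : ℝ) • v = p := by simp
  have k1 : ∀ᶠ t in 𝓝 (0 : ℝ), HasDerivAt (fun t => f (p + t • v)) (fderiv ℝ f (p + t • v) v) t := by
    have : Filter.Tendsto (fun t : ℝ => p + t • v) (𝓝 0) (𝓝 p) := by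
      simpa [hz] using (hline 0).continuousAt.tendsto
    filter_upwards [this.eventually (hf.eventually (by simp))] with t ht
    exact (ht.differentiableAt (by simp)).hasFDerivAt.comp_hasDerivAt t (hline t)
  have k2 : HasDerivAt (fun t : ℝ => fderiv ℝ f (p + t • v) v) (fderiv ℝ (fderiv ℝ f) p v v) 0 := by
    have A : HasFDerivAt (fderiv ℝ f) (fderiv ℝ (fderiv ℝ f) p) p :=
      ((hf.fderiv_right (m := 1) (by norm_num)).differentiableAt (by simp)).hasFDerivAt
    have B := (ContinuousLinearMap.apply ℝ ℝ v).hasFDerivAt.comp p A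
    exact B.comp_hasDerivAt_of_eq (0 : ℝ) (hline 0) hz.symm
  have heq : (fun t : ℝ => fderiv ℝ f (p + t • v) v) =ᶠ[𝓝 0] u' := by
    filter_upwards [h1, k1] with t x y using y.unique x
  exact (k2.congr_of_eventuallyEq heq.symm).unique h2

/-- Moving p in the first or second coordinate direction changes ρ² quadratically and leaves z
fixed, so the chain rule for second order jets applies. -/
theorem CylJet.lines {h : ℝ × ℝ → ℝ} {p : E3} {a b c d : ℝ} (H : CylJet h (cyl p) a b c d) :
    HasJet (fun t : ℝ => h (cyl (p + t • EuclideanSpace.single 0 1))) 0 (2 * p 0 * a)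
      (4 * p 0 ^ 2 * c + 2 * a) ∧
    HasJet (fun t : ℝ => h (cyl (p + t • EuclideanSpace.single 1 1))) 0 (2 * p 1 * a)
      (4 * p 1 ^ 2 * c + 2 * a) ∧
    HasJet (fun t : ℝ => h (cyl (p + t • EuclideanSpace.single 2 1))) 0 b d := by
  have sq : ∀ r r' : ℝ, HasJet (fun t : ℝ => (r + t) ^ 2 + r') 0 (2 * r) 2 := by
    intro r r'
    have l := (HasJet.const r 0).add (HasJet.id 0)
    refine (((l.mul l).add (HasJet.const r' 0)).congr
      (Filter.Eventually.of_forall fun t => by ring)).cast ?_ ?_ <;> ring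
  refine ⟨?_, ?_, ?_⟩
  · have e : HasJet (fun t => h (t, p 2)) ((fun t : ℝ => (p 0 + t) ^ 2 + p 1 ^ 2) 0) a c := by
      simpa [cyl, rhoSq] using H.s
    refine ((HasJet.comp (u := fun t => (p 0 + t) ^ 2 + p 1 ^ 2) e (sq (p 0) (p 1 ^ 2))).cast (by ring) (by ring)).congr
      (Filter.Eventually.of_forall fun t => ?_)
    simp [cyl, rhoSq]
  · have e : HasJet (fun t => h (t, p 2)) ((fun t : ℝ => (p 1 + t) ^ 2 + p 0 ^ 2) 0) a c := by
      simpa [cyl, rhoSq, add_comm] using H.s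
    refine ((HasJet.comp (u := fun t => (p 1 + t) ^ 2 + p 0 ^ 2) e (sq (p 1) (p 0 ^ 2))).cast (by ring) (by ring)).congr
      (Filter.Eventually.of_forall fun t => ?_)
    simp [cyl, rhoSq, add_comm]
  · have l := (HasJet.const (p 2) 0).add (HasJet.id 0)
    have e : HasJet (fun t => h (rhoSq p, t)) ((fun t : ℝ => p 2 + t) 0) b d := by
      simpa [cyl] using H.z
    refine ((HasJet.comp (u := fun t => p 2 + t) e l).cast (by ring) (by ring)).congr (Filter.Eventually.of_forall fun t => ?_)
    simp [cyl, rhoSq]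

/-- In the variable s = ρ² the Laplacian is 4s ∂ₛ² + 4 ∂ₛ + ∂_z², which is regular at s = 0. This is
the reason for working with ρ² and not with ρ. -/
theorem CylJet.laplacian {h : ℝ × ℝ → ℝ} {p : E3} {a b c d : ℝ} (H : CylJet h (cyl p) a b c d) :
    (Δ (fun x => h (cyl x))) p = 4 * rhoSq p * c + 4 * a + d := by
  have hf : ContDiffAt ℝ 2 (fun x => h (cyl x)) p := H.smooth.comp p contDiff_cyl.contDiffAt
  obtain ⟨l0, l1, l2⟩ := H.lines
  rw [InnerProductSpace.laplacian_eq_iteratedFDeriv_orthonormalBasis _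
    (EuclideanSpace.basisFun (Fin 3) ℝ)]
  simp only [Fin.sum_univ_three, iteratedFDeriv_two_apply, EuclideanSpace.basisFun_apply,
    Matrix.cons_val_zero, Matrix.cons_val_one]
  rw [fderiv_fderiv_of_hasJet hf l0, fderiv_fderiv_of_hasJet hf l1, fderiv_fderiv_of_hasJet hf l2]
  simp only [rhoSq]
  ring

/-- Both sides have the same scalar product with every w, by the Koszul formula, and the metric is
definite. -/
theorem christoffel_eq_gam {x : Fin 8 → ℝ} (hx : x ∈ target) (u : Fin 8 → ℝ) (A : Fin 8) :
    ∑ B, ∑ C, christoffel x A B C * u B * u C = gam x u A := by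
  have hf : detF x ≠ 0 := ((target_iff_det x).1 hx).2.ne'
  set v : Fin 8 → ℝ := fun A => ∑ B, ∑ C, christoffel x A B C * u B * u C
  have h : ∀ w, metric x (v + (-1 : ℝ) • gam x u) w = 0 := by
    intro w
    rw [metric_add_left, metric_smul_left, metric_christoffel hx, metric_gam hf]; ring
  have := congrFun (metric_self_eq_zero hx (h _)) A
  simp only [Pi.add_apply, Pi.smul_apply, Pi.zero_apply, smul_eq_mul] at this
  change v A = _
  linarith

theorem gam_smul (x u : Fin 8 → ℝ) (r : ℝ) : gam x (r • u) = r ^ 2 • gam x u := by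
  ext i
  fin_cases i <;>
  simp [gam, gamTr, gamUps, gamTh0, gamTh1, gamPsi0, gamPsi1, gIn, ups, th0, th1, chiF, psiX, m00,
    m01, m10, m11] <;> ring

/-- The tension at a point with `ρ² = s` and value `x` of a map with the given derivatives with
respect to `ρ²` and `z`. -/
def cylTension (s : ℝ) (x xs xz xss xzz : Fin 8 → ℝ) : Fin 8 → ℝ :=
  (4 * s) • (xss + gam x xs) + (4 : ℝ) • xs + (xzz + gam x xz)

/-- The two horizontal derivatives are both multiples of ∂ₛX, and `gam` is homogeneous of degree
two, so together they contribute 4ρ² times `gam` of ∂ₛX. -/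
theorem tension_cyl {X : ℝ × ℝ → Fin 8 → ℝ} {p : E3} {xs xz xss xzz : Fin 8 → ℝ}
    (H : ∀ A, CylJet (fun q => X q A) (cyl p) (xs A) (xz A) (xss A) (xzz A))
    (ht : X (cyl p) ∈ target) :
    tension (fun x => X (cyl x)) p = cylTension (rhoSq p) (X (cyl p)) xs xz xss xzz := by
  ext A
  have hd : ∀ a : Fin 3, partialD (fun x => X (cyl x)) p a
      = (![(2 * p 0) • xs, (2 * p 1) • xs, xz] : Fin 3 → Fin 8 → ℝ) a := by
    intro a
    ext B
    obtain ⟨l0, l1, l2⟩ := (H B).lines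
    fin_cases a
    · exact l0.hasDerivAt.deriv
    · exact l1.hasDerivAt.deriv
    · exact l2.hasDerivAt.deriv
  unfold tension
  rw [(H A).laplacian]
  simp only [hd, christoffel_eq_gam ht, Fin.sum_univ_three, Matrix.cons_val_zero, Matrix.cons_val_one,
    Matrix.cons_val, gam_smul, cylTension, Pi.add_apply, Pi.smul_apply, smul_eq_mul, rhoSq]
  ring

/-- The square of the length of `cylTension`. -/
def cylNormSq (s : ℝ) (x xs xz xss xzz : Fin 8 → ℝ) : ℝ :=
  metric x (cylTension s x xs xz xss xzz) (cylTension s x xs xz xss xzz)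

theorem tensionNorm_cyl {X : ℝ × ℝ → Fin 8 → ℝ} {p : E3} {xs xz xss xzz : Fin 8 → ℝ}
    (H : ∀ A, CylJet (fun q => X q A) (cyl p) (xs A) (xz A) (xss A) (xzz A))
    (ht : X (cyl p) ∈ target) :
    tensionNorm (fun x => X (cyl x)) p = √(cylNormSq (rhoSq p) (X (cyl p)) xs xz xss xzz) := by
  rw [tensionNorm, tension_cyl H ht]; rfl

/-! ### Linear isometries -/

/-- The action of the matrix with columns `α`, `β` on the symmetric space:
`F ↦ A F Aᵀ`, `ζ ↦ (det A) A ζ`, `χ ↦ (det A) χ`, `ψ ↦ A ψ`. -/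
def act (α β : Fin 2 → ℝ) (x : Fin 8 → ℝ) : Fin 8 → ℝ :=
  ![x 0 * α 0 ^ 2 + x 1 * (2 * (α 0 * β 0)) + x 2 * β 0 ^ 2,
    x 0 * (α 0 * α 1) + x 1 * (α 0 * β 1 + α 1 * β 0) + x 2 * (β 0 * β 1),
    x 0 * α 1 ^ 2 + x 1 * (2 * (α 1 * β 1)) + x 2 * β 1 ^ 2,
    (α 0 * β 1 - α 1 * β 0) * (x 3 * α 0 + x 4 * β 0),
    (α 0 * β 1 - α 1 * β 0) * (x 3 * α 1 + x 4 * β 1),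
    (α 0 * β 1 - α 1 * β 0) * x 5, x 6 * α 0 + x 7 * β 0, x 6 * α 1 + x 7 * β 1]

theorem act_add (α β : Fin 2 → ℝ) (x y : Fin 8 → ℝ) : act α β (x + y) = act α β x + act α β y := by
  ext i; fin_cases i <;> simp [act] <;> ring

theorem act_smul (α β : Fin 2 → ℝ) (r : ℝ) (x : Fin 8 → ℝ) : act α β (r • x) = r • act α β x := by
  ext i; fin_cases i <;> simp [act] <;> ring

/-- The columns of the inverse matrix. -/
def invCol₀ (α β : Fin 2 → ℝ) : Fin 2 → ℝ := (α 0 * β 1 - α 1 * β 0)⁻¹ • ![β 1, -α 1]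
/-- The columns of the inverse matrix. -/
def invCol₁ (α β : Fin 2 → ℝ) : Fin 2 → ℝ := (α 0 * β 1 - α 1 * β 0)⁻¹ • ![-β 0, α 0]

theorem act_inv {α β : Fin 2 → ℝ} (hd : α 0 * β 1 - α 1 * β 0 ≠ 0) (x : Fin 8 → ℝ) :
    act α β (act (invCol₀ α β) (invCol₁ α β) x) = x := by
  set D := α 0 * β 1 - α 1 * β 0 with hD
  ext i
  fin_cases i <;> simp only [act, invCol₀, invCol₁, ← hD, Pi.smul_apply, smul_eq_mul, Matrix.cons_val_zero,
    Matrix.cons_val_one, Matrix.cons_val, Fin.zero_eta, Fin.mk_one, Fin.reduceFinMk, mul_neg, neg_mul]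
    <;> field_simp <;> rw [hD] <;> ring

theorem detF_act (α β : Fin 2 → ℝ) (x : Fin 8 → ℝ) :
    detF (act α β x) = (α 0 * β 1 - α 1 * β 0) ^ 2 * detF x := by
  simp only [detF, act, Matrix.cons_val_zero, Matrix.cons_val_one, Matrix.cons_val]; ring

/-- The trace of `F⁻¹ φ` without the factor `1 / det F`. -/
theorem trace_eq (x u : Fin 8 → ℝ) :
    m00 x u + m11 x u = (detF x)⁻¹ * (x 2 * u 0 - 2 * x 1 * u 1 + x 0 * u 2) := by
  simp only [m00, m11, gA, gB, gC]; ring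

/-- The weights of ζ and χ under the action make Θ and Υ scale by det A, with Θ also rotated by A.
The factors (det A)² this produces cancel against 1 / det F. -/
theorem metric_act {α β : Fin 2 → ℝ} (hd : α 0 * β 1 - α 1 * β 0 ≠ 0) (x u w : Fin 8 → ℝ) :
    metric (act α β x) (act α β u) (act α β w) = metric x u w := by
  set D := α 0 * β 1 - α 1 * β 0 with hD
  have he : (detF (act α β x))⁻¹ = D⁻¹ ^ 2 * (detF x)⁻¹ := by
    rw [detF_act, mul_inv, inv_pow]
  have hDD : D⁻¹ * D = 1 := inv_mul_cancel₀ hd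
  have tr : ∀ u : Fin 8 → ℝ, m00 (act α β x) (act α β u) + m11 (act α β x) (act α β u)
      = m00 x u + m11 x u := by
    intro u
    rw [trace_eq, trace_eq, he]
    have : act α β x 2 * act α β u 0 - 2 * act α β x 1 * act α β u 1 + act α β x 0 * act α β u 2
        = D ^ 2 * (x 2 * u 0 - 2 * x 1 * u 1 + x 0 * u 2) := by
      simp only [act, hD, Matrix.cons_val_zero, Matrix.cons_val_one, Matrix.cons_val]; ring
    rw [this]
    linear_combination ((detF x)⁻¹ * (x 2 * u 0 - 2 * x 1 * u 1 + x 0 * u 2)) * (D⁻¹ * D + 1) * hDD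
  -- The polarised Cayley-Hamilton identity: Tr(MN) equals Tr M · Tr N minus the polarised
  -- determinant. The product of `detF y` and its inverse is left unsimplified so that no
  -- nonvanishing is needed.
  have trtr : ∀ y v w : Fin 8 → ℝ,
      m00 y v * m00 y w + m01 y v * m10 y w + m10 y v * m01 y w + m11 y v * m11 y w
      = (m00 y v + m11 y v) * (m00 y w + m11 y w)
        - (detF y)⁻¹ * (detF y * (detF y)⁻¹) * (v 0 * w 2 + v 2 * w 0 - 2 * v 1 * w 1) := by
    intro y v w
    simp only [m00, m01, m10, m11, gA, gB, gC]
    simp only [detF]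
    ring
  have hdd : ∀ u w : Fin 8 → ℝ, act α β u 0 * act α β w 2 + act α β u 2 * act α β w 0
      - 2 * act α β u 1 * act α β w 1 = D ^ 2 * (u 0 * w 2 + u 2 * w 0 - 2 * u 1 * w 1) := by
    intro u w
    simp only [act, hD, Matrix.cons_val_zero, Matrix.cons_val_one, Matrix.cons_val]; ring
  have hgin : ∀ a₀ a₁ b₀ b₁ : ℝ, gIn (act α β x) (a₀ * α 0 + a₁ * β 0) (a₀ * α 1 + a₁ * β 1)
      (b₀ * α 0 + b₁ * β 0) (b₀ * α 1 + b₁ * β 1) = gIn x a₀ a₁ b₀ b₁ := by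
    intro a₀ a₁ b₀ b₁
    simp only [gIn, gA, gB, gC, he]
    have : act α β x 2 * ((a₀ * α 0 + a₁ * β 0) * (b₀ * α 0 + b₁ * β 0))
        - act α β x 1 * ((a₀ * α 0 + a₁ * β 0) * (b₀ * α 1 + b₁ * β 1)
          + (a₀ * α 1 + a₁ * β 1) * (b₀ * α 0 + b₁ * β 0))
        + act α β x 0 * ((a₀ * α 1 + a₁ * β 1) * (b₀ * α 1 + b₁ * β 1))
        = D ^ 2 * (x 2 * (a₀ * b₀) - x 1 * (a₀ * b₁ + a₁ * b₀) + x 0 * (a₁ * b₁)) := by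
      simp only [act, hD, Matrix.cons_val_zero, Matrix.cons_val_one, Matrix.cons_val]; ring
    linear_combination D⁻¹ ^ 2 * (detF x)⁻¹ * this + (detF x)⁻¹ *
      (x 2 * (a₀ * b₀) - x 1 * (a₀ * b₁ + a₁ * b₀) + x 0 * (a₁ * b₁)) * (D⁻¹ * D + 1) * hDD
  have hpsi : ∀ u : Fin 8 → ℝ, psiX (act α β x) (act α β u) = D * psiX x u := by
    intro u
    simp only [psiX, act, hD, Matrix.cons_val]; ring
  have hups : ∀ u : Fin 8 → ℝ, ups (act α β x) (act α β u) = D * ups x u := by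
    intro u
    rw [ups, ups, hpsi]
    simp only [act, Matrix.cons_val, ← hD]; ring
  have hchi : ∀ u : Fin 8 → ℝ, chiF (act α β x) (act α β u) = D * chiF x u := by
    intro u
    rw [chiF, chiF, hpsi]
    simp only [act, Matrix.cons_val, ← hD]; ring
  have hth0 : ∀ u : Fin 8 → ℝ, th0 (act α β x) (act α β u)
      = (D * th0 x u) * α 0 + (D * th1 x u) * β 0 := by
    intro u
    rw [th0, th0, th1, hchi]
    simp only [act, Matrix.cons_val, ← hD]; ring
  have hth1 : ∀ u : Fin 8 → ℝ, th1 (act α β x) (act α β u)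
      = (D * th0 x u) * α 1 + (D * th1 x u) * β 1 := by
    intro u
    rw [th1, th0, th1, hchi]
    simp only [act, Matrix.cons_val, ← hD]; ring
  have h6 : ∀ u : Fin 8 → ℝ, act α β u 6 = u 6 * α 0 + u 7 * β 0 := fun _ => rfl
  have h7 : ∀ u : Fin 8 → ℝ, act α β u 7 = u 6 * α 1 + u 7 * β 1 := fun _ => rfl
  rw [metric_eq, metric_eq, trtr, trtr x, tr, tr, hdd, hth0, hth1, hth0, hth1, h6, h7, h6, h7, hgin,
    hgin, hups, hups, detF_act, ← hD]
  have e1 : (D ^ 2 * detF x)⁻¹ = D⁻¹ ^ 2 * (detF x)⁻¹ := by rw [mul_inv, inv_pow]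
  rw [e1]
  have e2 : gIn x (D * th0 x u) (D * th1 x u) (D * th0 x w) (D * th1 x w)
      = D ^ 2 * gIn x (th0 x u) (th1 x u) (th0 x w) (th1 x w) := by
    simp only [gIn]; ring
  rw [e2]
  generalize gIn x (th0 x u) (th1 x u) (th0 x w) (th1 x w) = g
  generalize (u 0 * w 2 + u 2 * w 0 - 2 * u 1 * w 1) = k
  have h2 : D⁻¹ ^ 2 * D ^ 2 = 1 := by rw [← mul_pow, hDD, one_pow]
  linear_combination ((detF x)⁻¹ * (g + ups x u * ups x w)
    - 1 / 2 * (detF x)⁻¹ ^ 2 * detF x * k * (D⁻¹ ^ 2 * D ^ 2 + 1)) * h2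

theorem act_mem_target {α β : Fin 2 → ℝ} (hd : α 0 * β 1 - α 1 * β 0 ≠ 0) {x : Fin 8 → ℝ}
    (hx : x ∈ target) : act α β x ∈ target := by
  rw [target_iff] at hx ⊢
  intro a b hab
  have := hx (α 0 * a + α 1 * b) (β 0 * a + β 1 * b) (by
    intro h
    obtain ⟨h1, h2⟩ := Prod.mk.inj h
    apply hab
    have ha : (α 0 * β 1 - α 1 * β 0) * a = 0 := by linear_combination β 1 * h1 - α 1 * h2
    have hb : (α 0 * β 1 - α 1 * β 0) * b = 0 := by linear_combination α 0 * h2 - β 0 * h1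
    rw [(mul_eq_zero.1 ha).resolve_left hd, (mul_eq_zero.1 hb).resolve_left hd])
  simp only [act, Matrix.cons_val_zero, Matrix.cons_val_one, Matrix.cons_val]
  linarith

theorem dMetric_act {α β : Fin 2 → ℝ} (hd : α 0 * β 1 - α 1 * β 0 ≠ 0) {x : Fin 8 → ℝ}
    (hx : detF x ≠ 0) (c u w : Fin 8 → ℝ) :
    dMetric (act α β x) (act α β c) (act α β u) (act α β w) = dMetric x c u w := by
  have h1 := hasDerivAt_metric (x := act α β x)
    (by rw [detF_act]; exact mul_ne_zero (pow_ne_zero 2 hd) hx) (act α β c) (act α β u) (act α β w)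
  have h2 := hasDerivAt_metric hx c u w
  refine h1.unique (h2.congr_of_eventuallyEq (Filter.Eventually.of_forall fun t => ?_))
  change metric (act α β x + t • act α β c) _ _ = _
  rw [← act_smul, ← act_add, metric_act hd]

/-- A linear isometry preserves the Levi-Civita connection. The Koszul identity, every term of which
is invariant, gives this without transforming `gam` explicitly. -/
theorem gam_act {α β : Fin 2 → ℝ} (hd : α 0 * β 1 - α 1 * β 0 ≠ 0) {x : Fin 8 → ℝ}
    (hx : x ∈ target) (u : Fin 8 → ℝ) : gam (act α β x) (act α β u) = act α β (gam x u) := by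
  have hax := act_mem_target hd hx
  have hf := ((target_iff_det _).1 hx).2.ne'
  have haf := ((target_iff_det _).1 hax).2.ne'
  have h : ∀ w, metric (act α β x) (gam (act α β x) (act α β u) + (-1 : ℝ) • act α β (gam x u)) w
      = 0 := by
    intro w
    obtain ⟨w', rfl⟩ : ∃ w', act α β w' = w := ⟨_, act_inv hd w⟩
    rw [metric_add_left, metric_smul_left, metric_gam haf, metric_act hd, metric_gam hf,
      dMetric_act hd hf, dMetric_act hd hf]; ring
  have := metric_self_eq_zero hax (h _)
  rw [neg_one_smul, add_neg_eq_zero] at this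
  exact this

theorem cylNormSq_act {α β : Fin 2 → ℝ} (hd : α 0 * β 1 - α 1 * β 0 ≠ 0) {x : Fin 8 → ℝ}
    (hx : x ∈ target) (s : ℝ) (xs xz xss xzz : Fin 8 → ℝ) :
    cylNormSq s (act α β x) (act α β xs) (act α β xz) (act α β xss) (act α β xzz)
      = cylNormSq s x xs xz xss xzz := by
  have : cylTension s (act α β x) (act α β xs) (act α β xz) (act α β xss) (act α β xzz)
      = act α β (cylTension s x xs xz xss xzz) := by
    simp only [cylTension, gam_act hd hx, act_add, act_smul]
  rw [cylNormSq, this, metric_act hd, cylNormSq]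

theorem cylJet_act (α β : Fin 2 → ℝ) {Y : ℝ × ℝ → Fin 8 → ℝ} {q : ℝ × ℝ}
    {xs xz xss xzz : Fin 8 → ℝ} (H : ∀ A, CylJet (fun q => Y q A) q (xs A) (xz A) (xss A) (xzz A))
    (A : Fin 8) : CylJet (fun q => act α β (Y q) A) q (act α β xs A) (act α β xz A) (act α β xss A)
      (act α β xzz A) := by
  have lin2 : ∀ (A B : Fin 8) (r r' : ℝ), CylJet (fun q => r * Y q A + r' * Y q B) q
      (r * xs A + r' * xs B) (r * xz A + r' * xz B) (r * xss A + r' * xss B)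
      (r * xzz A + r' * xzz B) := fun A B r r' => ((H A).const_mul r).add ((H B).const_mul r')
  have lin3 : ∀ (A B C : Fin 8) (r r' r'' : ℝ), CylJet (fun q => r * Y q A + r' * Y q B + r'' * Y q C)
      q (r * xs A + r' * xs B + r'' * xs C) (r * xz A + r' * xz B + r'' * xz C)
      (r * xss A + r' * xss B + r'' * xss C) (r * xzz A + r' * xzz B + r'' * xzz C) :=
    fun A B C r r' r'' => (lin2 A B r r').add ((H C).const_mul r'')
  fin_cases A
  · refine ((lin3 0 1 2 (α 0 ^ 2) (2 * (α 0 * β 0)) (β 0 ^ 2)).congr (Filter.Eventually.of_forall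
      fun q => ?_)).cast ?_ ?_ ?_ ?_ <;> simp [act] <;> ring
  · refine ((lin3 0 1 2 (α 0 * α 1) (α 0 * β 1 + α 1 * β 0) (β 0 * β 1)).congr
      (Filter.Eventually.of_forall fun q => ?_)).cast ?_ ?_ ?_ ?_ <;> simp [act] <;> ring
  · refine ((lin3 0 1 2 (α 1 ^ 2) (2 * (α 1 * β 1)) (β 1 ^ 2)).congr (Filter.Eventually.of_forall
      fun q => ?_)).cast ?_ ?_ ?_ ?_ <;> simp [act] <;> ring
  · refine ((lin2 3 4 ((α 0 * β 1 - α 1 * β 0) * α 0) ((α 0 * β 1 - α 1 * β 0) * β 0)).congr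
      (Filter.Eventually.of_forall fun q => ?_)).cast ?_ ?_ ?_ ?_ <;> simp [act] <;> ring
  · refine ((lin2 3 4 ((α 0 * β 1 - α 1 * β 0) * α 1) ((α 0 * β 1 - α 1 * β 0) * β 1)).congr
      (Filter.Eventually.of_forall fun q => ?_)).cast ?_ ?_ ?_ ?_ <;> simp [act] <;> ring
  · exact (H 5).const_mul (α 0 * β 1 - α 1 * β 0)
  · refine ((lin2 6 7 (α 0) (β 0)).congr (Filter.Eventually.of_forall fun q => ?_)).cast ?_ ?_ ?_ ?_
      <;> simp [act] <;> ring
  · refine ((lin2 6 7 (α 1) (β 1)).congr (Filter.Eventually.of_forall fun q => ?_)).cast ?_ ?_ ?_ ?_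
      <;> simp [act] <;> ring

/-- The tension of a map which agrees locally with an isometric image of `Y`. -/
theorem tensionNorm_of_act {α β : Fin 2 → ℝ} (hd : α 0 * β 1 - α 1 * β 0 ≠ 0)
    {X Y : ℝ × ℝ → Fin 8 → ℝ} {p : E3} {xs xz xss xzz : Fin 8 → ℝ}
    (hX : X =ᶠ[𝓝 (cyl p)] fun q => act α β (Y q))
    (H : ∀ A, CylJet (fun q => Y q A) (cyl p) (xs A) (xz A) (xss A) (xzz A))
    (ht : Y (cyl p) ∈ target) :
    tensionNorm (fun x => X (cyl x)) p = √(cylNormSq (rhoSq p) (Y (cyl p)) xs xz xss xzz) := by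
  have hXp : X (cyl p) = act α β (Y (cyl p)) := hX.self_of_nhds
  rw [tensionNorm_cyl (X := X) (fun A => (cylJet_act α β H A).congr
    (hX.fun_comp fun x : Fin 8 → ℝ => x A)) (by rw [hXp]; exact act_mem_target hd ht), hXp,
    cylNormSq_act hd ht]

/-! ### Regular points -/

theorem isOpen_target : IsOpen target := by
  have : target = {x | 0 < x 0} ∩ {x | 0 < detF x} := by
    ext x; exact target_iff_det x
  rw [this]
  refine (isOpen_lt continuous_const (by fun_prop)).inter (isOpen_lt continuous_const ?_)
  unfold detF
  fun_prop

section Continuity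

variable {T : Type*} [TopologicalSpace T] {t₀ : T} {x u w : T → Fin 8 → ℝ}

theorem continuousAt_inv_detF (hx : ContinuousAt x t₀) (h0 : detF (x t₀) ≠ 0) :
    ContinuousAt (fun t => (detF (x t))⁻¹) t₀ := by
  have hx' := continuousAt_pi.1 hx
  refine ContinuousAt.inv₀ ?_ h0
  unfold detF
  fun_prop

theorem continuousAt_gIn {a b c d : T → ℝ} (hx : ContinuousAt x t₀) (h0 : detF (x t₀) ≠ 0)
    (ha : ContinuousAt a t₀) (hb : ContinuousAt b t₀) (hc : ContinuousAt c t₀)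
    (hd : ContinuousAt d t₀) : ContinuousAt (fun t => gIn (x t) (a t) (b t) (c t) (d t)) t₀ := by
  have hx' := continuousAt_pi.1 hx
  have := continuousAt_inv_detF hx h0
  unfold gIn gA gB gC
  fun_prop

theorem continuousAt_forms (hx : ContinuousAt x t₀) (h0 : detF (x t₀) ≠ 0) (hu : ContinuousAt u t₀) :
    (ContinuousAt (fun t => m00 (x t) (u t)) t₀ ∧ ContinuousAt (fun t => m01 (x t) (u t)) t₀ ∧
    ContinuousAt (fun t => m10 (x t) (u t)) t₀ ∧ ContinuousAt (fun t => m11 (x t) (u t)) t₀) ∧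
    ContinuousAt (fun t => chiF (x t) (u t)) t₀ ∧
    ContinuousAt (fun t => th0 (x t) (u t)) t₀ ∧ ContinuousAt (fun t => th1 (x t) (u t)) t₀ ∧
    ContinuousAt (fun t => ups (x t) (u t)) t₀ := by
  have hx' := continuousAt_pi.1 hx
  have hu' := continuousAt_pi.1 hu
  have := continuousAt_inv_detF hx h0
  unfold m00 m01 m10 m11 th0 th1 ups chiF psiX gA gB gC
  refine ⟨⟨?_, ?_, ?_, ?_⟩, ?_, ?_, ?_, ?_⟩ <;> fun_prop

theorem continuousAt_metric (hx : ContinuousAt x t₀) (h0 : detF (x t₀) ≠ 0) (hu : ContinuousAt u t₀)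
    (hw : ContinuousAt w t₀) : ContinuousAt (fun t => metric (x t) (u t) (w t)) t₀ := by
  have hx' := continuousAt_pi.1 hx
  have hu' := continuousAt_pi.1 hu
  have hw' := continuousAt_pi.1 hw
  have h1 := continuousAt_inv_detF hx h0
  obtain ⟨⟨a1, a2, a3, a4⟩, -, a5, a6, a7⟩ := continuousAt_forms hx h0 hu
  obtain ⟨⟨b1, b2, b3, b4⟩, -, b5, b6, b7⟩ := continuousAt_forms hx h0 hw
  have h2 := continuousAt_gIn hx h0 a5 a6 b5 b6
  have h3 := continuousAt_gIn (a := fun t => u t 6) (b := fun t => u t 7) (c := fun t => w t 6)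
    (d := fun t => w t 7) hx h0 (by fun_prop) (by fun_prop) (by fun_prop) (by fun_prop)
  simp only [metric_eq]
  fun_prop

theorem continuousAt_gam (hx : ContinuousAt x t₀) (h0 : detF (x t₀) ≠ 0) (hu : ContinuousAt u t₀) :
    ContinuousAt (fun t => gam (x t) (u t)) t₀ := by
  have hx' := continuousAt_pi.1 hx
  have hu' := continuousAt_pi.1 hu
  have h1 := continuousAt_inv_detF hx h0
  obtain ⟨⟨a1, a2, a3, a4⟩, a8, a5, a6, a7⟩ := continuousAt_forms hx h0 hu
  have h2 := continuousAt_gIn (a := fun t => u t 6) (b := fun t => u t 7) (c := fun t => u t 6)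
    (d := fun t => u t 7) hx h0 (by fun_prop) (by fun_prop) (by fun_prop) (by fun_prop)
  have h3 := continuousAt_gIn (c := fun t => u t 6)
    (d := fun t => u t 7) hx h0 a5 a6 (by fun_prop) (by fun_prop)
  have p0 : ContinuousAt (fun t => gamPsi0 (x t) (u t)) t₀ := by unfold gamPsi0; fun_prop
  have p1 : ContinuousAt (fun t => gamPsi1 (x t) (u t)) t₀ := by unfold gamPsi1; fun_prop
  have p2 : ContinuousAt (fun t => gamUps (x t) (u t)) t₀ := by unfold gamUps; fun_prop
  have p3 : ContinuousAt (fun t => gamTh0 (x t) (u t)) t₀ := by unfold gamTh0; fun_prop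
  have p4 : ContinuousAt (fun t => gamTh1 (x t) (u t)) t₀ := by unfold gamTh1; fun_prop
  have p5 : ContinuousAt (fun t => gamTr (x t) (u t)) t₀ := by unfold gamTr; fun_prop
  rw [continuousAt_pi]
  intro i
  fin_cases i <;>
  · simp only [gam, Fin.zero_eta, Fin.mk_one, Fin.reduceFinMk, Matrix.cons_val_zero,
      Matrix.cons_val_one, Matrix.cons_val]
    fun_prop

end Continuity

theorem eventually_le_of_continuousAt {T : Type*} [TopologicalSpace T] {f : T → ℝ} {t₀ : T}
    (h : ContinuousAt f t₀) : ∀ᶠ t in 𝓝 t₀, f t ≤ f t₀ + 1 :=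
  (h.eventually (gt_mem_nhds (lt_add_one (f t₀)))).mono fun _ ht => le_of_lt ht

/-- Where F is nondegenerate, |τ|² is a continuous function of the jet. Points with ρ = 0 are
included, which covers the interior of horizon rods. -/
theorem tensionNorm_bounded_of_smooth {X : ℝ × ℝ → Fin 8 → ℝ} {q₀ : ℝ × ℝ}
    (hX : ∀ A, ContDiffAt ℝ ∞ (fun q => X q A) q₀) (ht : X q₀ ∈ target) :
    ∃ C, ∀ᶠ q in 𝓝 q₀, ∀ p, cyl p = q → tensionNorm (fun x => X (cyl x)) p ≤ C := by
  choose xs xz xss xzz c1 c2 c3 c4 hj using fun A => exists_cylJet (hX A)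
  have hc : ContinuousAt X q₀ := continuousAt_pi.2 fun A => (hX A).continuousAt
  have hdet : detF (X q₀) ≠ 0 := ((target_iff_det _).1 ht).2.ne'
  have k1 : ContinuousAt (fun q A => xs A q) q₀ := continuousAt_pi.2 c1
  have k2 : ContinuousAt (fun q A => xz A q) q₀ := continuousAt_pi.2 c2
  have k3 : ContinuousAt (fun q A => xss A q) q₀ := continuousAt_pi.2 c3
  have k4 : ContinuousAt (fun q A => xzz A q) q₀ := continuousAt_pi.2 c4
  have k5 := continuousAt_gam hc hdet k1
  have k6 := continuousAt_gam hc hdet k2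
  have k7 : ContinuousAt (fun q => cylTension q.1 (X q) (fun A => xs A q) (fun A => xz A q)
      (fun A => xss A q) (fun A => xzz A q)) q₀ := by
    unfold cylTension
    fun_prop
  have k8 := continuousAt_metric hc hdet k7 k7
  refine ⟨√(metric (X q₀) (cylTension q₀.1 (X q₀) (fun A => xs A q₀) (fun A => xz A q₀)
    (fun A => xss A q₀) (fun A => xzz A q₀)) (cylTension q₀.1 (X q₀) (fun A => xs A q₀)
    (fun A => xz A q₀) (fun A => xss A q₀) (fun A => xzz A q₀)) + 1), ?_⟩
  filter_upwards [eventually_le_of_continuousAt k8, Filter.eventually_all.2 hj,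
    hc.eventually (isOpen_target.mem_nhds ht)] with q h1 h2 h3 p hp
  subst hp
  rw [tensionNorm_cyl h2 h3]
  exact Real.sqrt_le_sqrt h1

/-! ### Exact solutions -/

/-- `log D` is harmonic, `a`, `b`, `c`, `d` being the derivatives of `D` at a point with `ρ² = s`. -/
def LogHarmonic (s D a b c d : ℝ) : Prop := D * (4 * s * c + 4 * a + d) = 4 * s * a ^ 2 + b ^ 2

/-- With constant potentials and diagonal F the harmonic map equations decouple into Δ log Dᵢ = 0.
The entries on the diagonals of flat tori are totally geodesic in the target. -/
theorem cylTension_of_logHarmonic {s D₁ a₁ b₁ c₁ d₁ D₂ a₂ b₂ c₂ d₂ : ℝ} (h₁ : D₁ ≠ 0) (h₂ : D₂ ≠ 0)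
    (l₁ : LogHarmonic s D₁ a₁ b₁ c₁ d₁) (l₂ : LogHarmonic s D₂ a₂ b₂ c₂ d₂) (y : Fin 5 → ℝ) :
    cylTension s ![D₁, 0, D₂, y 0, y 1, y 2, y 3, y 4] ![a₁, 0, a₂, 0, 0, 0, 0, 0]
      ![b₁, 0, b₂, 0, 0, 0, 0, 0] ![c₁, 0, c₂, 0, 0, 0, 0, 0] ![d₁, 0, d₂, 0, 0, 0, 0, 0] = 0 := by
  unfold LogHarmonic at l₁ l₂
  ext i
  fin_cases i <;> simp [cylTension, gam, gamTr, gamUps, gamTh0, gamTh1, gamPsi0, gamPsi1, gIn, ups,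
    th0, th1, chiF, psiX, m00, m01, m10, m11, gA, gB, gC, detF]
  · field_simp
    linear_combination l₁
  · field_simp
    linear_combination l₂

/-! ### Components of the tension in the coframe -/

theorem m00_cylTension (s : ℝ) (x xs xz xss xzz : Fin 8 → ℝ) : m00 x (cylTension s x xs xz xss xzz) =
    4 * s * (m00 x xss + m00 x (gam x xs)) + 4 * m00 x xs + (m00 x xzz + m00 x (gam x xz)) := by
  simp only [m00, cylTension, Pi.add_apply, Pi.smul_apply, smul_eq_mul]; ring

theorem m01_cylTension (s : ℝ) (x xs xz xss xzz : Fin 8 → ℝ) : m01 x (cylTension s x xs xz xss xzz) =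
    4 * s * (m01 x xss + m01 x (gam x xs)) + 4 * m01 x xs + (m01 x xzz + m01 x (gam x xz)) := by
  simp only [m01, cylTension, Pi.add_apply, Pi.smul_apply, smul_eq_mul]; ring

theorem m10_cylTension (s : ℝ) (x xs xz xss xzz : Fin 8 → ℝ) : m10 x (cylTension s x xs xz xss xzz) =
    4 * s * (m10 x xss + m10 x (gam x xs)) + 4 * m10 x xs + (m10 x xzz + m10 x (gam x xz)) := by
  simp only [m10, cylTension, Pi.add_apply, Pi.smul_apply, smul_eq_mul]; ring

theorem m11_cylTension (s : ℝ) (x xs xz xss xzz : Fin 8 → ℝ) : m11 x (cylTension s x xs xz xss xzz) =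
    4 * s * (m11 x xss + m11 x (gam x xs)) + 4 * m11 x xs + (m11 x xzz + m11 x (gam x xz)) := by
  simp only [m11, cylTension, Pi.add_apply, Pi.smul_apply, smul_eq_mul]; ring

theorem th0_cylTension (s : ℝ) (x xs xz xss xzz : Fin 8 → ℝ) : th0 x (cylTension s x xs xz xss xzz) =
    4 * s * (th0 x xss + gamTh0 x xs) + 4 * th0 x xs + (th0 x xzz + gamTh0 x xz) := by
  rw [← th0_gam, ← th0_gam]
  simp only [th0, chiF, psiX, cylTension, Pi.add_apply, Pi.smul_apply, smul_eq_mul]; ring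

theorem th1_cylTension (s : ℝ) (x xs xz xss xzz : Fin 8 → ℝ) : th1 x (cylTension s x xs xz xss xzz) =
    4 * s * (th1 x xss + gamTh1 x xs) + 4 * th1 x xs + (th1 x xzz + gamTh1 x xz) := by
  rw [← th1_gam, ← th1_gam]
  simp only [th1, chiF, psiX, cylTension, Pi.add_apply, Pi.smul_apply, smul_eq_mul]; ring

theorem ups_cylTension (s : ℝ) (x xs xz xss xzz : Fin 8 → ℝ) : ups x (cylTension s x xs xz xss xzz) =
    4 * s * (ups x xss + gamUps x xs) + 4 * ups x xs + (ups x xzz + gamUps x xz) := by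
  rw [← ups_gam, ← ups_gam]
  simp only [ups, psiX, cylTension, Pi.add_apply, Pi.smul_apply, smul_eq_mul]; ring

theorem six_cylTension (s : ℝ) (x xs xz xss xzz : Fin 8 → ℝ) : cylTension s x xs xz xss xzz 6 =
    4 * s * (xss 6 + gamPsi0 x xs) + 4 * xs 6 + (xzz 6 + gamPsi0 x xz) := rfl

theorem seven_cylTension (s : ℝ) (x xs xz xss xzz : Fin 8 → ℝ) : cylTension s x xs xz xss xzz 7 =
    4 * s * (xss 7 + gamPsi1 x xs) + 4 * xs 7 + (xzz 7 + gamPsi1 x xz) := rfl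

/-! ### Near the interior of an axis rod -/

/-- The values near an axis rod, in a basis whose first vector is the rod structure; `c` and `t` are
the components of `ψ`. -/
def rodVal (y₀ y₁ y₂ c s a b d t : ℝ) : Fin 8 → ℝ :=
  ![s * a, s * b, d, y₀ + 2 / 3 * (1 / √3) * c ^ 2 * t, y₁ + 1 / 3 * (1 / √3) * c * t ^ 2,
    y₂ - 1 / √3 * c * t, c, t]

/-- `rodNormSq` is the square of the tension near an axis rod; it has no singularity at `s = 0`. -/
def rodNormSq (s a b d as bs ds az bz dz ass bss dss azz bzz dzz t' t'' : ℝ) : ℝ :=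
  let i := (a * d - s * b ^ 2)⁻¹
  let α₁ := (d * as - s * b * bs) * i
  let β := d * b * i + s * ((d * bs - b * ds) * i)
  let γ := (a * bs - b * as) * i
  let ε := (a * ds - b * (b + s * bs)) * i
  let V₀₀ := (d * az - s * b * bz) * i
  let V₀₁ := (d * bz - b * dz) * i
  let V₁₀ := s * (a * bz - b * az) * i
  let V₁₁ := (a * dz - s * b * bz) * i
  let T := -1 / 3 * t' ^ 2 * a * i
  let R₀₀ := 4 * i * (d * (2 * as + s * ass) - s * b * (2 * bs + s * bss)) - 4 * α₁
    - 4 * s * α₁ ^ 2 - 4 * s * β * γ + (d * azz - s * b * bzz) * i - V₀₀ ^ 2 - V₀₁ * V₁₀ + T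
  let R₀₁ := 4 * i * (d * (2 * bs + s * bss) - s * b * dss) - 4 * β * (α₁ + ε)
    + (d * bzz - b * dzz) * i - V₀₁ * (V₀₀ + V₁₁) - b * i * t' ^ 2
  let R₁₀ := 4 * s * i * (a * (2 * bs + s * bss) - b * (2 * as + s * ass))
    - 4 * s ^ 2 * γ * (α₁ + ε) + s * (a * bzz - b * azz) * i - V₁₀ * (V₀₀ + V₁₁)
  let R₁₁ := 4 * s * i * (a * dss - b * (2 * bs + s * bss)) - 4 * s * (γ * β + ε ^ 2) + 4 * ε
    + (a * dzz - s * b * bzz) * i - V₁₀ * V₀₁ - V₁₁ ^ 2 + a * i * t' ^ 2 + T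
  let ξ := -(a * bz - b * az) * i * t'
  let η := t'' - V₁₁ * t'
  1 / 2 * (R₀₀ + R₁₁) ^ 2 + 1 / 2 * (R₀₀ ^ 2 + 2 * R₀₁ * R₁₀ + R₁₁ ^ 2)
    + (d * i * s * ξ ^ 2 - 2 * b * i * s * ξ * η + a * i * η ^ 2)

/-- The right side makes sense at s = 0 although F⁻¹ and 1 / det F have poles there. The potentials
of `rodVal` are such that Υ and Θ vanish on the derivatives of the map and on the tension; what
remains is the F-part, where the poles cancel, and the ψ-part, where the tension vanishes to the
order in s that compensates F⁻¹. -/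
theorem cylNormSq_rodVal {s a b d : ℝ} (hs : s ≠ 0) (hm : a * d - s * b ^ 2 ≠ 0)
    (y₀ y₁ y₂ c t as bs ds az bz dz ass bss dss azz bzz dzz t' t'' : ℝ) :
    cylNormSq s (rodVal y₀ y₁ y₂ c s a b d t)
      ![a + s * as, b + s * bs, ds, 0, 0, 0, 0, 0]
      ![s * az, s * bz, dz, 2 / 3 * (1 / √3) * c ^ 2 * t', 2 / 3 * (1 / √3) * c * (t * t'),
        -(1 / √3 * c * t'), 0, t']
      ![2 * as + s * ass, 2 * bs + s * bss, dss, 0, 0, 0, 0, 0]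
      ![s * azz, s * bzz, dzz, 2 / 3 * (1 / √3) * c ^ 2 * t'',
        2 / 3 * (1 / √3) * c * (t' ^ 2 + t * t''), -(1 / √3 * c * t''), 0, t'']
      = rodNormSq s a b d as bs ds az bz dz ass bss dss azz bzz dzz t' t'' := by
  set x := rodVal y₀ y₁ y₂ c s a b d t with hx
  set xs : Fin 8 → ℝ := ![a + s * as, b + s * bs, ds, 0, 0, 0, 0, 0] with hxs
  set xz : Fin 8 → ℝ := ![s * az, s * bz, dz, 2 / 3 * (1 / √3) * c ^ 2 * t',
    2 / 3 * (1 / √3) * c * (t * t'), -(1 / √3 * c * t'), 0, t'] with hxz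
  set xss : Fin 8 → ℝ := ![2 * as + s * ass, 2 * bs + s * bss, dss, 0, 0, 0, 0, 0] with hxss
  set xzz : Fin 8 → ℝ := ![s * azz, s * bzz, dzz, 2 / 3 * (1 / √3) * c ^ 2 * t'',
        2 / 3 * (1 / √3) * c * (t' ^ 2 + t * t''), -(1 / √3 * c * t''), 0, t''] with hxzz
  obtain ⟨i, hi⟩ : ∃ i, i = (a * d - s * b ^ 2)⁻¹ := ⟨_, rfl⟩
  have him : i * (a * d - s * b ^ 2) = 1 := by rw [hi]; exact inv_mul_cancel₀ hm
  have hss : s⁻¹ * s = 1 := inv_mul_cancel₀ hs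
  have hdet : detF x = s * (a * d - s * b ^ 2) := by
    simp only [detF, hx, rodVal, Matrix.cons_val_zero, Matrix.cons_val_one, Matrix.cons_val]; ring
  have hdi : (detF x)⁻¹ = s⁻¹ * i := by rw [hdet, mul_inv, hi]
  have hdne : detF x ≠ 0 := by rw [hdet]; exact mul_ne_zero hs hm
  have gA' : gA x = d * s⁻¹ * i := by rw [gA, hdi]; simp only [hx, rodVal, Matrix.cons_val]; ring
  have gB' : gB x = -b * i := by
    rw [gB, hdi]; simp only [hx, rodVal, Matrix.cons_val_one, Matrix.cons_val_zero]
    linear_combination -b * i * hss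
  have gC' : gC x = a * i := by
    rw [gC, hdi]; simp only [hx, rodVal, Matrix.cons_val_zero]
    linear_combination a * i * hss
  have ev : ∀ y : Fin 8 → ℝ, m00 x y = d * s⁻¹ * i * y 0 - b * i * y 1 ∧
      m01 x y = d * s⁻¹ * i * y 1 - b * i * y 2 ∧ m10 x y = -b * i * y 0 + a * i * y 1 ∧
      m11 x y = -b * i * y 1 + a * i * y 2 := by
    intro y
    refine ⟨?_, ?_, ?_, ?_⟩ <;> simp only [m00, m01, m10, m11, gA', gB', gC'] <;> ring
  obtain ⟨s00, s01, s10, s11⟩ := ev xs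
  obtain ⟨z00, z01, z10, z11⟩ := ev xz
  obtain ⟨ss00, ss01, ss10, ss11⟩ := ev xss
  obtain ⟨zz00, zz01, zz10, zz11⟩ := ev xzz
  have k0 : xs 0 = a + s * as := rfl
  have k1 : xs 1 = b + s * bs := rfl
  have k2 : xs 2 = ds := rfl
  have l0 : xz 0 = s * az := rfl
  have l1 : xz 1 = s * bz := rfl
  have l2 : xz 2 = dz := rfl
  have kk0 : xss 0 = 2 * as + s * ass := rfl
  have kk1 : xss 1 = 2 * bs + s * bss := rfl
  have kk2 : xss 2 = dss := rfl
  have ll0 : xzz 0 = s * azz := rfl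
  have ll1 : xzz 1 = s * bzz := rfl
  have ll2 : xzz 2 = dzz := rfl
  have z3 : xz 6 = 0 := rfl
  have z4 : xz 7 = t' := rfl
  have zz4 : xzz 7 = t'' := rfl
  have zz3 : xzz 6 = 0 := rfl
  have s3 : xs 6 = 0 := rfl
  have s4 : xs 7 = 0 := rfl
  have ss3 : xss 6 = 0 := rfl
  have ss4 : xss 7 = 0 := rfl
  have x6 : x 6 = c := rfl
  have x7 : x 7 = t := rfl
  -- the forms `Θ` and `Υ`
  have us : ups x xs = 0 := by simp [ups, psiX, hxs]
  have uz : ups x xz = 0 := by simp [ups, psiX, hxz, x6, x7]; ring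
  have uss : ups x xss = 0 := by simp [ups, psiX, hxss]
  have uzz : ups x xzz = 0 := by simp [ups, psiX, hxzz, x6, x7]; ring
  have t0s : th0 x xs = 0 := by simp [th0, chiF, psiX, hxs]
  have t1s : th1 x xs = 0 := by simp [th1, chiF, psiX, hxs]
  have t0z : th0 x xz = 0 := by simp [th0, chiF, psiX, hxz, x6, x7]; ring
  have t1z : th1 x xz = 0 := by simp [th1, chiF, psiX, hxz, x6, x7]; ring
  have t0ss : th0 x xss = 0 := by simp [th0, chiF, psiX, hxss]
  have t1ss : th1 x xss = 0 := by simp [th1, chiF, psiX, hxss]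
  have t0zz : th0 x xzz = 0 := by simp [th0, chiF, psiX, hxzz, x6, x7]; ring
  -- This is Θ₂(∂_z X) = 0 differentiated in z. The extra term arises because the second component t
  -- of ψ depends on z, and it is the same term that occurs in `gamTh1`.
  have t1zz : th1 x xzz + chiF x xz * t' = 0 := by
    simp [th1, chiF, psiX, hxzz, hxz, x6, x7]; ring
  set τ := cylTension s x xs xz xss xzz with hτ
  have tth0 : th0 x τ = 0 := by
    rw [hτ, th0_cylTension]; simp [gamTh0, t0ss, t0s, t1s, t0z, t1z, s3, t0zz, z3]
  have tth1 : th1 x τ = 0 := by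
    rw [hτ, th1_cylTension]; simp [gamTh1, t1ss, t0s, t1s, t0z, t1z, s4, z4, t1zz]
  have tups : ups x τ = 0 := by
    rw [hτ, ups_cylTension]
    simp [gamUps, us, uz, uss, uzz, t0s, t1s, t0z, t1z, gIn]
  have ts : gamTr x xs = 0 := by simp [gamTr, us, gIn, s3, s4]
  have tz : gamTr x xz = -1 / 3 * t' ^ 2 * a * i := by
    simp only [gamTr, uz, gIn, z3, z4, gA', gB', gC']; ring
  simp only [k0, k1, k2] at s00 s01 s10 s11
  simp only [l0, l1, l2] at z00 z01 z10 z11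
  simp only [kk0, kk1, kk2] at ss00 ss01 ss10 ss11
  simp only [ll0, ll1, ll2] at zz00 zz01 zz10 zz11
  -- The pole comes from the logarithmic derivative of s. It enters the tension as 4 s⁻¹ - 4 s · s⁻²
  -- = 0, which is the harmonicity of log ρ². The pole of the (0, 1) entry below cancels in the same
  -- way.
  have e00 : m00 x xs = s⁻¹ + (d * as - s * b * bs) * i := by
    rw [s00]
    linear_combination s⁻¹ * him + (d * i * as + i * b ^ 2) * hss
  have e01 : m01 x xs = s⁻¹ * (d * b * i + s * ((d * bs - b * ds) * i)) := by
    rw [s01]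
    linear_combination i * b * ds * hss
  have e10 : m10 x xs = s * ((a * bs - b * as) * i) := by rw [s10]; ring
  have e11 : m11 x xs = (a * ds - b * (b + s * bs)) * i := by rw [s11]; ring
  have f00 : m00 x xz = (d * az - s * b * bz) * i := by
    rw [z00]; linear_combination (d * i * az) * hss
  have f01 : m01 x xz = (d * bz - b * dz) * i := by
    rw [z01]; linear_combination (d * i * bz) * hss
  have f10 : m10 x xz = s * (a * bz - b * az) * i := by rw [z10]; ring
  have f11 : m11 x xz = (a * dz - s * b * bz) * i := by rw [z11]; ring
  set α₁ := (d * as - s * b * bs) * i with hα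
  set β := d * b * i + s * ((d * bs - b * ds) * i) with hβ
  set γ := (a * bs - b * as) * i with hγ
  set ε := (a * ds - b * (b + s * bs)) * i with hε
  set V₀₀ := (d * az - s * b * bz) * i with hV00
  set V₀₁ := (d * bz - b * dz) * i with hV01
  set V₁₀ := s * (a * bz - b * az) * i with hV10
  set V₁₁ := (a * dz - s * b * bz) * i with hV11
  set T := -1 / 3 * t' ^ 2 * a * i with hT
  have R00 : m00 x τ = 4 * i * (d * (2 * as + s * ass) - s * b * (2 * bs + s * bss)) - 4 * α₁
    - 4 * s * α₁ ^ 2 - 4 * s * β * γ + (d * azz - s * b * bzz) * i - V₀₀ ^ 2 - V₀₁ * V₁₀ + T := by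
    rw [hτ, m00_cylTension, m00_gam hdne, m00_gam hdne, ts, tz, t0s, t1s, t0z, t1z, s3, s4, z3, z4,
      e00, e01, e10, f00, f01, f10, ss00, zz00]
    linear_combination (4 * d * i * (2 * as + s * ass) + d * azz * i - 4 * s⁻¹
      - 8 * α₁ - 4 * s * β * γ) * hss
  have R01 : m01 x τ = 4 * i * (d * (2 * bs + s * bss) - s * b * dss) - 4 * β * (α₁ + ε)
    + (d * bzz - b * dzz) * i - V₀₁ * (V₀₀ + V₁₁) - b * i * t' ^ 2 := by
    rw [hτ, m01_cylTension, m01_gam hdne, m01_gam hdne, t0s, t1s, t0z, t1z, s3, s4, z3, z4,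
      e00, e01, e11, f00, f01, f11, ss01, zz01, gA', gB']
    linear_combination (4 * d * i * (2 * bs + s * bss) + d * bzz * i - 4 * s⁻¹ * β
      - 4 * β * (α₁ + ε)) * hss
  have R10 : m10 x τ = 4 * s * i * (a * (2 * bs + s * bss) - b * (2 * as + s * ass))
    - 4 * s ^ 2 * γ * (α₁ + ε) + s * (a * bzz - b * azz) * i - V₁₀ * (V₀₀ + V₁₁) := by
    rw [hτ, m10_cylTension, m10_gam hdne, m10_gam hdne, t0s, t1s, t0z, t1z, s3, s4, z3, z4,
      e00, e10, e11, f00, f10, f11, ss10, zz10]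
    linear_combination (-4 * s * γ) * hss
  have R11 : m11 x τ = 4 * s * i * (a * dss - b * (2 * bs + s * bss)) - 4 * s * (γ * β + ε ^ 2)
    + 4 * ε + (a * dzz - s * b * bzz) * i - V₁₀ * V₀₁ - V₁₁ ^ 2 + a * i * t' ^ 2 + T := by
    rw [hτ, m11_cylTension, m11_gam hdne, m11_gam hdne, ts, tz, t0s, t1s, t0z, t1z, s3, s4, z3, z4,
      e01, e10, e11, f01, f10, f11, ss11, zz11, gB', gC']
    linear_combination (-4 * s * γ * β) * hss
  -- The factor s matters: the corresponding entry of F⁻¹ is of order 1 / s, and here it meets s².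
  have P0 : τ 6 = s * (-(a * bz - b * az) * i * t') := by
    rw [hτ, six_cylTension]
    simp only [gamPsi0, us, uz, ss3, s3, s4, z3, z4, zz3, f10, hV10]; ring
  have P1 : τ 7 = t'' - V₁₁ * t' := by
    rw [hτ, seven_cylTension]
    simp only [gamPsi1, us, uz, ss4, s3, s4, z3, z4, zz4, f11]; ring
  rw [cylNormSq, ← hτ, metric_eq, tth0, tth1, tups, R00, R01, R10, R11, P0, P1]
  simp only [rodNormSq, ← hi, gIn, gA', gB', gC', ← hα, ← hβ, ← hγ, ← hε, ← hV00, ← hV01, ← hV10,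
    ← hV11, ← hT]
  linear_combination (d * i * s * (-(a * bz - b * az) * i * t') ^ 2) * hss

/-- By isometry invariance the map may be replaced by `rodVal`, and `rodNormSq` is continuous at s =
0 because a d - s b² is positive there. -/
theorem tensionNorm_bounded_of_rod {α β : Fin 2 → ℝ} (hdet : α 0 * β 1 - α 1 * β 0 ≠ 0)
    {X : ℝ × ℝ → Fin 8 → ℝ} {z₀ : ℝ} {a b d : ℝ × ℝ → ℝ} {t : ℝ → ℝ} {y₀ y₁ y₂ c : ℝ}
    (ha : ContDiffAt ℝ ∞ a (0, z₀)) (hb : ContDiffAt ℝ ∞ b (0, z₀)) (hd : ContDiffAt ℝ ∞ d (0, z₀))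
    (ht : ContDiffAt ℝ ∞ t z₀) (ha0 : 0 < a (0, z₀)) (hd0 : 0 < d (0, z₀))
    (hX : ∀ᶠ q in 𝓝 ((0 : ℝ), z₀),
      X q = act α β (rodVal y₀ y₁ y₂ c q.1 (a q) (b q) (d q) (t q.2))) :
    ∃ C, ∀ᶠ q in 𝓝 ((0 : ℝ), z₀), ∀ p, cyl p = q → 0 < q.1 →
      tensionNorm (fun x => X (cyl x)) p ≤ C := by
  obtain ⟨as, az, ass, azz, a1, a2, a3, a4, ja⟩ := exists_cylJet ha
  obtain ⟨bs, bz, bss, bzz, b1, b2, b3, b4, jb⟩ := exists_cylJet hb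
  obtain ⟨ds, dz, dss, dzz, d1, d2, d3, d4, jd⟩ := exists_cylJet hd
  have ht2 : ContDiffAt ℝ ∞ (fun q : ℝ × ℝ => t q.2) (0, z₀) :=
    ContDiffAt.comp (0, z₀) (g := t) ht contDiffAt_snd
  obtain ⟨ts, tz, tss, tzz, t1, t2, t3, t4, jt⟩ := exists_cylJet ht2
  have ca := ha.continuousAt
  have cb := hb.continuousAt
  have cd := hd.continuousAt
  have hm0 : 0 < a (0, z₀) * d (0, z₀) - (0 : ℝ) * b (0, z₀) ^ 2 := by
    rw [zero_mul, sub_zero]; positivity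
  have cm : ContinuousAt (fun q : ℝ × ℝ => a q * d q - q.1 * b q ^ 2) (0, z₀) := by fun_prop
  have ci : ContinuousAt (fun q : ℝ × ℝ => (a q * d q - q.1 * b q ^ 2)⁻¹) (0, z₀) :=
    cm.inv₀ hm0.ne'
  have cN : ContinuousAt (fun q : ℝ × ℝ => rodNormSq q.1 (a q) (b q) (d q) (as q) (bs q) (ds q) (az q)
      (bz q) (dz q) (ass q) (bss q) (dss q) (azz q) (bzz q) (dzz q) (tz q) (tzz q)) (0, z₀) := by
    simp only [rodNormSq]
    fun_prop
  refine ⟨√(rodNormSq (0, z₀).1 (a (0, z₀)) (b (0, z₀)) (d (0, z₀)) (as (0, z₀)) (bs (0, z₀))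
    (ds (0, z₀)) (az (0, z₀)) (bz (0, z₀)) (dz (0, z₀)) (ass (0, z₀)) (bss (0, z₀)) (dss (0, z₀))
    (azz (0, z₀)) (bzz (0, z₀)) (dzz (0, z₀)) (tz (0, z₀)) (tzz (0, z₀)) + 1), ?_⟩
  filter_upwards [ja, jb, jd, jt, eventually_le_of_continuousAt cN, hX.eventually_nhds,
    cm.eventually (lt_mem_nhds hm0), ca.eventually (lt_mem_nhds ha0)]
    with q ja jb jd jt hN hX hm ha p hp hs
  subst hp
  have jt1 := jt.z
  have js := CylJet.fst (cyl p)
  set q := cyl p with hq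
  have jsa := js.mul ja
  have jsb := js.mul jb
  have jt2 := jt.mul jt
  -- The component t is a function of z only, so the derivatives in ρ² chosen for it by
  -- `exists_cylJet` must vanish.
  have zs : ts q = 0 ∧ tss q = 0 := by
    have h1 := jt.s
    obtain ⟨u', h2, h3, h4⟩ := h1
    have h5 : ∀ᶠ r in 𝓝 q.1, u' r = 0 := by
      filter_upwards [h3] with r hr using hr.unique (hasDerivAt_const r (t q.2))
    refine ⟨h2.symm.trans h5.self_of_nhds, ?_⟩
    exact h4.unique ((hasDerivAt_const q.1 (0 : ℝ)).congr_of_eventuallyEq h5)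
  obtain ⟨zs, zss⟩ := zs
  rw [tensionNorm_of_act hdet (Y := fun q => rodVal y₀ y₁ y₂ c q.1 (a q) (b q) (d q) (t q.2)) hX
    (xs := ![a q + q.1 * as q, b q + q.1 * bs q, ds q, 0, 0, 0, 0, 0])
    (xz := ![q.1 * az q, q.1 * bz q, dz q, 2 / 3 * (1 / √3) * c ^ 2 * tz q,
      2 / 3 * (1 / √3) * c * (t q.2 * tz q), -(1 / √3 * c * tz q), 0, tz q])
    (xss := ![2 * as q + q.1 * ass q, 2 * bs q + q.1 * bss q, dss q, 0, 0, 0, 0, 0])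
    (xzz := ![q.1 * azz q, q.1 * bzz q, dzz q, 2 / 3 * (1 / √3) * c ^ 2 * tzz q,
        2 / 3 * (1 / √3) * c * (tz q ^ 2 + t q.2 * tzz q), -(1 / √3 * c * tzz q), 0, tzz q]) ?_ ?_]
  · refine Real.sqrt_le_sqrt (le_trans (le_of_eq ?_) hN)
    exact cylNormSq_rodVal hs.ne' hm.ne' _ _ _ _ _ _ _ _ _ _ _ _ _ _ _ _ _ _ _
  · intro A
    fin_cases A
    · exact jsa.cast (by simp) (by simp) (by simp) (by simp)
    · exact jsb.cast (by simp) (by simp) (by simp) (by simp)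
    · exact jd
    · refine (((jt.const_mul (2 / 3 * (1 / √3) * c ^ 2)).add_const y₀).congr
        (Filter.Eventually.of_forall fun q => add_comm _ _)).cast ?_ ?_ ?_ ?_ <;> simp [zs, zss]
    · refine (((jt2.const_mul (1 / 3 * (1 / √3) * c)).add_const y₁).congr
        (Filter.Eventually.of_forall fun q => ?_)).cast ?_ ?_ ?_ ?_ <;> simp [zs, zss, rodVal]
      · ring
      · ring
      · ring
    · refine (((jt.const_mul (-(1 / √3 * c))).add_const y₂).congr
        (Filter.Eventually.of_forall fun q => ?_)).cast ?_ ?_ ?_ ?_ <;> simp [zs, zss, rodVal]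
      ring
    · exact CylJet.const c _
    · exact jt.cast (by simp [zs]) (by simp) (by simp [zss]) (by simp)
  · rw [target_iff_det]
    refine ⟨mul_pos hs ha, ?_⟩
    have : detF (rodVal y₀ y₁ y₂ c q.1 (a q) (b q) (d q) (t q.2))
        = q.1 * (a q * d q - q.1 * b q ^ 2) := by
      simp only [detF, rodVal, Matrix.cons_val_zero, Matrix.cons_val_one, Matrix.cons_val]; ring
    rw [this]
    exact mul_pos hs hm

/-! ### The distance to a point of the axis -/

/-- The distance to the point with height `c` on the axis, as a function of `(ρ², z)`. -/
def rad (c : ℝ) (q : ℝ × ℝ) : ℝ := √(q.1 + (q.2 - c) ^ 2)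

theorem rad_pos {c : ℝ} {q : ℝ × ℝ} (h : 0 < q.1 + (q.2 - c) ^ 2) : 0 < rad c q := Real.sqrt_pos.2 h

theorem rad_sq {c : ℝ} {q : ℝ × ℝ} (h : 0 ≤ q.1 + (q.2 - c) ^ 2) :
    rad c q ^ 2 = q.1 + (q.2 - c) ^ 2 := Real.sq_sqrt h

theorem contDiffAt_rad {c : ℝ} {q : ℝ × ℝ} (h : 0 < q.1 + (q.2 - c) ^ 2) {n : WithTop ℕ∞} :
    ContDiffAt ℝ n (rad c) q := by
  unfold rad
  exact ContDiffAt.sqrt (by fun_prop) h.ne'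

theorem hasJet_sqrt {y : ℝ} (hy : 0 < y) : HasJet Real.sqrt y (1 / (2 * √y)) (-1 / (4 * √y ^ 3)) := by
  refine ⟨fun y => 1 / (2 * √y), rfl, ?_, ?_⟩
  · filter_upwards [lt_mem_nhds hy] with r hr using Real.hasDerivAt_sqrt hr.ne'
  · have h0 : √y ≠ 0 := (Real.sqrt_pos.2 hy).ne'
    refine (((hasDerivAt_const y (1 : ℝ)).div ((Real.hasDerivAt_sqrt hy.ne').const_mul 2)
      (by positivity))).congr_deriv ?_
    field_simp
    ring

theorem hasJet_inv {y : ℝ} (hy : y ≠ 0) : HasJet (fun y => y⁻¹) y (-(y ^ 2)⁻¹) (2 * (y ^ 3)⁻¹) := by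
  refine ⟨fun y => -(y ^ 2)⁻¹, rfl, ?_, ?_⟩
  · filter_upwards [isOpen_ne.mem_nhds hy] with r hr using hasDerivAt_inv hr
  · have := ((hasDerivAt_pow 2 y).inv (by positivity)).neg
    refine this.congr_deriv ?_
    field_simp
    norm_num
    ring

theorem cylJet_height (c : ℝ) (q : ℝ × ℝ) : CylJet (fun p => p.2 - c) q 0 1 0 0 := by
  have h := (HasJet.id q.2).add (HasJet.const (-c) q.2)
  exact (CylJet.of_snd (f := fun r => r + -c) (by fun_prop) h).cast rfl (by ring) rfl (by ring)

theorem cylJet_rad {c : ℝ} {q : ℝ × ℝ} (h : 0 < q.1 + (q.2 - c) ^ 2) :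
    CylJet (rad c) q (1 / (2 * rad c q)) ((q.2 - c) / rad c q) (-1 / (4 * rad c q ^ 3))
      (q.1 / rad c q ^ 3) := by
  have hr := rad_pos h
  have hsq := rad_sq h.le
  have j := (CylJet.fst q).add ((cylJet_height c q).mul (cylJet_height c q))
  have j' : CylJet (fun p => p.1 + (p.2 - c) ^ 2) q 1 (2 * (q.2 - c)) 0 2 :=
    (j.congr (Filter.Eventually.of_forall fun p => by ring)).cast (by ring) (by ring) (by ring)
      (by ring)
  refine (j'.comp (f := Real.sqrt) (Real.contDiffAt_sqrt h.ne') (hasJet_sqrt h)).cast ?_ ?_ ?_ ?_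
  · change 1 / (2 * rad c q) * 1 = _
    ring
  · change 1 / (2 * rad c q) * _ = _
    field_simp
  · change -1 / (4 * rad c q ^ 3) * 1 ^ 2 + 1 / (2 * rad c q) * 0 = _
    ring
  · change -1 / (4 * rad c q ^ 3) * _ + 1 / (2 * rad c q) * 2 = _
    field_simp
    linear_combination 4 * hsq

/-- The functions `r + (z - c)` (for `ε = 1`) and `r - (z - c)` (for `ε = -1`). -/
def radAdd (ε c : ℝ) (q : ℝ × ℝ) : ℝ := rad c q + ε * (q.2 - c)

theorem contDiffAt_radAdd {ε c : ℝ} {q : ℝ × ℝ} (h : 0 < q.1 + (q.2 - c) ^ 2) {n : WithTop ℕ∞} :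
    ContDiffAt ℝ n (radAdd ε c) q := by
  unfold radAdd
  exact (contDiffAt_rad h).add (by fun_prop)

theorem cylJet_radAdd (ε : ℝ) {c : ℝ} {q : ℝ × ℝ} (h : 0 < q.1 + (q.2 - c) ^ 2) :
    CylJet (radAdd ε c) q (1 / (2 * rad c q)) ((q.2 - c) / rad c q + ε) (-1 / (4 * rad c q ^ 3))
      (q.1 / rad c q ^ 3) :=
  ((cylJet_rad h).add ((cylJet_height c q).const_mul ε)).cast (by ring) (by ring) (by ring) (by ring)

/-- Up to a factor, log(r ± (z - c)) is the Newtonian potential of a uniformly charged half-line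
ending at c. In the present variables this is a polynomial identity modulo r² = s + (z - c)². -/
theorem logHarmonic_radAdd {ε c : ℝ} (hε : ε ^ 2 = 1) {q : ℝ × ℝ} (h : 0 < q.1 + (q.2 - c) ^ 2) :
    LogHarmonic q.1 (radAdd ε c q) (1 / (2 * rad c q)) ((q.2 - c) / rad c q + ε)
      (-1 / (4 * rad c q ^ 3)) (q.1 / rad c q ^ 3) := by
  have hr := rad_pos h
  have hsq := rad_sq h.le
  unfold LogHarmonic radAdd
  field_simp
  linear_combination 4 * rad c q * hsq - 4 * rad c q ^ 3 * hε

theorem logHarmonic_one (s : ℝ) : LogHarmonic s 1 0 0 0 0 := by simp [LogHarmonic]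

theorem logHarmonic_fst (s : ℝ) : LogHarmonic s s 1 0 0 0 := by simp [LogHarmonic]; ring

theorem radAdd_mul {c : ℝ} {q : ℝ × ℝ} (h : 0 ≤ q.1 + (q.2 - c) ^ 2) :
    radAdd 1 c q * radAdd (-1) c q = q.1 := by
  unfold radAdd
  linear_combination rad_sq h

theorem radAdd_pos {ε c : ℝ} (hε : ε ^ 2 = 1) {q : ℝ × ℝ} (h : 0 < q.1) : 0 < radAdd ε c q := by
  have h' : 0 < q.1 + (q.2 - c) ^ 2 := by positivity
  have hr := rad_pos h'
  have : |ε * (q.2 - c)| < rad c q := by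
    refine abs_lt_of_sq_lt_sq ?_ hr.le
    rw [rad_sq h'.le, mul_pow, hε]; linarith
  have := (abs_lt.1 this).1
  unfold radAdd; linarith

/-! ### The asymptotic region -/

/-- The values of the asymptotic model, in a suitable basis. -/
def farVal (D₁ D₂ : ℝ) (y w : Fin 5 → ℝ) (l : ℝ) : Fin 8 → ℝ :=
  ![D₁, 0, D₂, y 0 + l * w 0, y 1 + l * w 1, y 2 + l * w 2, y 3 + l * w 3, y 4 + l * w 4]

/-- The square of the tension of the asymptotic model without its decay factor. -/
def farNormSq (h₁ h₂ κ e ϱ w₁ w₂ G₁ G₂ C₀ C₁ a₀ b₀ δ : ℝ) : ℝ :=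
  let A₀₀ := w₂ * (e * C₀ ^ 2 * h₁ + δ * κ + 1 / 3 * (e * a₀ ^ 2 - δ * κ))
  let A₁₁ := w₂ * (e * C₁ ^ 2 * h₂ + 1 / 3 * (e * a₀ ^ 2 - δ * κ))
  ϱ ^ 2 * (1 / 2 * (A₀₀ + A₁₁) ^ 2 + 1 / 2 * (A₀₀ ^ 2
      + 2 * (w₂ * e * C₀ * C₁ * h₁) * (w₂ * e * C₀ * C₁ * h₂) + A₁₁ ^ 2))
    + e * ((w₁ * C₀ + w₂ * b₀ * δ - (2 * G₁ + G₂) * C₀) ^ 2 * h₁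
      + (w₁ * C₁ - (G₁ + 2 * G₂) * C₁) ^ 2 * h₂)
    + e * (w₁ * a₀ - (G₁ + G₂) * a₀ + w₂ * ϱ ^ 2 * κ * C₀) ^ 2
    + ((w₁ - G₁) ^ 2 * δ * κ - 2 * (w₁ - G₁) * κ * ϱ ^ 2 * w₂ * e * a₀ * C₀
      + ϱ ^ 2 * (w₂ * e * a₀ * C₀) ^ 2 * h₁)
    + ϱ ^ 2 * (-(w₂ * e * a₀ * C₁) + 2 * (1 / √3) * w₂ * a₀ * κ) ^ 2 * h₂

theorem cylNormSq_farVal {s D₁ a₁ b₁ c₁ d₁ D₂ a₂ b₂ c₂ d₂ l ls lz lss lzz : ℝ} {y w : Fin 5 → ℝ}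
    {κ e ϱ w₁ w₂ G₁ G₂ : ℝ} (hD₁ : D₁ ≠ 0) (hD₂ : D₂ ≠ 0) (hw4 : w 4 = 0)
    (l₁ : LogHarmonic s D₁ a₁ b₁ c₁ d₁) (l₂ : LogHarmonic s D₂ a₂ b₂ c₂ d₂)
    (hw₁ : 4 * s * lss + 4 * ls + lzz = ϱ ^ 2 * w₁) (hw₂ : 4 * s * ls ^ 2 + lz ^ 2 = ϱ ^ 2 * w₂)
    (hG₁ : (4 * s * ls * a₁ + lz * b₁) * D₁⁻¹ = ϱ ^ 2 * G₁)
    (hG₂ : (4 * s * ls * a₂ + lz * b₂) * D₂⁻¹ = ϱ ^ 2 * G₂)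
    (he : D₁⁻¹ * D₂⁻¹ = ϱ ^ 2 * e) (hk : w 3 * D₁⁻¹ = ϱ ^ 2 * κ) :
    cylNormSq s (farVal D₁ D₂ y w l)
      ![a₁, 0, a₂, ls * w 0, ls * w 1, ls * w 2, ls * w 3, 0]
      ![b₁, 0, b₂, lz * w 0, lz * w 1, lz * w 2, lz * w 3, 0]
      ![c₁, 0, c₂, lss * w 0, lss * w 1, lss * w 2, lss * w 3, 0]
      ![d₁, 0, d₂, lzz * w 0, lzz * w 1, lzz * w 2, lzz * w 3, 0]
      = ϱ ^ 6 * farNormSq D₁⁻¹ D₂⁻¹ κ e ϱ w₁ w₂ G₁ G₂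
        (w 0 + (w 2 - 1 / √3 / 3 * y 4 * w 3) * (y 3 + l * w 3))
        (w 1 + (w 2 - 1 / √3 / 3 * y 4 * w 3) * y 4) (w 2 - 1 / √3 * y 4 * w 3)
        (w 2 - 1 / √3 / 3 * y 4 * w 3) (w 3) := by
  set x := farVal D₁ D₂ y w l with hx
  obtain ⟨C₀, hC₀⟩ : ∃ C₀, C₀ = w 0 + (w 2 - 1 / √3 / 3 * y 4 * w 3) * (y 3 + l * w 3) := ⟨_, rfl⟩
  obtain ⟨C₁, hC₁⟩ : ∃ C₁, C₁ = w 1 + (w 2 - 1 / √3 / 3 * y 4 * w 3) * y 4 := ⟨_, rfl⟩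
  obtain ⟨a₀, ha₀⟩ : ∃ a₀, a₀ = w 2 - 1 / √3 * y 4 * w 3 := ⟨_, rfl⟩
  obtain ⟨b₀, hb₀⟩ : ∃ b₀, b₀ = w 2 - 1 / √3 / 3 * y 4 * w 3 := ⟨_, rfl⟩
  obtain ⟨δ, hδ⟩ : ∃ δ, δ = w 3 := ⟨_, rfl⟩
  obtain ⟨h₁, hh₁⟩ : ∃ h, h = D₁⁻¹ := ⟨_, rfl⟩
  obtain ⟨h₂, hh₂⟩ : ∃ h, h = D₂⁻¹ := ⟨_, rfl⟩
  have hD₁h : D₁ * h₁ = 1 := by rw [hh₁]; exact mul_inv_cancel₀ hD₁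
  have hD₂h : D₂ * h₂ = 1 := by rw [hh₂]; exact mul_inv_cancel₀ hD₂
  rw [← hC₀, ← hC₁, ← ha₀, ← hb₀, ← hh₁, ← hh₂]
  rw [← hb₀] at hC₀ hC₁
  rw [← hh₁] at hG₁ he hk
  rw [← hh₂] at hG₂ he
  rw [← hδ] at hk
  have x0 : x 0 = D₁ := rfl
  have x1 : x 1 = 0 := rfl
  have x2 : x 2 = D₂ := rfl
  have x6 : x 6 = y 3 + l * w 3 := rfl
  have x7 : x 7 = y 4 := by simp [hx, farVal, hw4]
  have hdet : detF x = D₁ * D₂ := by rw [detF, x0, x1, x2]; ring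
  have hdne : detF x ≠ 0 := by rw [hdet]; exact mul_ne_zero hD₁ hD₂
  have hdi : (detF x)⁻¹ = h₁ * h₂ := by rw [hdet, mul_inv, hh₁, hh₂]
  have gA' : gA x = h₁ := by rw [gA, hdi, x2]; linear_combination h₁ * hD₂h
  have gB' : gB x = 0 := by rw [gB, x1]; ring
  have gC' : gC x = h₂ := by rw [gC, hdi, x0]; linear_combination h₂ * hD₁h
  have ev : ∀ a c m : ℝ, ∀ u : Fin 8 → ℝ,
      u = ![a, 0, c, m * w 0, m * w 1, m * w 2, m * w 3, 0] →
      m00 x u = h₁ * a ∧ m01 x u = 0 ∧ m10 x u = 0 ∧ m11 x u = h₂ * c ∧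
      chiF x u = m * b₀ ∧ th0 x u = m * C₀ ∧ th1 x u = m * C₁ ∧ ups x u = m * a₀ ∧
      u 6 = m * δ ∧ u 7 = 0 := by
    rintro a c m u rfl
    have hchi : chiF x ![a, 0, c, m * w 0, m * w 1, m * w 2, m * w 3, 0] = m * b₀ := by
      rw [hb₀]; simp only [chiF, psiX, x7, Matrix.cons_val]; ring
    refine ⟨?_, ?_, ?_, ?_, hchi, ?_, ?_, ?_, ?_, rfl⟩
    · simp [m00, gA', gB']
    · simp [m01, gA', gB']
    · simp [m10, gB', gC']
    · simp [m11, gB', gC']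
    · rw [th0, hchi, hC₀, x6]; simp only [Matrix.cons_val]; ring
    · rw [th1, hchi, hC₁, x7]; simp only [Matrix.cons_val]; ring
    · rw [ups, ha₀]; simp only [psiX, x7, Matrix.cons_val]; ring
    · rw [hδ]; simp only [Matrix.cons_val]
  obtain ⟨s1, s2, s3, s4, s5, s6, s7, s8, s9, s10⟩ := ev a₁ a₂ ls _ rfl
  obtain ⟨z1, z2, z3, z4, z5, z6, z7, z8, z9, z10⟩ := ev b₁ b₂ lz _ rfl
  obtain ⟨p1, p2, p3, p4, p5, p6, p7, p8, p9, p10⟩ := ev c₁ c₂ lss _ rfl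
  obtain ⟨r1, r2, r3, r4, r5, r6, r7, r8, r9, r10⟩ := ev d₁ d₂ lzz _ rfl
  set xs : Fin 8 → ℝ := ![a₁, 0, a₂, ls * w 0, ls * w 1, ls * w 2, ls * w 3, 0]
  set xz : Fin 8 → ℝ := ![b₁, 0, b₂, lz * w 0, lz * w 1, lz * w 2, lz * w 3, 0]
  set xss : Fin 8 → ℝ := ![c₁, 0, c₂, lss * w 0, lss * w 1, lss * w 2, lss * w 3, 0]
  set xzz : Fin 8 → ℝ := ![d₁, 0, d₂, lzz * w 0, lzz * w 1, lzz * w 2, lzz * w 3, 0]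
  unfold LogHarmonic at l₁ l₂
  -- This is Δ log D₁ = 0. It removes the contribution of F itself, so that only derivatives of l
  -- remain in the tension.
  have hr₁ : h₁ * (4 * s * c₁ + 4 * a₁ + d₁) - 4 * s * (h₁ * a₁) ^ 2 - (h₁ * b₁) ^ 2 = 0 := by
    linear_combination h₁ ^ 2 * l₁ - h₁ * (4 * s * c₁ + 4 * a₁ + d₁) * hD₁h
  have hr₂ : h₂ * (4 * s * c₂ + 4 * a₂ + d₂) - 4 * s * (h₂ * a₂) ^ 2 - (h₂ * b₂) ^ 2 = 0 := by
    linear_combination h₂ ^ 2 * l₂ - h₂ * (4 * s * c₂ + 4 * a₂ + d₂) * hD₂h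
  set τ := cylTension s x xs xz xss xzz with hτ
  have T00 : m00 x τ = ϱ ^ 4 * (w₂ * (e * C₀ ^ 2 * h₁ + δ * κ + 1 / 3 * (e * a₀ ^ 2 - δ * κ))) := by
    rw [hτ, m00_cylTension, m00_gam hdne, m00_gam hdne]
    simp only [gamTr, gIn, gA', gB', gC', hdi, s1, s2, s3, s6, s7, s8, s9, s10, z1, z2, z3, z6, z7,
      z8, z9, z10, p1, r1]
    linear_combination hr₁ + (h₁ * h₂ * C₀ ^ 2 * h₁ + δ ^ 2 * h₁
      + 1 / 3 * (h₁ * h₂ * a₀ ^ 2 - δ ^ 2 * h₁)) * hw₂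
      + ϱ ^ 2 * w₂ * (C₀ ^ 2 * h₁ + 1 / 3 * a₀ ^ 2) * he + ϱ ^ 2 * w₂ * (2 / 3 * δ) * hk
  have T01 : m01 x τ = ϱ ^ 4 * (w₂ * e * C₀ * C₁ * h₁) := by
    rw [hτ, m01_cylTension, m01_gam hdne, m01_gam hdne]
    simp only [gA', gB', hdi, s1, s2, s4, s6, s7, s9, s10, z1, z2, z4, z6, z7, z9, z10, p2, r2]
    linear_combination (h₁ * h₂ * C₀ * C₁ * h₁) * hw₂ + ϱ ^ 2 * w₂ * (C₀ * C₁ * h₁) * he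
  have T10 : m10 x τ = ϱ ^ 4 * (w₂ * e * C₀ * C₁ * h₂) := by
    rw [hτ, m10_cylTension, m10_gam hdne, m10_gam hdne]
    simp only [gB', gC', hdi, s1, s3, s4, s6, s7, s9, s10, z1, z3, z4, z6, z7, z9, z10, p3, r3]
    linear_combination (h₁ * h₂ * C₀ * C₁ * h₂) * hw₂ + ϱ ^ 2 * w₂ * (C₀ * C₁ * h₂) * he
  have T11 : m11 x τ = ϱ ^ 4 * (w₂ * (e * C₁ ^ 2 * h₂ + 1 / 3 * (e * a₀ ^ 2 - δ * κ))) := by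
    rw [hτ, m11_cylTension, m11_gam hdne, m11_gam hdne]
    simp only [gamTr, gIn, gA', gB', gC', hdi, s2, s3, s4, s6, s7, s8, s9, s10, z2, z3, z4,
      z6, z7, z8, z9, z10, p4, r4]
    linear_combination hr₂ + (h₁ * h₂ * C₁ ^ 2 * h₂
      + 1 / 3 * (h₁ * h₂ * a₀ ^ 2 - δ ^ 2 * h₁)) * hw₂
      + ϱ ^ 2 * w₂ * (C₁ ^ 2 * h₂ + 1 / 3 * a₀ ^ 2) * he - ϱ ^ 2 * w₂ * (1 / 3 * δ) * hk
  have Tt0 : th0 x τ = ϱ ^ 2 * (w₁ * C₀ + w₂ * b₀ * δ - (2 * G₁ + G₂) * C₀) := by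
    rw [hτ, th0_cylTension]
    simp only [gamTh0, s1, s3, s4, s5, s6, s7, s9, z1, z3, z4, z5, z6, z7, z9, p6, r6]
    linear_combination C₀ * hw₁ + b₀ * δ * hw₂ - 2 * C₀ * hG₁ - C₀ * hG₂
  have Tt1 : th1 x τ = ϱ ^ 2 * (w₁ * C₁ - (G₁ + 2 * G₂) * C₁) := by
    rw [hτ, th1_cylTension]
    simp only [gamTh1, s1, s2, s4, s5, s6, s7, s10, z1, z2, z4, z5, z6, z7, z10, p7, r7]
    linear_combination C₁ * hw₁ - C₁ * hG₁ - 2 * C₁ * hG₂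
  have Tu : ups x τ = ϱ ^ 2 * (w₁ * a₀ - (G₁ + G₂) * a₀ + w₂ * ϱ ^ 2 * κ * C₀) := by
    rw [hτ, ups_cylTension]
    simp only [gamUps, gIn, gA', gB', gC', s1, s4, s6, s7, s8, s9, s10, z1, z4, z6, z7, z8, z9, z10,
      p8, r8]
    linear_combination a₀ * hw₁ - a₀ * hG₁ - a₀ * hG₂ + δ * C₀ * h₁ * hw₂ + ϱ ^ 2 * w₂ * C₀ * hk
  have T6 : τ 6 = ϱ ^ 2 * ((w₁ - G₁) * δ - ϱ ^ 2 * (w₂ * e * a₀ * C₀)) := by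
    rw [hτ, six_cylTension]
    simp only [gamPsi0, hdi, x0, x1, s1, s3, s6, s8, s9, s10, z1, z3, z6, z8, z9, z10, p9, r9]
    linear_combination δ * hw₁ - δ * hG₁ - h₁ * h₂ * a₀ * C₀ * hw₂ - ϱ ^ 2 * w₂ * a₀ * C₀ * he
  have T7 : τ 7 = ϱ ^ 4 * (-(w₂ * e * a₀ * C₁) + 2 * (1 / √3) * w₂ * a₀ * κ) := by
    rw [hτ, seven_cylTension]
    simp only [gamPsi1, hdi, x1, x2, s2, s4, s7, s8, s9, s10, z2, z4, z7, z8, z9, z10, p10, r10]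
    linear_combination (-(h₁ * h₂ * a₀ * C₁) + 2 * (1 / √3) * a₀ * (δ * h₁)) * hw₂
      - ϱ ^ 2 * w₂ * a₀ * C₁ * he + 2 * (1 / √3) * a₀ * ϱ ^ 2 * w₂ * hk
      + 2 * (1 / √3) * h₁ * a₀ * δ * (4 * s * ls ^ 2 + lz ^ 2) * hD₂h
  rw [cylNormSq, ← hτ, metric_eq, T00, T01, T10, T11, Tt0, Tt1, Tu, T6, T7, hdi, ← hδ]
  simp only [farNormSq, gIn, gA', gB', gC']
  linear_combination (ϱ ^ 4 * ((w₁ * C₀ + w₂ * b₀ * δ - (2 * G₁ + G₂) * C₀) ^ 2 * h₁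
      + (w₁ * C₁ - (G₁ + 2 * G₂) * C₁) ^ 2 * h₂)
    + ϱ ^ 4 * (w₁ * a₀ - (G₁ + G₂) * a₀ + w₂ * ϱ ^ 2 * κ * C₀) ^ 2) * he
    + ϱ ^ 4 * ((w₁ - G₁) ^ 2 * δ - 2 * (w₁ - G₁) * ϱ ^ 2 * w₂ * e * a₀ * C₀) * hk

/-! ### The angular transition and the decay of the tension -/

/-- A smooth function of the cosine of the polar angle which is constant near the axis. -/
def angStep (c : ℝ) : ℝ := Real.smoothTransition (1 / 2 - c)

theorem contDiff_angStep {n : ℕ∞} : ContDiff ℝ n angStep := by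
  unfold angStep
  exact Real.smoothTransition.contDiff.comp (by fun_prop)

theorem angStep_of_ge {c : ℝ} (h : 1 / 2 ≤ c) : angStep c = 0 :=
  Real.smoothTransition.zero_of_nonpos (by linarith)

theorem angStep_of_le {c : ℝ} (h : c ≤ -1 / 2) : angStep c = 1 :=
  Real.smoothTransition.one_of_one_le (by linarith)

theorem contDiff_deriv_angStep {n : ℕ∞} : ContDiff ℝ n (deriv angStep) := by
  have h : ContDiff ℝ (n + 1 : ℕ∞) angStep := contDiff_angStep
  push_cast at h
  exact (contDiff_succ_iff_deriv.1 h).2.2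

theorem deriv_angStep_eq_zero {c : ℝ} (h : 1 / 2 < |c|) :
    deriv angStep c = 0 ∧ deriv (deriv angStep) c = 0 := by
  have key : ∃ r, ∀ᶠ x in 𝓝 c, angStep x = r := by
    rcases lt_abs.1 h with h | h
    · exact ⟨0, by filter_upwards [lt_mem_nhds h] with x hx using angStep_of_ge hx.le⟩
    · exact ⟨1, by
        filter_upwards [gt_mem_nhds (show c < -1 / 2 by linarith)] with x hx
          using angStep_of_le hx.le⟩
  obtain ⟨r, hr⟩ := key
  have h1 : ∀ᶠ x in 𝓝 c, deriv angStep x = 0 := by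
    filter_upwards [hr.eventually_nhds] with x hx
    rw [Filter.EventuallyEq.deriv_eq (f := fun _ => r) hx, deriv_const]
  refine ⟨h1.self_of_nhds, ?_⟩
  rw [Filter.EventuallyEq.deriv_eq (f := fun _ => (0 : ℝ)) h1, deriv_const]

/-- The cosine of the polar angle. -/
def cosAng (q : ℝ × ℝ) : ℝ := q.2 / rad 0 q

theorem cosAng_sq {q : ℝ × ℝ} (h : 0 < q.1 + q.2 ^ 2) :
    q.1 = (1 - cosAng q ^ 2) * rad 0 q ^ 2 ∧ q.2 = cosAng q * rad 0 q := by
  have h' : 0 < q.1 + (q.2 - 0) ^ 2 := by simpa using h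
  have hr := rad_pos h'
  have h2 : q.2 = cosAng q * rad 0 q := by rw [cosAng, div_mul_cancel₀ _ hr.ne']
  refine ⟨?_, h2⟩
  have := rad_sq h'.le
  rw [sub_zero] at this
  linear_combination -this - (q.2 + cosAng q * rad 0 q) * h2

/-- The derivatives are written in r and cos θ alone, so that the homogeneity in r can be read off.
-/
theorem cylJet_cosAng {q : ℝ × ℝ} (h : 0 < q.1 + q.2 ^ 2) :
    CylJet cosAng q (-(cosAng q) / (2 * rad 0 q ^ 2)) ((1 - cosAng q ^ 2) / rad 0 q)
      (3 * cosAng q / (4 * rad 0 q ^ 4)) (-3 * (1 - cosAng q ^ 2) * cosAng q / rad 0 q ^ 2) := by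
  have h' : 0 < q.1 + (q.2 - 0) ^ 2 := by simpa using h
  have hr := rad_pos h'
  obtain ⟨h1, h2⟩ := cosAng_sq h
  have hi := (cylJet_rad h').comp (f := fun y => y⁻¹) (contDiffAt_inv ℝ hr.ne') (hasJet_inv hr.ne')
  have hz := cylJet_height 0 q
  refine ((hz.mul hi).congr (Filter.Eventually.of_forall fun p => ?_)).cast ?_ ?_ ?_ ?_
  · simp [cosAng, div_eq_mul_inv]
  all_goals
    simp only [sub_zero]
    set r := rad 0 q
    set c := cosAng q
    rw [h2]
    try rw [h1]
    field_simp
    ring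

theorem continuousOn_farNormSq {h₁ h₂ κ e ϱ w₁ w₂ G₁ G₂ C₀ C₁ a₀ b₀ δ : ℝ × ℝ → ℝ} {K : Set (ℝ × ℝ)}
    (k1 : ContinuousOn h₁ K) (k2 : ContinuousOn h₂ K) (k3 : ContinuousOn κ K) (k4 : ContinuousOn e K)
    (k5 : ContinuousOn ϱ K) (k6 : ContinuousOn w₁ K) (k7 : ContinuousOn w₂ K) (k8 : ContinuousOn G₁ K)
    (k9 : ContinuousOn G₂ K) (k10 : ContinuousOn C₀ K) (k11 : ContinuousOn C₁ K)
    (k12 : ContinuousOn a₀ K) (k13 : ContinuousOn b₀ K) (k14 : ContinuousOn δ K) :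
    ContinuousOn (fun t => farNormSq (h₁ t) (h₂ t) (κ t) (e t) (ϱ t) (w₁ t) (w₂ t) (G₁ t) (G₂ t)
      (C₀ t) (C₁ t) (a₀ t) (b₀ t) (δ t)) K := by
  simp only [farNormSq]
  fun_prop

/-- The jet of `angStep ∘ cosAng`. -/
theorem cylJet_angStep {q : ℝ × ℝ} (h : 0 < q.1 + q.2 ^ 2) : ∃ ls lz lss lzz : ℝ,
    CylJet (fun q => angStep (cosAng q)) q ls lz lss lzz ∧
    ls = deriv angStep (cosAng q) * (-(cosAng q) / (2 * rad 0 q ^ 2)) ∧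
    lz = deriv angStep (cosAng q) * ((1 - cosAng q ^ 2) / rad 0 q) ∧
    4 * q.1 * lss + 4 * ls + lzz = (rad 0 q)⁻¹ ^ 2 * (deriv (deriv angStep) (cosAng q)
      * (1 - cosAng q ^ 2) - 2 * cosAng q * deriv angStep (cosAng q)) ∧
    4 * q.1 * ls ^ 2 + lz ^ 2 =
      (rad 0 q)⁻¹ ^ 2 * (deriv angStep (cosAng q) ^ 2 * (1 - cosAng q ^ 2)) := by
  have h' : 0 < q.1 + (q.2 - 0) ^ 2 := by simpa using h
  have hr := rad_pos h'
  obtain ⟨h1, h2⟩ := cosAng_sq h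
  have hc : ContDiffAt ℝ 2 angStep (cosAng q) :=
    (contDiff_angStep (n := 2)).contDiffAt
  refine ⟨_, _, _, _, (cylJet_cosAng h).comp hc (HasJet.of_contDiffAt hc), rfl, rfl, ?_, ?_⟩
  all_goals
    rw [h1]
    field_simp
    ring

theorem norm_eq_rad (p : E3) : ‖p‖ = rad 0 (cyl p) := by
  rw [EuclideanSpace.norm_eq, rad]
  simp [Fin.sum_univ_three, cyl, rhoSq]

theorem isCompact_farBox : IsCompact (Set.Icc (0 : ℝ) 1 ×ˢ Set.Icc (-1 / 2 : ℝ) (1 / 2)) :=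
  isCompact_Icc.prod isCompact_Icc

/-- The decay of the tension of the asymptotic model, for a pair of factors `D₁`, `D₂`. -/
theorem tensionNorm_far {α β : Fin 2 → ℝ} (hdet : α 0 * β 1 - α 1 * β 0 ≠ 0)
    {D₁ D₂ a₁ b₁ c₁ d₁ a₂ b₂ c₂ d₂ : ℝ × ℝ → ℝ} {y w : Fin 5 → ℝ} (hw4 : w 4 = 0)
    (j₁ : ∀ q : ℝ × ℝ, 0 < q.1 → 0 < D₁ q ∧ CylJet D₁ q (a₁ q) (b₁ q) (c₁ q) (d₁ q) ∧
      LogHarmonic q.1 (D₁ q) (a₁ q) (b₁ q) (c₁ q) (d₁ q))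
    (j₂ : ∀ q : ℝ × ℝ, 0 < q.1 → 0 < D₂ q ∧ CylJet D₂ q (a₂ q) (b₂ q) (c₂ q) (d₂ q) ∧
      LogHarmonic q.1 (D₂ q) (a₂ q) (b₂ q) (c₂ q) (d₂ q))
    (hmul : ∀ q : ℝ × ℝ, 0 < q.1 → D₁ q * D₂ q = q.1)
    {h₁ h₂ : ℝ × ℝ → ℝ} {g₁ g₂ : ℝ → ℝ}
    (hc₁ : ContinuousOn h₁ (Set.Icc (0 : ℝ) 1 ×ˢ Set.Icc (-1 / 2 : ℝ) (1 / 2)))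
    (hc₂ : ContinuousOn h₂ (Set.Icc (0 : ℝ) 1 ×ˢ Set.Icc (-1 / 2 : ℝ) (1 / 2)))
    (hg₁ : Continuous g₁) (hg₂ : Continuous g₂)
    (hh₁ : ∀ q : ℝ × ℝ, 0 < q.1 → (D₁ q)⁻¹ = h₁ ((rad 0 q)⁻¹, cosAng q))
    (hh₂ : ∀ q : ℝ × ℝ, 0 < q.1 → (D₂ q)⁻¹ = h₂ ((rad 0 q)⁻¹, cosAng q))
    (hG₁ : ∀ q : ℝ × ℝ, 0 < q.1 → (4 * q.1 * (-(cosAng q) / (2 * rad 0 q ^ 2)) * a₁ q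
      + (1 - cosAng q ^ 2) / rad 0 q * b₁ q) * (D₁ q)⁻¹ = (rad 0 q)⁻¹ ^ 2 * g₁ (cosAng q))
    (hG₂ : ∀ q : ℝ × ℝ, 0 < q.1 → (4 * q.1 * (-(cosAng q) / (2 * rad 0 q ^ 2)) * a₂ q
      + (1 - cosAng q ^ 2) / rad 0 q * b₂ q) * (D₂ q)⁻¹ = (rad 0 q)⁻¹ ^ 2 * g₂ (cosAng q))
    (hk : ∀ q : ℝ × ℝ, 0 < q.1 →
      w 3 * (D₁ q)⁻¹ = (rad 0 q)⁻¹ ^ 2 * (w 3 / (1 - cosAng q ^ 2))) :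
    ∃ C, 0 ≤ C ∧ ∀ (X : ℝ × ℝ → Fin 8 → ℝ) (p : E3), 0 < rhoSq p → 1 ≤ ‖p‖ →
      (X =ᶠ[𝓝 (cyl p)] fun q => act α β (farVal (D₁ q) (D₂ q) y w (angStep (cosAng q)))) →
      tensionNorm (fun x => X (cyl x)) p ≤ C * ‖p‖ ^ (-3 : ℤ) := by
  set K : Set (ℝ × ℝ) := Set.Icc (0 : ℝ) 1 ×ˢ Set.Icc (-1 / 2 : ℝ) (1 / 2) with hK
  -- The remaining factor r⁶|τ|² is a function of (1/r, cos θ). In these variables the exterior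
  -- region r ≥ 1 becomes relatively compact, and N is continuous up to 1/r = 0 on the transition
  -- zone.
  set N : ℝ × ℝ → ℝ := fun t => farNormSq (h₁ t) (h₂ t) (w 3 / (1 - t.2 ^ 2)) (1 / (1 - t.2 ^ 2)) t.1
      (deriv (deriv angStep) t.2 * (1 - t.2 ^ 2) - 2 * t.2 * deriv angStep t.2)
      (deriv angStep t.2 ^ 2 * (1 - t.2 ^ 2)) (deriv angStep t.2 * g₁ t.2)
      (deriv angStep t.2 * g₂ t.2)
      (w 0 + (w 2 - 1 / √3 / 3 * y 4 * w 3) * (y 3 + angStep t.2 * w 3))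
      (w 1 + (w 2 - 1 / √3 / 3 * y 4 * w 3) * y 4) (w 2 - 1 / √3 * y 4 * w 3)
      (w 2 - 1 / √3 / 3 * y 4 * w 3) (w 3) with hN
  have hcont : ContinuousOn N K := by
    have s0 : Continuous angStep := (contDiff_angStep (n := 0)).continuous
    have s1 : Continuous (deriv angStep) := (contDiff_deriv_angStep (n := 0)).continuous
    have s2 : Continuous (deriv (deriv angStep)) :=
      (contDiff_deriv_angStep (n := 1)).continuous_deriv le_rfl
    have hne : ∀ t ∈ K, (1 : ℝ) - t.2 ^ 2 ≠ 0 := by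
      rintro ⟨t₁, t₂⟩ ⟨-, ht⟩
      have : t₂ ^ 2 ≤ (1 / 2) ^ 2 := sq_le_sq' (by linarith [ht.1]) ht.2
      simp only
      intro h0
      linarith
    have hsub : ContinuousOn (fun t : ℝ × ℝ => (1 : ℝ) - t.2 ^ 2) K := by fun_prop
    refine continuousOn_farNormSq hc₁ hc₂ (continuousOn_const.div hsub hne)
      (continuousOn_const.div hsub hne) ?_ ?_ ?_ ?_ ?_ ?_ ?_ ?_ ?_ ?_
    all_goals fun_prop
  obtain ⟨M, hM⟩ := isCompact_farBox.exists_bound_of_continuousOn hcont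
  refine ⟨√(max M 0), Real.sqrt_nonneg _, ?_⟩
  intro X p hp h1 hX
  have hq : 0 < (cyl p).1 := hp
  have hpos : 0 < (cyl p).1 + (cyl p).2 ^ 2 := by positivity
  have hpos' : 0 < (cyl p).1 + ((cyl p).2 - 0) ^ 2 := by positivity
  rw [norm_eq_rad] at h1 ⊢
  set q := cyl p with hqdef
  have hr : 0 < rad 0 q := rad_pos hpos'
  obtain ⟨ls, lz, lss, lzz, jl, e1, e2, e3, e4⟩ := cylJet_angStep hpos
  obtain ⟨p₁, j₁, l₁⟩ := j₁ q hq
  obtain ⟨p₂, j₂, l₂⟩ := j₂ q hq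
  obtain ⟨sq1, sq2⟩ := cosAng_sq hpos
  have hσ : 1 - cosAng q ^ 2 ≠ 0 := by
    intro h0; rw [h0, zero_mul] at sq1; exact hq.ne' sq1
  rw [tensionNorm_of_act hdet hX
    (xs := ![a₁ q, 0, a₂ q, ls * w 0, ls * w 1, ls * w 2, ls * w 3, 0])
    (xz := ![b₁ q, 0, b₂ q, lz * w 0, lz * w 1, lz * w 2, lz * w 3, 0])
    (xss := ![c₁ q, 0, c₂ q, lss * w 0, lss * w 1, lss * w 2, lss * w 3, 0])
    (xzz := ![d₁ q, 0, d₂ q, lzz * w 0, lzz * w 1, lzz * w 2, lzz * w 3, 0]) ?_ ?_]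
  · have hs : rhoSq p = q.1 := rfl
    rw [hs, cylNormSq_farVal (ϱ := (rad 0 q)⁻¹) (e := 1 / (1 - cosAng q ^ 2))
      (G₁ := deriv angStep (cosAng q) * g₁ (cosAng q)) (G₂ := deriv angStep (cosAng q) * g₂ (cosAng q))
      p₁.ne' p₂.ne' hw4 l₁ l₂ e3 e4 (by
        rw [e1, e2]; linear_combination deriv angStep (cosAng q) * hG₁ q hq) (by
        rw [e1, e2]; linear_combination deriv angStep (cosAng q) * hG₂ q hq) (by
        rw [← mul_inv, hmul q hq]
        conv_lhs => rw [sq1]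
        field_simp) (hk q hq), hh₁ q hq, hh₂ q hq]
    change √((rad 0 q)⁻¹ ^ 6 * N ((rad 0 q)⁻¹, cosAng q)) ≤ _
    -- In the transition zone the bound comes from compactness. Outside it the derivatives of
    -- `angStep` vanish and N = 0, so the singularity of 1 / sin² θ on the axis plays no role.
    have hNM : N ((rad 0 q)⁻¹, cosAng q) ≤ max M 0 := by
      by_cases hc : |cosAng q| ≤ 1 / 2
      · refine le_max_of_le_left ((le_abs_self _).trans (hM _ ⟨⟨by positivity, ?_⟩, ?_, ?_⟩))
        · exact inv_le_one_of_one_le₀ h1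
        · linarith [(abs_le.1 hc).1]
        · exact (abs_le.1 hc).2
      · obtain ⟨z1, z2⟩ := deriv_angStep_eq_zero (not_le.1 hc)
        refine le_max_of_le_right (le_of_eq ?_)
        simp [hN, z1, z2, farNormSq]
    calc √((rad 0 q)⁻¹ ^ 6 * N ((rad 0 q)⁻¹, cosAng q)) ≤ √((rad 0 q)⁻¹ ^ 6 * max M 0) := by
          refine Real.sqrt_le_sqrt ?_
          gcongr
      _ = √(max M 0) * rad 0 q ^ (-3 : ℤ) := by
          rw [Real.sqrt_mul (by positivity), show (rad 0 q)⁻¹ ^ 6 = ((rad 0 q)⁻¹ ^ 3) ^ 2 by ring,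
            Real.sqrt_sq (by positivity), zpow_neg, inv_pow, mul_comm]
          rfl
  · intro A
    have lin : ∀ r r' : ℝ, CylJet (fun q => r + angStep (cosAng q) * r') q (ls * r') (lz * r')
        (lss * r') (lzz * r') := fun r r' =>
      (((jl.const_mul r').add_const r).congr (Filter.Eventually.of_forall fun q => by ring)).cast
        (by ring) (by ring) (by ring) (by ring)
    fin_cases A
    · exact j₁
    · exact CylJet.const 0 _
    · exact j₂
    · exact lin _ _
    · exact lin _ _
    · exact lin _ _
    · exact lin _ _
    · exact (lin (y 4) (w 4)).cast (by simp [hw4]) (by simp [hw4]) (by simp [hw4]) (by simp [hw4])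
  · rw [target_iff_det]
    refine ⟨p₁, ?_⟩
    have : detF (farVal (D₁ q) (D₂ q) y w (angStep (cosAng q))) = D₁ q * D₂ q := by
      simp [detF, farVal]
    rw [this]; exact mul_pos p₁ p₂

theorem one_sub_cosAng {ε : ℝ} (hε : ε ^ 2 = 1) {q : ℝ × ℝ} (h : 0 < q.1) :
    0 < 1 + ε * cosAng q ∧ radAdd ε 0 q = rad 0 q * (1 + ε * cosAng q) := by
  have hpos : 0 < q.1 + q.2 ^ 2 := by positivity
  have hr : 0 < rad 0 q := rad_pos (by simpa using hpos)
  obtain ⟨-, h2⟩ := cosAng_sq hpos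
  have h3 : radAdd ε 0 q = rad 0 q * (1 + ε * cosAng q) := by
    rw [radAdd, sub_zero]; linear_combination ε * h2
  refine ⟨?_, h3⟩
  have := radAdd_pos (c := 0) hε h
  rw [h3] at this
  exact pos_of_mul_pos_right this hr.le

/-- Asymptotic model when the two semi-infinite rods have independent rod structures. -/
theorem tensionNorm_far_corner {α β : Fin 2 → ℝ} (hdet : α 0 * β 1 - α 1 * β 0 ≠ 0)
    {y w : Fin 5 → ℝ} (hw3 : w 3 = 0) (hw4 : w 4 = 0) :
    ∃ C, 0 ≤ C ∧ ∀ (X : ℝ × ℝ → Fin 8 → ℝ) (p : E3), 0 < rhoSq p → 1 ≤ ‖p‖ →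
      (X =ᶠ[𝓝 (cyl p)] fun q => act α β (farVal (radAdd (-1) 0 q) (radAdd 1 0 q) y w
        (angStep (cosAng q)))) →
      tensionNorm (fun x => X (cyl x)) p ≤ C * ‖p‖ ^ (-3 : ℤ) := by
  have e1 : (-1 : ℝ) ^ 2 = 1 := by norm_num
  have e2 : (1 : ℝ) ^ 2 = 1 := by norm_num
  have hpos : ∀ q : ℝ × ℝ, 0 < q.1 → 0 < q.1 + (q.2 - 0) ^ 2 := fun q h => by positivity
  have hpos' : ∀ q : ℝ × ℝ, 0 < q.1 → 0 < q.1 + q.2 ^ 2 := fun q h => by positivity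
  refine tensionNorm_far hdet hw4
    -- These are 1 / (r - z) and 1 / (r + z) in the variables (1/r, cos θ). The functions g₁, g₂ are
    -- r² ⟨∇cos θ, ∇log Dᵢ⟩.
    (h₁ := fun t => t.1 / (1 - t.2)) (h₂ := fun t => t.1 / (1 + t.2))
    (g₁ := fun c => -(1 + c)) (g₂ := fun c => 1 - c)
    (fun q h => ⟨radAdd_pos e1 h, cylJet_radAdd (-1) (hpos q h), logHarmonic_radAdd e1 (hpos q h)⟩)
    (fun q h => ⟨radAdd_pos e2 h, cylJet_radAdd 1 (hpos q h), logHarmonic_radAdd e2 (hpos q h)⟩)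
    (fun q h => by rw [mul_comm]; exact radAdd_mul (hpos q h).le) ?_ ?_ (by fun_prop) (by fun_prop)
    ?_ ?_ ?_ ?_ ?_
  · refine continuousOn_fst.div (by fun_prop) ?_
    rintro ⟨t₁, t₂⟩ ⟨-, ht⟩
    have := ht.2
    simp only
    intro h0
    simp only at this
    linarith
  · refine continuousOn_fst.div (by fun_prop) ?_
    rintro ⟨t₁, t₂⟩ ⟨-, ht⟩
    have := ht.1
    simp only
    intro h0
    simp only at this
    linarith
  · intro q h
    obtain ⟨h1, h2⟩ := one_sub_cosAng e1 h
    rw [h2, mul_inv, div_eq_mul_inv]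
    ring
  · intro q h
    obtain ⟨h1, h2⟩ := one_sub_cosAng e2 h
    rw [h2, mul_inv, div_eq_mul_inv]
    ring
  · intro q h
    obtain ⟨h1, h2⟩ := one_sub_cosAng e1 h
    obtain ⟨k1, k2⟩ := cosAng_sq (hpos' q h)
    have hr : 0 < rad 0 q := rad_pos (hpos q h)
    have hn : (1 : ℝ) - cosAng q ≠ 0 := by intro h0; linarith
    rw [h2, sub_zero, show (1 : ℝ) + -1 * cosAng q = 1 - cosAng q by ring]
    set r := rad 0 q
    set c := cosAng q
    rw [k1, k2]
    field_simp
    ring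
  · intro q h
    obtain ⟨h1, h2⟩ := one_sub_cosAng e2 h
    obtain ⟨k1, k2⟩ := cosAng_sq (hpos' q h)
    have hr : 0 < rad 0 q := rad_pos (hpos q h)
    have hn : (1 : ℝ) + cosAng q ≠ 0 := by intro h0; linarith
    rw [h2, sub_zero, show (1 : ℝ) + 1 * cosAng q = 1 + cosAng q by ring]
    set r := rad 0 q
    set c := cosAng q
    rw [k1, k2]
    field_simp
    ring
  · intro q h
    simp [hw3]

/-- Asymptotic model when the two semi-infinite rods have parallel rod structures. -/
theorem tensionNorm_far_rod {α β : Fin 2 → ℝ} (hdet : α 0 * β 1 - α 1 * β 0 ≠ 0)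
    {y w : Fin 5 → ℝ} (hw4 : w 4 = 0) :
    ∃ C, 0 ≤ C ∧ ∀ (X : ℝ × ℝ → Fin 8 → ℝ) (p : E3), 0 < rhoSq p → 1 ≤ ‖p‖ →
      (X =ᶠ[𝓝 (cyl p)] fun q => act α β (farVal q.1 1 y w (angStep (cosAng q)))) →
      tensionNorm (fun x => X (cyl x)) p ≤ C * ‖p‖ ^ (-3 : ℤ) := by
  have hpos : ∀ q : ℝ × ℝ, 0 < q.1 → 0 < q.1 + q.2 ^ 2 := fun q h => by positivity
  have hinv : ∀ q : ℝ × ℝ, 0 < q.1 → (q.1)⁻¹ = (rad 0 q)⁻¹ ^ 2 / (1 - cosAng q ^ 2) := by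
    intro q h
    obtain ⟨k1, -⟩ := cosAng_sq (hpos q h)
    conv_lhs => rw [k1]
    rw [mul_inv, inv_pow, div_eq_mul_inv, mul_comm]
  refine tensionNorm_far hdet hw4 (D₁ := fun q => q.1) (D₂ := fun _ => 1)
    (h₁ := fun t => t.1 ^ 2 / (1 - t.2 ^ 2)) (h₂ := fun _ => 1)
    (g₁ := fun c => -2 * c) (g₂ := fun _ => 0)
    (fun q h => ⟨h, CylJet.fst q, logHarmonic_fst q.1⟩)
    (fun q h => ⟨one_pos, CylJet.const 1 q, logHarmonic_one q.1⟩)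
    (fun q h => mul_one _) ?_ continuousOn_const (by fun_prop) (by fun_prop)
    (fun q h => hinv q h) (fun q h => inv_one) ?_ (fun q h => by simp) ?_
  · refine ContinuousOn.div (by fun_prop) (by fun_prop) ?_
    rintro ⟨t₁, t₂⟩ ⟨-, ht⟩
    have : t₂ ^ 2 ≤ (1 / 2) ^ 2 := sq_le_sq' (by linarith [ht.1]) ht.2
    simp only
    intro h0
    linarith
  · intro q h
    have hr : 0 < rad 0 q := rad_pos (by simpa using hpos q h)
    have := h.ne'
    field_simp
    ring
  · intro q h
    rw [hinv q h]; ring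

/-! ### Rods as intervals of heights, and a partition of unity on the axis -/

namespace RodData

variable {L : ℕ} (R : RodData L)

/-- The height `h` lies in the interior of the rod `l`. -/
def Inside (l : Fin (L + 1)) (h : ℝ) : Prop :=
  (∀ i : Fin L, (i : ℕ) < l → h < R.z i) ∧ ∀ i : Fin L, (l : ℕ) ≤ i → R.z i < h

variable {R}

theorem inside_or_eq (hz : StrictAnti R.z) (h : ℝ) : (∃ k, h = R.z k) ∨ ∃ l, R.Inside l h := by
  by_cases hk : ∃ k, h = R.z k
  · exact Or.inl hk
  refine Or.inr ?_
  have hk' : ∀ k, h ≠ R.z k := fun k e => hk ⟨k, e⟩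
  -- The rod containing h is numbered by the least n for which all separating points from the n-th
  -- on lie below h.
  have hP : ∃ n : ℕ, n ≤ L ∧ ∀ i : Fin L, n ≤ (i : ℕ) → R.z i < h :=
    ⟨L, le_rfl, fun i hi => absurd hi (not_le.2 i.2)⟩
  classical
  obtain ⟨hn, hn'⟩ := Nat.find_spec hP
  refine ⟨⟨Nat.find hP, Nat.lt_succ_of_le hn⟩, fun i hi => ?_, hn'⟩
  by_contra hlt
  have hlt' : R.z i < h := lt_of_le_of_ne (not_lt.1 hlt) (hk' i).symm
  exact Nat.find_min hP hi ⟨i.2.le, fun j hj => (hz.antitone hj).trans_lt hlt'⟩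

theorem Inside.eventually {l : Fin (L + 1)} {h : ℝ} (H : R.Inside l h) :
    ∀ᶠ h' in 𝓝 h, R.Inside l h' := by
  refine Filter.Eventually.and ?_ ?_
  · refine Filter.eventually_all.2 fun i => ?_
    by_cases hi : (i : ℕ) < l
    · filter_upwards [gt_mem_nhds (H.1 i hi)] with h' hh _ using hh
    · exact Filter.Eventually.of_forall fun _ hh => absurd hh hi
  · refine Filter.eventually_all.2 fun i => ?_
    by_cases hi : (l : ℕ) ≤ i
    · filter_upwards [lt_mem_nhds (H.2 i hi)] with h' hh _ using hh
    · exact Filter.Eventually.of_forall fun _ hh => absurd hh hi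

theorem mem_rod_iff {l : Fin (L + 1)} {x : E3} : x ∈ R.rod l ↔ rhoSq x = 0 ∧
    (∀ i : Fin L, (i : ℕ) = l → R.z i ≤ x 2) ∧ ∀ i : Fin L, (i : ℕ) + 1 = l → x 2 ≤ R.z i := by
  have h0 : rhoSq x = 0 ↔ x 0 = 0 ∧ x 1 = 0 := by
    unfold rhoSq
    constructor
    · intro h
      constructor <;> nlinarith [sq_nonneg (x 0), sq_nonneg (x 1)]
    · rintro ⟨h1, h2⟩; simp [h1, h2]
  have e1 : ∀ i : Fin L, i.castSucc = l ↔ (i : ℕ) = l := fun i => Fin.ext_iff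
  have e2 : ∀ i : Fin L, i.succ = l ↔ (i : ℕ) + 1 = l := fun i => Fin.ext_iff
  simp only [rod, Set.mem_ofPred_eq, h0, e1, e2, and_assoc]

theorem Inside.mem_rod {l : Fin (L + 1)} {x : E3} (H : R.Inside l (x 2)) (hx : rhoSq x = 0) :
    x ∈ R.rod l :=
  mem_rod_iff.2 ⟨hx, fun i hi => (H.2 i hi.ge).le, fun i hi => (H.1 i (by omega)).le⟩

theorem Inside.eq_of_mem_rod {l l' : Fin (L + 1)} {x : E3} (H : R.Inside l (x 2))
    (hx : x ∈ R.rod l') : l' = l := by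
  obtain ⟨-, h1, h2⟩ := mem_rod_iff.1 hx
  rcases lt_trichotomy (l' : ℕ) l with hl | hl | hl
  · have hi : (l' : ℕ) < L := by omega
    exact absurd (H.1 ⟨l', hi⟩ hl) (not_lt.2 (h1 ⟨l', hi⟩ rfl))
  · exact Fin.ext hl
  · have hi : (l' : ℕ) - 1 < L := by omega
    exact absurd (H.2 ⟨l' - 1, hi⟩ (by simp only; omega))
      (not_lt.2 (h2 ⟨l' - 1, hi⟩ (by simp only; omega)))

theorem Inside.unique {l l' : Fin (L + 1)} {h : ℝ} (H : R.Inside l h) (H' : R.Inside l' h) :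
    l' = l := by
  refine H.eq_of_mem_rod (x := axisPt h) (H'.mem_rod (x := axisPt h) ?_)
  simp [rhoSq, axisPt]

theorem mem_rod_endPt (hz : StrictAnti R.z) {k : Fin L} {l : Fin (L + 1)} {x : E3}
    (hx : rhoSq x = 0) (hk : x 2 = R.z k) : x ∈ R.rod l ↔ l = k.castSucc ∨ l = k.succ := by
  rw [mem_rod_iff, hk]
  constructor
  · rintro ⟨-, h1, h2⟩
    rcases lt_trichotomy (l : ℕ) k with hl | hl | hl
    · exact absurd (hz (show (⟨l, by omega⟩ : Fin L) < k from hl)) (not_lt.2 (h1 ⟨l, by omega⟩ rfl))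
    · exact Or.inl (Fin.ext hl)
    · refine Or.inr (Fin.ext ?_)
      by_contra hne
      have hne' : (l : ℕ) ≠ k + 1 := hne
      have hi : (l : ℕ) - 1 < L := by omega
      exact absurd (hz (show k < (⟨l - 1, hi⟩ : Fin L) from by rw [Fin.lt_def]; simp only; omega))
        (not_lt.2 (h2 ⟨l - 1, hi⟩ (by simp only; omega)))
  · rintro (rfl | rfl)
    · refine ⟨hx, fun i hi => ?_, fun i hi => ?_⟩
      · rw [Fin.ext (show (i : ℕ) = k from hi)]
      · exact hz.antitone (show (i : ℕ) ≤ k by simp only [Fin.val_castSucc] at hi; omega)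
    · refine ⟨hx, fun i hi => ?_, fun i hi => ?_⟩
      · exact hz.antitone (show (k : ℕ) ≤ i by simp only [Fin.val_succ] at hi; omega)
      · rw [Fin.ext (show (i : ℕ) = k by simp only [Fin.val_succ] at hi; omega)]

theorem Inside.castSucc_of_gt (hz : StrictAnti R.z) {k : Fin L} {l : Fin (L + 1)} {h : ℝ}
    (H : R.Inside l h) (hU : ∀ i, i < k → h < R.z i) (hk : R.z k < h) : l = k.castSucc := by
  refine (H.unique ⟨fun i hi => hU i hi, fun i hi => ?_⟩).symm
  exact (hz.antitone (show k ≤ i from hi)).trans_lt hk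

theorem Inside.succ_of_lt (hz : StrictAnti R.z) {k : Fin L} {l : Fin (L + 1)} {h : ℝ}
    (H : R.Inside l h) (hU : ∀ i, k < i → R.z i < h) (hk : h < R.z k) : l = k.succ := by
  refine (H.unique ⟨fun i hi => ?_, fun i hi => hU i (Nat.lt_of_succ_le hi)⟩).symm
  exact hk.trans_le (hz.antitone (show i ≤ k from Nat.lt_succ_iff.1 hi))

variable (R)

/-- A height beyond all the separating points. -/
def outer : ℝ := 1 + ∑ k, |R.z k|

theorem abs_z_lt_outer (k : Fin L) : |R.z k| < R.outer := by
  have := Finset.single_le_sum (f := fun k => |R.z k|) (fun i _ => abs_nonneg _) (Finset.mem_univ k)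
  unfold outer
  linarith

theorem one_le_outer : 1 ≤ R.outer := by
  have := Finset.sum_nonneg (s := Finset.univ) (f := fun k => |R.z k|) fun i _ => abs_nonneg _
  unfold outer
  linarith

variable {R}

theorem inside_zero {h : ℝ} (hh : R.outer ≤ h) : R.Inside 0 h :=
  ⟨fun _ hi => absurd hi (Nat.not_lt_zero _), fun i _ =>
    ((le_abs_self _).trans_lt (R.abs_z_lt_outer i)).trans_le hh⟩

theorem inside_last {h : ℝ} (hh : h ≤ -R.outer) : R.Inside (Fin.last L) h :=
  ⟨fun i _ => by have := neg_abs_le (R.z i); have := R.abs_z_lt_outer i; linarith,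
    fun i hi => absurd hi (not_le.2 i.2)⟩

variable (R)

/-- The pieces of the axis on which one model is used: a neighbourhood of each separating point
that contains no other, and (for `true`, `false`) the northern and southern ends of the axis. -/
def piece : Fin L ⊕ Bool → Set ℝ
  | .inl k => {h | (∀ i, i < k → h < R.z i) ∧ (∀ i, k < i → R.z i < h) ∧ |h| < R.outer}
  | .inr true => {h | R.Inside 0 h ∧ -R.outer < h}
  | .inr false => {h | R.Inside (Fin.last L) h ∧ h < R.outer}

variable {R}

theorem isOpen_piece (i : Fin L ⊕ Bool) : IsOpen (R.piece i) := by
  rw [isOpen_iff_eventually]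
  intro h hh
  rcases i with k | _ | _
  · refine Filter.Eventually.and ?_ (Filter.Eventually.and ?_ ?_)
    · refine Filter.eventually_all.2 fun i => ?_
      by_cases hi : i < k
      · filter_upwards [gt_mem_nhds (hh.1 i hi)] with h' hh _ using hh
      · exact Filter.Eventually.of_forall fun _ hh => absurd hh hi
    · refine Filter.eventually_all.2 fun i => ?_
      by_cases hi : k < i
      · filter_upwards [lt_mem_nhds (hh.2.1 i hi)] with h' hh _ using hh
      · exact Filter.Eventually.of_forall fun _ hh => absurd hh hi
    · exact continuous_abs.continuousAt.eventually (gt_mem_nhds hh.2.2)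
  · exact hh.1.eventually.and (gt_mem_nhds hh.2)
  · exact hh.1.eventually.and (lt_mem_nhds hh.2)

theorem exists_mem_piece (hz : StrictAnti R.z) (h : ℝ) : ∃ i, h ∈ R.piece i := by
  rcases inside_or_eq hz h with ⟨k, rfl⟩ | ⟨l, H⟩
  · exact ⟨.inl k, fun i hi => hz hi, fun i hi => hz hi, R.abs_z_lt_outer k⟩
  have hA := R.one_le_outer
  by_cases h1 : R.outer ≤ h
  · exact ⟨.inr true, inside_zero h1, by linarith⟩
  by_cases h2 : h ≤ -R.outer
  · exact ⟨.inr false, inside_last h2, by linarith⟩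
  push Not at h1 h2
  -- The first rod lies in the northern piece; the interior of any other rod lies in the piece
  -- around its upper end point.
  rcases Fin.eq_zero_or_eq_succ l with rfl | ⟨k, rfl⟩
  · exact ⟨.inr true, H, h2⟩
  · refine ⟨.inl k, fun i hi => H.1 i ?_, fun i hi => H.2 i ?_, abs_lt.2 ⟨h2, h1⟩⟩
    · exact Nat.lt_succ_of_lt hi
    · exact Nat.succ_le_of_lt hi

/-- A smooth partition of unity subordinate to the pieces of the axis. -/
structure IsAxisPartition (R : RodData L) (η : Fin L ⊕ Bool → ℝ → ℝ) : Prop where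
  smooth : ∀ i, ContDiff ℝ ∞ (η i)
  nonneg : ∀ i h, 0 ≤ η i h
  sum_eq_one : ∀ h, ∑ i, η i h = 1
  eventually_eq_zero : ∀ i h, h ∉ R.piece i → ∀ᶠ h' in 𝓝 h, η i h' = 0

theorem exists_axisPartition (hz : StrictAnti R.z) : ∃ η, R.IsAxisPartition η := by
  obtain ⟨f, hf⟩ := SmoothPartitionOfUnity.exists_isSubordinate (modelWithCornersSelf ℝ ℝ) isClosed_univ
    R.piece isOpen_piece fun h _ => Set.mem_iUnion.2 (exists_mem_piece hz h)
  refine ⟨fun i => f i, fun i => (f i).contMDiff.contDiff, fun i h => f.nonneg i h, fun h => ?_,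
    fun i h hh => ?_⟩
  · rw [← finsum_eq_sum_of_fintype]
    exact f.sum_eq_one (Set.mem_univ h)
  · have : h ∉ tsupport (f i) := fun h' => hh (hf i h')
    exact notMem_tsupport_iff_eventuallyEq.1 this

end RodData

/-! ### Symmetric `2 × 2` matrices as triples -/

/-- The matrix `v vᵀ`. -/
def sqVec (v : Fin 2 → ℝ) : Fin 3 → ℝ := ![v 0 ^ 2, v 0 * v 1, v 1 ^ 2]

/-- The matrix `v wᵀ + w vᵀ`. -/
def symVec (v w : Fin 2 → ℝ) : Fin 3 → ℝ := ![2 * (v 0 * w 0), v 0 * w 1 + v 1 * w 0, 2 * (v 1 * w 1)]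

/-- The quadratic form of a symmetric matrix. -/
def quadForm (f : Fin 3 → ℝ) (w : Fin 2 → ℝ) : ℝ :=
  f 0 * w 0 ^ 2 + 2 * f 1 * (w 0 * w 1) + f 2 * w 1 ^ 2

/-- The point of the target with given `F` and given potentials. -/
def join (f : Fin 3 → ℝ) (y : Fin 5 → ℝ) : Fin 8 → ℝ := ![f 0, f 1, f 2, y 0, y 1, y 2, y 3, y 4]

theorem quadForm_sqVec (v w : Fin 2 → ℝ) : quadForm (sqVec v) w = (v ⬝ᵥ w) ^ 2 := by
  simp [quadForm, sqVec, dotProduct, Fin.sum_univ_two]; ring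

theorem quadForm_add (f g : Fin 3 → ℝ) (w : Fin 2 → ℝ) :
    quadForm (f + g) w = quadForm f w + quadForm g w := by
  simp [quadForm]; ring

theorem quadForm_smul (r : ℝ) (f : Fin 3 → ℝ) (w : Fin 2 → ℝ) :
    quadForm (r • f) w = r * quadForm f w := by
  simp [quadForm]; ring

theorem quadForm_sum {J : Type*} (s : Finset J) (f : J → Fin 3 → ℝ) (w : Fin 2 → ℝ) :
    quadForm (∑ j ∈ s, f j) w = ∑ j ∈ s, quadForm (f j) w := by
  classical
  induction s using Finset.induction_on with
  | empty => simp [quadForm]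
  | insert j s hj ih => rw [Finset.sum_insert hj, Finset.sum_insert hj, quadForm_add, ih]

theorem join_mem_target {f : Fin 3 → ℝ} {y : Fin 5 → ℝ} :
    join f y ∈ target ↔ ∀ w, w ≠ 0 → 0 < quadForm f w := by
  rw [target_iff]
  constructor
  · intro h w hw
    refine h (w 0) (w 1) fun e => hw ?_
    obtain ⟨e0, e1⟩ := Prod.mk.inj e
    ext i; fin_cases i
    · exact e0
    · exact e1
  · intro h a b hab
    refine h ![a, b] fun e => hab ?_
    have e0 := congrFun e 0
    have e1 := congrFun e 1
    exact Prod.ext e0 e1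

/-- `f` is smooth and positive definite at `q`. -/
def Regular (f : ℝ × ℝ → Fin 3 → ℝ) (q : ℝ × ℝ) : Prop :=
  ContDiffAt ℝ ∞ f q ∧ ∀ w, w ≠ 0 → 0 < quadForm (f q) w

/-- Near the point of the axis with height `h`, `f` is a smooth function of `ρ²` and `z` which on
the axis degenerates exactly in the direction `v`, to first order in `ρ²`. -/
def RodForm (v : Fin 2 → ℝ) (f : ℝ × ℝ → Fin 3 → ℝ) (h : ℝ) : Prop :=
  ∃ a b d : ℝ × ℝ → ℝ, ContDiffAt ℝ ∞ a (0, h) ∧ ContDiffAt ℝ ∞ b (0, h) ∧ ContDiffAt ℝ ∞ d (0, h) ∧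
    0 < a (0, h) ∧ 0 < d (0, h) ∧ f =ᶠ[𝓝 (0, h)] fun q =>
      (q.1 * a q) • sqVec v + (q.1 * b q) • symVec v (hat v) + d q • sqVec (hat v)

section Sum

variable {J : Type*} [Fintype J] {w : J → ℝ × ℝ → ℝ} {f : J → ℝ × ℝ → Fin 3 → ℝ}

theorem exists_pos_weight {w : J → ℝ} (h0 : ∀ j, 0 ≤ w j) (h1 : ∑ j, w j = 1) : ∃ j, 0 < w j := by
  by_contra! h
  have : ∑ j, w j = 0 := Finset.sum_eq_zero fun j _ => le_antisymm (h j) (h0 j)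
  rw [this] at h1
  exact zero_ne_one h1

/-- The positive definite matrices form a convex cone. Models whose weight vanishes near the point
need not be regular there. -/
theorem Regular.sum {q₀ : ℝ × ℝ} (hw : ∀ j, ContDiffAt ℝ ∞ (w j) q₀) (h0 : ∀ j, 0 ≤ w j q₀)
    (h1 : ∑ j, w j q₀ = 1) (hf : ∀ j, (∀ᶠ q in 𝓝 q₀, w j q = 0) ∨ Regular (f j) q₀) :
    Regular (fun q => ∑ j, w j q • f j q) q₀ := by
  refine ⟨ContDiffAt.sum fun j _ => ?_, fun v hv => ?_⟩
  · rcases hf j with h | h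
    · refine (contDiffAt_const (c := (0 : Fin 3 → ℝ))).congr_of_eventuallyEq ?_
      filter_upwards [h] with q hq
      simp [hq]
    · exact (hw j).smul h.1
  · rw [quadForm_sum]
    simp only [quadForm_smul]
    have key : ∀ j, 0 < w j q₀ → 0 < quadForm (f j q₀) v := fun j hj =>
      (hf j).elim (fun h => absurd h.self_of_nhds hj.ne') fun h => h.2 v hv
    obtain ⟨j, hj⟩ := exists_pos_weight h0 h1
    refine Finset.sum_pos' (fun i _ => ?_) ⟨j, Finset.mem_univ j, mul_pos hj (key j hj)⟩
    rcases (h0 i).eq_or_lt with h | h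
    · rw [← h, zero_mul]
    · exact (mul_pos h (key i h)).le

theorem sum_weight_pos {a w : J → ℝ} (h0 : ∀ j, 0 ≤ w j) (h1 : ∑ j, w j = 1) (ha : ∀ j, 0 < a j) :
    0 < ∑ j, w j * a j := by
  obtain ⟨j, hj⟩ := exists_pos_weight h0 h1
  exact Finset.sum_pos' (fun i _ => mul_nonneg (h0 i) (ha i).le) ⟨j, Finset.mem_univ j, mul_pos hj (ha j)⟩

/-- For a fixed rod structure the coefficients a, b, d enter F linearly and the conditions on them
are convex. This is what allows different models along one rod to be averaged. -/
theorem RodForm.sum {v : Fin 2 → ℝ} {h : ℝ} (hw : ∀ j, ContDiffAt ℝ ∞ (w j) (0, h))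
    (h0 : ∀ j, 0 ≤ w j (0, h)) (h1 : ∑ j, w j (0, h) = 1)
    (hf : ∀ j, (∀ᶠ q in 𝓝 (0, h), w j q = 0) ∨ RodForm v (f j) h) :
    RodForm v (fun q => ∑ j, w j q • f j q) h := by
  have hf' : ∀ j, ∃ a b d : ℝ × ℝ → ℝ, ContDiffAt ℝ ∞ a (0, h) ∧ ContDiffAt ℝ ∞ b (0, h) ∧
      ContDiffAt ℝ ∞ d (0, h) ∧ 0 < a (0, h) ∧ 0 < d (0, h) ∧ ∀ᶠ q in 𝓝 (0, h), w j q • f j q =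
        w j q • ((q.1 * a q) • sqVec v + (q.1 * b q) • symVec v (hat v) + d q • sqVec (hat v)) := by
    intro j
    rcases hf j with h | ⟨a, b, d, h1, h2, h3, h4, h5, h6⟩
    -- Where the weight vanishes identically the coefficients are arbitrary; the value 1 keeps them
    -- positive.
    · refine ⟨fun _ => 1, fun _ => 1, fun _ => 1, contDiffAt_const, contDiffAt_const, contDiffAt_const,
        one_pos, one_pos, ?_⟩
      filter_upwards [h] with q hq
      rw [hq, zero_smul, zero_smul]
    · refine ⟨a, b, d, h1, h2, h3, h4, h5, ?_⟩
      filter_upwards [h6] with q hq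
      rw [hq]
  choose a b d ca cb cd pa pd e using hf'
  refine ⟨fun q => ∑ j, w j q * a j q, fun q => ∑ j, w j q * b j q, fun q => ∑ j, w j q * d j q,
    ContDiffAt.sum fun j _ => (hw j).mul (ca j), ContDiffAt.sum fun j _ => (hw j).mul (cb j),
    ContDiffAt.sum fun j _ => (hw j).mul (cd j), sum_weight_pos h0 h1 pa, sum_weight_pos h0 h1 pd, ?_⟩
  filter_upwards [Filter.eventually_all.2 e] with q hq
  simp only [hq]
  ext i
  simp only [Finset.sum_apply, Pi.add_apply, Pi.smul_apply, smul_eq_mul, Finset.mul_sum,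
    Finset.sum_mul, ← Finset.sum_add_distrib]
  exact Finset.sum_congr rfl fun j _ => by ring

end Sum

theorem hat_dot_self (v : Fin 2 → ℝ) : hat v ⬝ᵥ hat v = v ⬝ᵥ v := by
  simp [hat, dotProduct, Fin.sum_univ_two]; ring

theorem dot_self_pos {v : Fin 2 → ℝ} (hv : v ≠ 0) : 0 < v ⬝ᵥ v := by
  have h2 : v 0 ≠ 0 ∨ v 1 ≠ 0 := by
    by_contra! h
    exact hv (by ext i; fin_cases i; exacts [h.1, h.2])
  simp only [dotProduct, Fin.sum_univ_two]
  rcases h2 with h | h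
  · nlinarith [mul_self_pos.2 h, mul_self_nonneg (v 1)]
  · nlinarith [mul_self_pos.2 h, mul_self_nonneg (v 0)]

/-- Expanding α in the orthogonal frame (v, v̂) changes the coefficient of v̂v̂ᵀ only by a multiple
of s. The corner models need this, since there α is not parallel to v. -/
theorem RodForm.of_frame {v α : Fin 2 → ℝ} (hv : v ≠ 0) (hα : α ⬝ᵥ v ≠ 0) {f : ℝ × ℝ → Fin 3 → ℝ}
    {h : ℝ} {g d : ℝ × ℝ → ℝ} (hg : ContDiffAt ℝ ∞ g (0, h)) (hd : ContDiffAt ℝ ∞ d (0, h))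
    (g0 : 0 < g (0, h)) (d0 : 0 < d (0, h))
    (hf : f =ᶠ[𝓝 (0, h)] fun q => (q.1 * g q) • sqVec α + d q • sqVec (hat v)) : RodForm v f h := by
  have hn := (dot_self_pos hv).ne'
  set x := (v ⬝ᵥ v)⁻¹ * (α ⬝ᵥ v) with hx
  set y := (v ⬝ᵥ v)⁻¹ * (α ⬝ᵥ hat v) with hy
  have hx0 : x ≠ 0 := mul_ne_zero (inv_ne_zero hn) hα
  have key : sqVec α = x ^ 2 • sqVec v + (x * y) • symVec v (hat v) + y ^ 2 • sqVec (hat v) := by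
    have e0 : α 0 = x * v 0 + y * hat v 0 := by
      simp only [hx, hy, dotProduct, Fin.sum_univ_two, hat, Matrix.cons_val_zero,
        Matrix.cons_val_one] at hn ⊢
      rw [← sq, ← sq] at hn ⊢
      field_simp
      ring
    have e1 : α 1 = x * v 1 + y * hat v 1 := by
      simp only [hx, hy, dotProduct, Fin.sum_univ_two, hat, Matrix.cons_val_zero,
        Matrix.cons_val_one] at hn ⊢
      rw [← sq, ← sq] at hn ⊢
      field_simp
      ring
    ext i
    fin_cases i <;> simp [sqVec, symVec, e0, e1] <;> ring
  refine ⟨fun q => g q * x ^ 2, fun q => g q * (x * y), fun q => d q + q.1 * g q * y ^ 2,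
    hg.mul contDiffAt_const, hg.mul contDiffAt_const,
    hd.add ((contDiffAt_fst.mul hg).mul contDiffAt_const), by positivity, by simpa using d0, ?_⟩
  filter_upwards [hf] with q hq
  rw [hq, key]
  ext i
  simp only [Pi.add_apply, Pi.smul_apply, smul_eq_mul]
  ring

theorem RodForm.contDiffAt {v : Fin 2 → ℝ} {f : ℝ × ℝ → Fin 3 → ℝ} {h : ℝ} (H : RodForm v f h) :
    ContDiffAt ℝ ∞ f (0, h) := by
  obtain ⟨a, b, d, h1, h2, h3, h4, h5, h6⟩ := H
  refine ContDiffAt.congr_of_eventuallyEq ?_ h6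
  exact (((contDiffAt_fst.mul h1).smul contDiffAt_const).add
    ((contDiffAt_fst.mul h2).smul contDiffAt_const)).add (h3.smul contDiffAt_const)

/-- The matrix with given triple applied to `w` vanishes. -/
def InKer (f : Fin 3 → ℝ) (w : Fin 2 → ℝ) : Prop := f 0 * w 0 + f 1 * w 1 = 0 ∧ f 1 * w 0 + f 2 * w 1 = 0

theorem inKer_smul_sqVec {v w : Fin 2 → ℝ} (hv : v ≠ 0) {r : ℝ} (hr : r ≠ 0) :
    InKer (r • sqVec v) w ↔ v ⬝ᵥ w = 0 := by
  have h2 : v 0 ≠ 0 ∨ v 1 ≠ 0 := by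
    by_contra! h
    exact hv (by ext i; fin_cases i; exacts [h.1, h.2])
  simp only [InKer, sqVec, Pi.smul_apply, smul_eq_mul, Matrix.cons_val_zero, Matrix.cons_val_one,
    Matrix.cons_val, dotProduct, Fin.sum_univ_two]
  constructor
  · rintro ⟨e0, e1⟩
    rcases h2 with h | h
    · have : r * v 0 * (v 0 * w 0 + v 1 * w 1) = 0 := by linear_combination e0
      exact (mul_eq_zero.1 this).resolve_left (mul_ne_zero hr h)
    · have : r * v 1 * (v 0 * w 0 + v 1 * w 1) = 0 := by linear_combination e1
      exact (mul_eq_zero.1 this).resolve_left (mul_ne_zero hr h)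
  · intro e
    constructor
    · linear_combination r * v 0 * e
    · linear_combination r * v 1 * e

theorem hat_dot_eq_zero_iff {v w : Fin 2 → ℝ} (hv : v ≠ 0) :
    hat v ⬝ᵥ w = 0 ↔ w ∈ Submodule.span ℝ {v} := by
  have hn := (dot_self_pos hv).ne'
  rw [Submodule.mem_span_singleton]
  simp only [dotProduct, Fin.sum_univ_two, hat, Matrix.cons_val_zero, Matrix.cons_val_one] at hn ⊢
  rw [← sq, ← sq] at hn
  constructor
  · intro h
    refine ⟨(v 0 ^ 2 + v 1 ^ 2)⁻¹ * (v 0 * w 0 + v 1 * w 1), ?_⟩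
    ext i
    fin_cases i <;> simp only [Pi.smul_apply, smul_eq_mul, Fin.zero_eta, Fin.mk_one] <;> field_simp
    · linear_combination v 1 * h
    · linear_combination -v 0 * h
  · rintro ⟨r, rfl⟩
    simp only [Pi.smul_apply, smul_eq_mul]
    ring

theorem hat_ne_zero {v : Fin 2 → ℝ} (hv : v ≠ 0) : hat v ≠ 0 := by
  intro h
  have := dot_self_pos hv
  rw [← hat_dot_self, h] at this
  simp at this

theorem RodForm.inKer_iff {v : Fin 2 → ℝ} (hv : v ≠ 0) {f : ℝ × ℝ → Fin 3 → ℝ} {h : ℝ}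
    (H : RodForm v f h) (w : Fin 2 → ℝ) : InKer (f (0, h)) w ↔ w ∈ Submodule.span ℝ {v} := by
  obtain ⟨a, b, d, h1, h2, h3, h4, h5, h6⟩ := H
  rw [h6.self_of_nhds]
  simp only [zero_mul, zero_smul, zero_add]
  rw [inKer_smul_sqVec (hat_ne_zero hv) h5.ne', hat_dot_eq_zero_iff hv]

theorem Regular.inKer_iff {f : ℝ × ℝ → Fin 3 → ℝ} {q : ℝ × ℝ} (H : Regular f q) (w : Fin 2 → ℝ) :
    InKer (f q) w ↔ w = 0 := by
  constructor
  · rintro ⟨e0, e1⟩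
    by_contra hw
    have := H.2 w hw
    have e : quadForm (f q) w = 0 := by
      unfold quadForm
      linear_combination w 0 * e0 + w 1 * e1
    exact this.ne' e
  · rintro rfl
    simp [InKer]

/-- The determinant of a symmetric matrix. -/
def detVec (f : Fin 3 → ℝ) : ℝ := f 0 * f 2 - f 1 ^ 2

/-- In the frame (v, v̂) the determinant is s |v|⁴ (a d - s b²), whose cofactor of s is continuous
and positive on the axis. -/
theorem RodForm.detVec_comparable {v : Fin 2 → ℝ} (hv : v ≠ 0) {f : ℝ × ℝ → Fin 3 → ℝ} {h : ℝ}
    (H : RodForm v f h) : ∃ m > 0, ∃ M > 0, ∀ᶠ q in 𝓝 (0, h), 0 ≤ q.1 →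
      m * q.1 ≤ detVec (f q) ∧ detVec (f q) ≤ M * q.1 := by
  obtain ⟨a, b, d, h1, h2, h3, h4, h5, h6⟩ := H
  have hn := dot_self_pos hv
  set D : ℝ × ℝ → ℝ := fun q => (v ⬝ᵥ v) ^ 2 * (a q * d q - q.1 * b q ^ 2) with hD
  have hc : ContinuousAt D (0, h) := by
    have := h1.continuousAt
    have := h2.continuousAt
    have := h3.continuousAt
    fun_prop
  have h0 : 0 < D (0, h) := by
    simp only [hD, zero_mul, sub_zero]
    positivity
  refine ⟨D (0, h) / 2, by positivity, 2 * D (0, h), by positivity, ?_⟩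
  filter_upwards [h6, hc.eventually (lt_mem_nhds (half_lt_self h0)),
    hc.eventually (gt_mem_nhds (show D (0, h) < 2 * D (0, h) by linarith))] with q e l1 l2 hq
  have : detVec (f q) = D q * q.1 := by
    rw [e]
    simp only [hD, detVec, sqVec, symVec, hat, Pi.add_apply, Pi.smul_apply, smul_eq_mul,
      Matrix.cons_val_zero, Matrix.cons_val_one, Matrix.cons_val, dotProduct, Fin.sum_univ_two]
    ring
  rw [this]
  exact ⟨mul_le_mul_of_nonneg_right l1.le hq, mul_le_mul_of_nonneg_right l2.le hq⟩

/-! ### Harmonic model maps near the separating points -/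

/-- The three functions of which the models near the point of the axis with height `c` are made:
`r ± (z - c)` and `1`. -/
def IsFactor (c : ℝ) (D : ℝ × ℝ → ℝ) : Prop := (∃ ε : ℝ, ε ^ 2 = 1 ∧ D = radAdd ε c) ∨ D = fun _ => 1

namespace IsFactor

variable {c : ℝ} {D : ℝ × ℝ → ℝ}

theorem pos (H : IsFactor c D) {q : ℝ × ℝ} (h : 0 < q.1) : 0 < D q := by
  rcases H with ⟨ε, hε, rfl⟩ | rfl
  · exact radAdd_pos hε h
  · exact one_pos

theorem contDiffAt (H : IsFactor c D) {q : ℝ × ℝ} (h : 0 < q.1 + (q.2 - c) ^ 2) :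
    ContDiffAt ℝ ∞ D q := by
  rcases H with ⟨ε, hε, rfl⟩ | rfl
  · exact contDiffAt_radAdd h
  · exact contDiffAt_const

theorem exists_jet (H : IsFactor c D) {q : ℝ × ℝ} (h : 0 < q.1 + (q.2 - c) ^ 2) :
    ∃ a b a' b', CylJet D q a b a' b' ∧ LogHarmonic q.1 (D q) a b a' b' := by
  rcases H with ⟨ε, hε, rfl⟩ | rfl
  · exact ⟨_, _, _, _, cylJet_radAdd ε h, logHarmonic_radAdd hε h⟩
  · exact ⟨_, _, _, _, CylJet.const 1 q, logHarmonic_one q.1⟩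

theorem exists_smooth (H : IsFactor c D) : ∃ g : ℝ × ℝ → ℝ, ContDiff ℝ ∞ g ∧
    ∀ q, D q = g (rad c q + (q.2 - c), rad c q - (q.2 - c)) := by
  rcases H with ⟨ε, hε, rfl⟩ | rfl
  · refine ⟨fun t => (1 + ε) / 2 * t.1 + (1 - ε) / 2 * t.2, by fun_prop, fun q => ?_⟩
    unfold radAdd
    ring
  · exact ⟨fun _ => 1, contDiff_const, fun _ => rfl⟩

end IsFactor

/-- The matrix `D₁ α αᵀ + D₂ β βᵀ`. -/
def frameMat (α β : Fin 2 → ℝ) (D₁ D₂ : ℝ × ℝ → ℝ) (q : ℝ × ℝ) : Fin 3 → ℝ :=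
  D₁ q • sqVec α + D₂ q • sqVec β

/-- The potentials in the frame `(α, β)`. -/
def potAct (α β : Fin 2 → ℝ) (y : Fin 5 → ℝ) : Fin 5 → ℝ :=
  ![(α 0 * β 1 - α 1 * β 0) * (y 0 * α 0 + y 1 * β 0),
    (α 0 * β 1 - α 1 * β 0) * (y 0 * α 1 + y 1 * β 1),
    (α 0 * β 1 - α 1 * β 0) * y 2, y 3 * α 0 + y 4 * β 0, y 3 * α 1 + y 4 * β 1]

theorem exists_potAct {α β : Fin 2 → ℝ} (hd : α 0 * β 1 - α 1 * β 0 ≠ 0) (y : Fin 5 → ℝ) :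
    ∃ y', potAct α β y' = y := by
  set D := α 0 * β 1 - α 1 * β 0 with hD
  refine ⟨![D⁻¹ ^ 2 * (β 1 * y 0 - β 0 * y 1), D⁻¹ ^ 2 * (α 0 * y 1 - α 1 * y 0), D⁻¹ * y 2,
    D⁻¹ * (β 1 * y 3 - β 0 * y 4), D⁻¹ * (α 0 * y 4 - α 1 * y 3)], ?_⟩
  ext i
  fin_cases i <;> simp only [potAct, ← hD, Matrix.cons_val_zero, Matrix.cons_val_one, Matrix.cons_val,
    Fin.zero_eta, Fin.mk_one, Fin.reduceFinMk] <;> field_simp <;> rw [hD] <;> ring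

theorem potAct_add (α β : Fin 2 → ℝ) (y w : Fin 5 → ℝ) :
    potAct α β (y + w) = potAct α β y + potAct α β w := by
  ext i; fin_cases i <;> simp [potAct] <;> ring

theorem potAct_smul (α β : Fin 2 → ℝ) (r : ℝ) (y : Fin 5 → ℝ) :
    potAct α β (r • y) = r • potAct α β y := by
  ext i; fin_cases i <;> simp [potAct] <;> ring

theorem join_frameMat (α β : Fin 2 → ℝ) (D₁ D₂ : ℝ × ℝ → ℝ) (q : ℝ × ℝ) (y : Fin 5 → ℝ) :
    join (frameMat α β D₁ D₂ q) (potAct α β y) =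
      act α β ![D₁ q, 0, D₂ q, y 0, y 1, y 2, y 3, y 4] := by
  ext i; fin_cases i <;> simp [join, frameMat, potAct, act, sqVec]

theorem detVec_frameMat (α β : Fin 2 → ℝ) (D₁ D₂ : ℝ × ℝ → ℝ) (q : ℝ × ℝ) :
    detVec (frameMat α β D₁ D₂ q) = (α 0 * β 1 - α 1 * β 0) ^ 2 * (D₁ q * D₂ q) := by
  simp [detVec, frameMat, sqVec]; ring

theorem quadForm_frameMat (α β : Fin 2 → ℝ) (D₁ D₂ : ℝ × ℝ → ℝ) (q : ℝ × ℝ) (w : Fin 2 → ℝ) :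
    quadForm (frameMat α β D₁ D₂ q) w = D₁ q * (α ⬝ᵥ w) ^ 2 + D₂ q * (β ⬝ᵥ w) ^ 2 := by
  rw [frameMat, quadForm_add, quadForm_smul, quadForm_smul, quadForm_sqVec, quadForm_sqVec]

theorem frameMat_pos {α β : Fin 2 → ℝ} (hd : α 0 * β 1 - α 1 * β 0 ≠ 0) {D₁ D₂ : ℝ × ℝ → ℝ}
    {q : ℝ × ℝ} (h₁ : 0 < D₁ q) (h₂ : 0 < D₂ q) {w : Fin 2 → ℝ} (hw : w ≠ 0) :
    0 < quadForm (frameMat α β D₁ D₂ q) w := by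
  rw [quadForm_frameMat]
  have : α ⬝ᵥ w ≠ 0 ∨ β ⬝ᵥ w ≠ 0 := by
    by_contra! h
    simp only [dotProduct, Fin.sum_univ_two] at h
    obtain ⟨e0, e1⟩ := h
    refine hw ?_
    have k0 : (α 0 * β 1 - α 1 * β 0) * w 0 = 0 := by linear_combination β 1 * e0 - α 1 * e1
    have k1 : (α 0 * β 1 - α 1 * β 0) * w 1 = 0 := by linear_combination α 0 * e1 - β 0 * e0
    ext i
    fin_cases i
    · exact (mul_eq_zero.1 k0).resolve_left hd
    · exact (mul_eq_zero.1 k1).resolve_left hd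
  rcases this with h | h
  · exact add_pos_of_pos_of_nonneg (by positivity) (by positivity)
  · exact add_pos_of_nonneg_of_pos (by positivity) (by positivity)

/-- Testing on β̂ and α̂ isolates D₁ and D₂. This yields positivity also at points of horizon rods,
where s = 0 and `IsFactor.pos` does not apply. -/
theorem pos_of_frameMat {α β : Fin 2 → ℝ} (hd : α 0 * β 1 - α 1 * β 0 ≠ 0) {D₁ D₂ : ℝ × ℝ → ℝ}
    {q : ℝ × ℝ} (h : ∀ w, w ≠ 0 → 0 < quadForm (frameMat α β D₁ D₂ q) w) : 0 < D₁ q ∧ 0 < D₂ q := by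
  have hα : hat α ≠ 0 := hat_ne_zero (by rintro rfl; simp at hd)
  have hβ : hat β ≠ 0 := hat_ne_zero (by rintro rfl; simp at hd)
  have h1 := h _ hα
  have h2 := h _ hβ
  rw [quadForm_frameMat] at h1 h2
  simp only [dotProduct, Fin.sum_univ_two, hat, Matrix.cons_val_zero, Matrix.cons_val_one] at h1 h2
  constructor
  · have : 0 < D₁ q * (α 0 * β 1 - α 1 * β 0) ^ 2 := by
      refine h2.trans_eq ?_; ring
    exact pos_of_mul_pos_left this (sq_nonneg _)
  · have : 0 < D₂ q * (α 0 * β 1 - α 1 * β 0) ^ 2 := by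
      refine h1.trans_eq ?_; ring
    exact pos_of_mul_pos_left this (sq_nonneg _)

/-- Regular if `v = 0` (a horizon rod), in rod form otherwise. -/
def AxisForm (v : Fin 2 → ℝ) (f : ℝ × ℝ → Fin 3 → ℝ) (h : ℝ) : Prop :=
  (v = 0 → Regular f (0, h)) ∧ (v ≠ 0 → RodForm v f h)

/-- The properties of a model map near the point of height `c` separating two rods, with rod
structures `u` above and `d` below. -/
structure IsEndModel (u d : Fin 2 → ℝ) (c : ℝ) (f : ℝ × ℝ → Fin 3 → ℝ) : Prop where
  regular : ∀ q : ℝ × ℝ, 0 < q.1 → Regular f q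
  above : ∀ h, c < h → AxisForm u f h
  below : ∀ h, h < c → AxisForm d f h
  ker : ∀ w, InKer (f (0, c)) w ↔ w ∈ Submodule.span ℝ {u, d}
  smooth : ∃ g : ℝ × ℝ → Fin 3 → ℝ, ContDiff ℝ ∞ g ∧
    ∀ q, f q = g (rad c q + (q.2 - c), rad c q - (q.2 - c))
  det : u ≠ 0 → d ≠ 0 → ∃ m > 0, ∀ q : ℝ × ℝ, 0 ≤ q.1 → detVec (f q) = m * q.1
  tension : u ≠ 0 ∨ d ≠ 0 → ∀ (y : Fin 5 → ℝ) (X : ℝ × ℝ → Fin 8 → ℝ) (p : E3),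
    (X =ᶠ[𝓝 (cyl p)] fun q => join (f q) y) → 0 < rhoSq p + (p 2 - c) ^ 2 →
    (∀ w, w ≠ 0 → 0 < quadForm (f (cyl p)) w) → tensionNorm (fun x => X (cyl x)) p = 0
  flat : u = 0 → d = 0 → Regular f (0, c)

section Frame

variable {α β : Fin 2 → ℝ} {D₁ D₂ : ℝ × ℝ → ℝ} {c : ℝ}

theorem regular_frameMat (hd : α 0 * β 1 - α 1 * β 0 ≠ 0) {q : ℝ × ℝ} (c₁ : ContDiffAt ℝ ∞ D₁ q)
    (c₂ : ContDiffAt ℝ ∞ D₂ q) (h₁ : 0 < D₁ q) (h₂ : 0 < D₂ q) : Regular (frameMat α β D₁ D₂) q :=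
  ⟨(c₁.smul contDiffAt_const).add (c₂.smul contDiffAt_const), fun _ hw => frameMat_pos hd h₁ h₂ hw⟩

/-- In the frame (α, β) the map is diagonal with log-harmonic entries and constant potentials, and
the change of frame is an isometry. -/
theorem tension_frameMat (hd : α 0 * β 1 - α 1 * β 0 ≠ 0) (H₁ : IsFactor c D₁) (H₂ : IsFactor c D₂)
    (y : Fin 5 → ℝ) (X : ℝ × ℝ → Fin 8 → ℝ) (p : E3)
    (hX : X =ᶠ[𝓝 (cyl p)] fun q => join (frameMat α β D₁ D₂ q) y) (hp : 0 < rhoSq p + (p 2 - c) ^ 2)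
    (ht : ∀ w, w ≠ 0 → 0 < quadForm (frameMat α β D₁ D₂ (cyl p)) w) :
    tensionNorm (fun x => X (cyl x)) p = 0 := by
  obtain ⟨y', rfl⟩ := exists_potAct hd y
  simp only [join_frameMat] at hX
  obtain ⟨p₁, p₂⟩ := pos_of_frameMat hd ht
  obtain ⟨a₁, b₁, c₁, d₁, j₁, l₁⟩ := H₁.exists_jet (q := cyl p) hp
  obtain ⟨a₂, b₂, c₂, d₂, j₂, l₂⟩ := H₂.exists_jet (q := cyl p) hp
  rw [tensionNorm_of_act hd hX (xs := ![a₁, 0, a₂, 0, 0, 0, 0, 0]) (xz := ![b₁, 0, b₂, 0, 0, 0, 0, 0])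
    (xss := ![c₁, 0, c₂, 0, 0, 0, 0, 0]) (xzz := ![d₁, 0, d₂, 0, 0, 0, 0, 0])]
  · have : rhoSq p = (cyl p).1 := rfl
    rw [cylNormSq, this, cylTension_of_logHarmonic p₁.ne' p₂.ne' l₁ l₂ y']
    have := metric_smul_left ![D₁ (cyl p), 0, D₂ (cyl p), y' 0, y' 1, y' 2, y' 3, y' 4] 0 0 0
    rw [zero_smul] at this
    rw [this, zero_mul, Real.sqrt_zero]
  · intro A
    fin_cases A
    · exact j₁
    · exact CylJet.const 0 _
    · exact j₂
    all_goals exact CylJet.const _ _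
  · rw [target_iff_det]
    refine ⟨p₁, ?_⟩
    simpa [detF] using mul_pos p₁ p₂

theorem isEndModel_frameMat {u d : Fin 2 → ℝ} (hd : α 0 * β 1 - α 1 * β 0 ≠ 0) (H₁ : IsFactor c D₁)
    (H₂ : IsFactor c D₂) (above : ∀ h, c < h → AxisForm u (frameMat α β D₁ D₂) h)
    (below : ∀ h, h < c → AxisForm d (frameMat α β D₁ D₂) h)
    (ker : ∀ w, InKer (frameMat α β D₁ D₂ (0, c)) w ↔ w ∈ Submodule.span ℝ {u, d})
    (det : u ≠ 0 → d ≠ 0 → ∀ q : ℝ × ℝ, 0 ≤ q.1 → D₁ q * D₂ q = q.1)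
    (flat : u = 0 → d = 0 → Regular (frameMat α β D₁ D₂) (0, c)) :
    IsEndModel u d c (frameMat α β D₁ D₂) where
  regular q hq := by
    have hq' : 0 < q.1 + (q.2 - c) ^ 2 := by positivity
    exact regular_frameMat hd (H₁.contDiffAt hq') (H₂.contDiffAt hq') (H₁.pos hq) (H₂.pos hq)
  above := above
  below := below
  ker := ker
  smooth := by
    obtain ⟨g₁, s₁, e₁⟩ := H₁.exists_smooth
    obtain ⟨g₂, s₂, e₂⟩ := H₂.exists_smooth
    refine ⟨fun t => g₁ t • sqVec α + g₂ t • sqVec β,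
      (s₁.smul contDiff_const).add (s₂.smul contDiff_const), fun q => ?_⟩
    rw [frameMat, e₁, e₂]
  det hu hd' := ⟨(α 0 * β 1 - α 1 * β 0) ^ 2, by positivity, fun q hq => by
    rw [detVec_frameMat, det hu hd' q hq]⟩
  tension _ := tension_frameMat hd H₁ H₂
  flat := flat

end Frame

theorem radAdd_axis_pos {ε c h : ℝ} (hh : 0 < ε * (h - c)) : 0 < radAdd ε c (0, h) := by
  unfold radAdd rad
  exact add_pos_of_nonneg_of_pos (Real.sqrt_nonneg _) hh

theorem radAdd_self (ε c : ℝ) : radAdd ε c (0, c) = 0 := by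
  simp [radAdd, rad]

/-- On the side of the axis on which it vanishes, `r ± (z - c)` is `ρ²` times a smooth function. -/
theorem radAdd_eventually_eq {ε c h : ℝ} (hε : ε ^ 2 = 1) (hh : ε * (h - c) < 0) :
    0 < (radAdd (-ε) c (0, h))⁻¹ ∧ ContDiffAt ℝ ∞ (fun q => (radAdd (-ε) c q)⁻¹) (0, h) ∧
      ∀ᶠ q in 𝓝 ((0 : ℝ), h), radAdd ε c q = q.1 * (radAdd (-ε) c q)⁻¹ := by
  have hne : h ≠ c := by rintro rfl; simp at hh
  have h2 : 0 < (h - c) ^ 2 := by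
    have : h - c ≠ 0 := sub_ne_zero.2 hne
    positivity
  have hpos : 0 < radAdd (-ε) c (0, h) := radAdd_axis_pos (by linarith)
  have hq : 0 < (0, h).1 + ((0, h).2 - c) ^ 2 := by simpa using h2
  have hsm : ContDiffAt ℝ ∞ (radAdd (-ε) c) (0, h) := contDiffAt_radAdd hq
  refine ⟨inv_pos.2 hpos, hsm.inv hpos.ne', ?_⟩
  have hopen : ContinuousAt (fun q : ℝ × ℝ => q.1 + (q.2 - c) ^ 2) (0, h) := by fun_prop
  filter_upwards [hsm.continuousAt.eventually (lt_mem_nhds hpos), hopen.eventually (lt_mem_nhds hq)]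
    with q h1 h3
  rw [eq_mul_inv_iff_mul_eq₀ h1.ne']
  unfold radAdd
  have := rad_sq h3.le
  linear_combination this - (q.2 - c) ^ 2 * hε

theorem axisForm_of_ne {v : Fin 2 → ℝ} {f : ℝ × ℝ → Fin 3 → ℝ} {h : ℝ} (hv : v ≠ 0)
    (H : RodForm v f h) : AxisForm v f h :=
  ⟨fun e => absurd e hv, fun _ => H⟩

theorem axisForm_zero {f : ℝ × ℝ → Fin 3 → ℝ} {h : ℝ} (H : Regular f (0, h)) : AxisForm 0 f h :=
  ⟨fun _ => H, fun e => absurd rfl e⟩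

theorem frameMat_comm (α β : Fin 2 → ℝ) (D₁ D₂ : ℝ × ℝ → ℝ) :
    frameMat α β D₁ D₂ = frameMat β α D₂ D₁ := by
  funext q; exact add_comm _ _

/-- The rod form of `D₁ α αᵀ + D₂ v̂ v̂ᵀ` on the side on which `D₁ = r ± (z - c)` vanishes. -/
theorem rodForm_frameMat {v α : Fin 2 → ℝ} (hv : v ≠ 0) (hα : α ⬝ᵥ v ≠ 0) {ε c h : ℝ} (hε : ε ^ 2 = 1)
    (hh : ε * (h - c) < 0) {D : ℝ × ℝ → ℝ} (hD : ContDiffAt ℝ ∞ D (0, h)) (hD0 : 0 < D (0, h)) :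
    RodForm v (frameMat α (hat v) (radAdd ε c) D) h := by
  obtain ⟨h1, h2, h3⟩ := radAdd_eventually_eq hε hh
  refine RodForm.of_frame hv hα h2 hD h1 hD0 ?_
  filter_upwards [h3] with q hq
  rw [frameMat, hq]

theorem det_hat (v : Fin 2 → ℝ) : v 0 * hat v 1 - v 1 * hat v 0 = v ⬝ᵥ v := by
  simp [hat, dotProduct, Fin.sum_univ_two]

/-- A pole, with the axis rod on the side on which `r + ε (z - c)` vanishes. -/
theorem regular_pole {v : Fin 2 → ℝ} (hv : v ≠ 0) {ε c h : ℝ} (hh : 0 < ε * (h - c)) :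
    Regular (frameMat v (hat v) (radAdd ε c) fun _ => 1) (0, h) := by
  have hne : h - c ≠ 0 := by rintro e; simp [e] at hh
  refine regular_frameMat (by rw [det_hat]; exact (dot_self_pos hv).ne') (contDiffAt_radAdd ?_)
    contDiffAt_const (radAdd_axis_pos hh) one_pos
  simp only [zero_add]
  positivity

theorem ker_pole {v : Fin 2 → ℝ} (hv : v ≠ 0) (ε c : ℝ) (w : Fin 2 → ℝ) :
    InKer (frameMat v (hat v) (radAdd ε c) (fun _ => 1) (0, c)) w ↔ w ∈ Submodule.span ℝ {v} := by
  rw [frameMat, radAdd_self, zero_smul, zero_add, inKer_smul_sqVec (hat_ne_zero hv) one_ne_zero,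
    hat_dot_eq_zero_iff hv]

/-- The model near a corner. -/
theorem isEndModel_corner {u d : Fin 2 → ℝ} (hx : u 0 * d 1 - u 1 * d 0 ≠ 0) (c : ℝ) :
    IsEndModel u d c (frameMat (hat d) (hat u) (radAdd (-1) c) (radAdd 1 c)) := by
  have e1 : (1 : ℝ) ^ 2 = 1 := by norm_num
  have e2 : (-1 : ℝ) ^ 2 = 1 := by norm_num
  have sm : ∀ {ε h : ℝ}, h ≠ c → ContDiffAt ℝ ∞ (radAdd ε c) (0, h) := fun {ε h} hh => by
    have : h - c ≠ 0 := sub_ne_zero.2 hh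
    refine contDiffAt_radAdd ?_
    simp only [zero_add]
    positivity
  have hu : u ≠ 0 := by rintro rfl; simp at hx
  have hd : d ≠ 0 := by rintro rfl; simp at hx
  have hdet : hat d 0 * hat u 1 - hat d 1 * hat u 0 ≠ 0 := by
    intro h0
    apply hx
    simp only [hat, Matrix.cons_val_zero, Matrix.cons_val_one] at h0
    linear_combination -h0
  refine isEndModel_frameMat (c := c) (α := hat d) (β := hat u) (D₁ := radAdd (-1) c)
    (D₂ := radAdd 1 c) hdet (Or.inl ⟨-1, e2, rfl⟩) (Or.inl ⟨1, e1, rfl⟩)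
    -- Above c the factor r - (z - c) of d̂d̂ᵀ vanishes on the axis, leaving ûûᵀ, whose kernel is
    -- spanned by u. Below c the roles are exchanged.
    (fun h hh => axisForm_of_ne hu (rodForm_frameMat hu ?_ e2 (by linarith) (sm hh.ne')
      (radAdd_axis_pos (by linarith))))
    (fun h hh => axisForm_of_ne hd ?_) (fun w => ?_)
    (fun _ _ q hq => ?_) fun e => absurd e hu
  · intro h0
    apply hx
    simp only [hat, dotProduct, Fin.sum_univ_two, Matrix.cons_val_zero, Matrix.cons_val_one] at h0
    linear_combination -h0
  · rw [frameMat_comm]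
    refine rodForm_frameMat hd ?_ e1 (by linarith) (sm hh.ne) (radAdd_axis_pos (by linarith))
    intro h0
    apply hx
    simp only [hat, dotProduct, Fin.sum_univ_two, Matrix.cons_val_zero, Matrix.cons_val_one] at h0
    linear_combination h0
  · have h0 : frameMat (hat d) (hat u) (radAdd (-1) c) (radAdd 1 c) (0, c) = 0 := by
      rw [frameMat, radAdd_self, radAdd_self, zero_smul, zero_smul, add_zero]
    rw [h0]
    refine ⟨fun _ => ?_, fun _ => by simp [InKer]⟩
    rw [Submodule.mem_span_pair]
    refine ⟨(u 0 * d 1 - u 1 * d 0)⁻¹ * (w 0 * d 1 - w 1 * d 0),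
      (u 0 * d 1 - u 1 * d 0)⁻¹ * (u 0 * w 1 - u 1 * w 0), ?_⟩
    ext i
    fin_cases i <;> simp only [Pi.add_apply, Pi.smul_apply, smul_eq_mul, Fin.zero_eta, Fin.mk_one] <;>
      field_simp <;> ring
  · rw [mul_comm]
    exact radAdd_mul (by positivity)

/-- There are four cases: the identity matrix between two horizon rods, vvᵀ times r ± (z - c) plus
v̂v̂ᵀ at the two kinds of pole, with the sign that vanishes on the axis rod, and the corner model.
-/
theorem exists_isEndModel {u d : Fin 2 → ℝ} (hud : u ≠ 0 → d ≠ 0 → u 0 * d 1 - u 1 * d 0 ≠ 0) (c : ℝ) :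
    ∃ f, IsEndModel u d c f := by
  have e1 : (1 : ℝ) ^ 2 = 1 := by norm_num
  have e2 : (-1 : ℝ) ^ 2 = 1 := by norm_num
  by_cases hu : u = 0
  · subst hu
    by_cases hd : d = 0
    · subst hd
      have hdet : (![1, 0] : Fin 2 → ℝ) 0 * (![0, 1] : Fin 2 → ℝ) 1
          - (![1, 0] : Fin 2 → ℝ) 1 * (![0, 1] : Fin 2 → ℝ) 0 ≠ 0 := by simp
      have hreg : ∀ q, Regular (frameMat ![1, 0] ![0, 1] (fun _ => 1) fun _ => 1) q := fun q =>
        regular_frameMat hdet contDiffAt_const contDiffAt_const one_pos one_pos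
      refine ⟨_, isEndModel_frameMat (c := c) hdet (Or.inr rfl) (Or.inr rfl)
        (fun h _ => axisForm_zero (hreg _)) (fun h _ => axisForm_zero (hreg _)) (fun w => ?_)
        (fun e => absurd rfl e) fun _ _ => hreg _⟩
      rw [(hreg (0, c)).inKer_iff]
      simp
    · refine ⟨_, isEndModel_frameMat (c := c) (α := d) (β := hat d) (D₁ := radAdd 1 c) (D₂ := fun _ => 1)
        (by rw [det_hat]; exact (dot_self_pos hd).ne') (Or.inl ⟨1, e1, rfl⟩) (Or.inr rfl)
        (fun h hh => axisForm_zero (regular_pole hd (by linarith)))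
        (fun h hh => axisForm_of_ne hd (rodForm_frameMat hd (dot_self_pos hd).ne' e1 (by linarith)
          contDiffAt_const one_pos)) (fun w => ?_) (fun e => absurd rfl e) fun _ e => absurd e hd⟩
      rw [ker_pole hd, Submodule.span_insert_zero]
  · by_cases hd : d = 0
    · subst hd
      refine ⟨_, isEndModel_frameMat (c := c) (α := u) (β := hat u) (D₁ := radAdd (-1) c) (D₂ := fun _ => 1)
        (by rw [det_hat]; exact (dot_self_pos hu).ne') (Or.inl ⟨-1, e2, rfl⟩) (Or.inr rfl)
        (fun h hh => axisForm_of_ne hu (rodForm_frameMat hu (dot_self_pos hu).ne' e2 (by linarith)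
          contDiffAt_const one_pos))
        (fun h hh => axisForm_zero (regular_pole hu (by linarith))) (fun w => ?_)
        (fun _ e => absurd rfl e) fun e => absurd e hu⟩
      rw [ker_pole hu, Set.pair_comm, Submodule.span_insert_zero]
    · exact ⟨_, isEndModel_corner (hud hu hd) c⟩

/-! ### Potentials on the axis -/

/-- The values of `(ζ, χ, ψ)` on a rod with rod structure `v`, as a function of `ψ = p`. -/
def profile (v A : Fin 2 → ℝ) (B : ℝ) (p : Fin 2 → ℝ) : Fin 5 → ℝ :=
  ![A 0 + zetaProfile v p 0, A 1 + zetaProfile v p 1, B + chiProfile v p, p 0, p 1]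

theorem contDiff_profile (v A : Fin 2 → ℝ) (B : ℝ) {p : ℝ → Fin 2 → ℝ} (hp : ContDiff ℝ ∞ p) :
    ContDiff ℝ ∞ fun h => profile v A B (p h) := by
  have h0 : ContDiff ℝ ∞ fun h => p h 0 := contDiff_pi.1 hp 0
  have h1 : ContDiff ℝ ∞ fun h => p h 1 := contDiff_pi.1 hp 1
  refine contDiff_pi.2 fun i => ?_
  fin_cases i <;> simp only [profile, zetaProfile, chiProfile, dotProduct, Fin.sum_univ_two,
    Matrix.cons_val_zero, Matrix.cons_val_one, Matrix.cons_val, Fin.zero_eta, Fin.mk_one,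
    Fin.reduceFinMk, Pi.add_apply, Pi.smul_apply, smul_eq_mul, div_eq_mul_inv] <;> fun_prop

/-- On a rod the potentials are, in the frame `(v, v̂)`, those of the rod models. -/
theorem exists_profile_eq {v : Fin 2 → ℝ} (hv : v ≠ 0) (A : Fin 2 → ℝ) (B c : ℝ) :
    ∃ y₀ y₁ y₂ c' : ℝ, ∀ p, v ⬝ᵥ p = c → profile v A B p = potAct v (hat v)
      ![y₀ + 2 / 3 * (1 / √3) * c' ^ 2 * ((v ⬝ᵥ v)⁻¹ * (p ⬝ᵥ hat v)),
        y₁ + 1 / 3 * (1 / √3) * c' * ((v ⬝ᵥ v)⁻¹ * (p ⬝ᵥ hat v)) ^ 2,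
        y₂ - 1 / √3 * c' * ((v ⬝ᵥ v)⁻¹ * (p ⬝ᵥ hat v)), c', (v ⬝ᵥ v)⁻¹ * (p ⬝ᵥ hat v)] := by
  have hn := (dot_self_pos hv).ne'
  -- One factor |v|⁻² comes from expanding in (v, v̂). The weights of ζ and χ under `potAct`
  -- contribute the determinant |v|² of this frame, hence a further inverse.
  refine ⟨(v ⬝ᵥ v)⁻¹ ^ 2 * (A ⬝ᵥ v), (v ⬝ᵥ v)⁻¹ ^ 2 * (A ⬝ᵥ hat v), (v ⬝ᵥ v)⁻¹ * B,
    (v ⬝ᵥ v)⁻¹ * c, fun p hp => ?_⟩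
  have h3 : (√3 : ℝ) ≠ 0 := by positivity
  rw [dotProduct_comm] at hp
  subst hp
  set n := v ⬝ᵥ v with hndef
  have hn2 : v 0 * hat v 1 - v 1 * hat v 0 = n := det_hat v
  have hd : ∀ x : Fin 2 → ℝ, n * x 0 = (x ⬝ᵥ v) * v 0 + (x ⬝ᵥ hat v) * hat v 0 ∧
      n * x 1 = (x ⬝ᵥ v) * v 1 + (x ⬝ᵥ hat v) * hat v 1 := fun x => by
    simp only [hndef, hat, dotProduct, Fin.sum_univ_two, Matrix.cons_val_zero, Matrix.cons_val_one]
    constructor <;> ring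
  obtain ⟨a0, a1⟩ := hd A
  obtain ⟨p0, p1⟩ := hd p
  set x := A ⬝ᵥ v
  set y := A ⬝ᵥ hat v
  set s := p ⬝ᵥ v with hs
  set t := p ⬝ᵥ hat v with ht
  have a0' : A 0 = n⁻¹ * (x * v 0 + y * hat v 0) := by rw [← a0]; field_simp
  have a1' : A 1 = n⁻¹ * (x * v 1 + y * hat v 1) := by rw [← a1]; field_simp
  have p0' : p 0 = n⁻¹ * (s * v 0 + t * hat v 0) := by rw [← p0]; field_simp
  have p1' : p 1 = n⁻¹ * (s * v 1 + t * hat v 1) := by rw [← p1]; field_simp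
  ext i
  fin_cases i <;> simp only [profile, potAct, zetaProfile, chiProfile, hn2, ← hs, ← ht, ← hndef,
    Matrix.cons_val_zero, Matrix.cons_val_one, Matrix.cons_val, Fin.zero_eta, Fin.mk_one,
    Fin.reduceFinMk, Pi.add_apply, Pi.smul_apply, smul_eq_mul, a0', a1', p0', p1'] <;> field_simp <;> ring

/-- Both branches equal the same constant near c, so the junction is smooth. This is why ψ is kept
constant near the separating points. -/
theorem contDiff_ite_of_eventuallyEq {Y₁ Y₂ : ℝ → Fin 5 → ℝ} {c : ℝ} {y : Fin 5 → ℝ}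
    (h₁ : ContDiff ℝ ∞ Y₁) (h₂ : ContDiff ℝ ∞ Y₂) (e₁ : ∀ᶠ h in 𝓝 c, Y₁ h = y)
    (e₂ : ∀ᶠ h in 𝓝 c, Y₂ h = y) : ContDiff ℝ ∞ (fun h => if c ≤ h then Y₁ h else Y₂ h) ∧
      ∀ᶠ h in 𝓝 c, (if c ≤ h then Y₁ h else Y₂ h) = y := by
  have e : ∀ᶠ h in 𝓝 c, (if c ≤ h then Y₁ h else Y₂ h) = y := by
    filter_upwards [e₁, e₂] with h k₁ k₂
    split_ifs
    exacts [k₁, k₂]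
  refine ⟨contDiff_iff_contDiffAt.2 fun h => ?_, e⟩
  rcases lt_trichotomy h c with hh | rfl | hh
  · refine h₂.contDiffAt.congr_of_eventuallyEq ?_
    filter_upwards [gt_mem_nhds hh] with h' hh'
    rw [if_neg (not_le.2 hh')]
  · exact contDiffAt_const.congr_of_eventuallyEq e
  · refine h₁.contDiffAt.congr_of_eventuallyEq ?_
    filter_upwards [lt_mem_nhds hh] with h' hh'
    rw [if_pos hh'.le]

/-- Solving one or two equations for `ψ`. -/
theorem exists_dot_eq {u d : Fin 2 → ℝ} (hud : u ≠ 0 → d ≠ 0 → u 0 * d 1 - u 1 * d 0 ≠ 0) (r s : ℝ) :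
    ∃ p : Fin 2 → ℝ, (u ≠ 0 → u ⬝ᵥ p = r) ∧ (d ≠ 0 → d ⬝ᵥ p = s) := by
  have one : ∀ {v : Fin 2 → ℝ}, v ≠ 0 → ∀ r : ℝ, v ⬝ᵥ ((v ⬝ᵥ v)⁻¹ * r) • v = r := fun hv r => by
    have := (dot_self_pos hv).ne'
    rw [dotProduct_smul, smul_eq_mul]
    field_simp
  by_cases hu : u = 0
  · by_cases hd : d = 0
    · exact ⟨0, fun e => absurd hu e, fun e => absurd hd e⟩
    · exact ⟨_, fun e => absurd hu e, fun _ => one hd s⟩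
  · by_cases hd : d = 0
    · exact ⟨_, fun _ => one hu r, fun e => absurd hd e⟩
    · have hx := hud hu hd
      set e := (u 0 * d 1 - u 1 * d 0)⁻¹
      have he : e * (u 0 * d 1 - u 1 * d 0) = 1 := inv_mul_cancel₀ hx
      refine ⟨![e * (r * d 1 - s * u 1), e * (u 0 * s - d 0 * r)], fun _ => ?_, fun _ => ?_⟩
      all_goals simp only [dotProduct, Fin.sum_univ_two, Matrix.cons_val_zero, Matrix.cons_val_one]
      · linear_combination r * he
      · linear_combination s * he

namespace RodData

variable {L : ℕ} {R : RodData L}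

theorem vec_ne_zero_iff {l : Fin (L + 1)} : R.vec l ≠ 0 ↔ R.IsAxis l := by
  rw [IsAxis, not_iff_not]
  constructor
  · intro h
    ext i
    have := congrFun h i
    simpa [vec] using this
  · intro h
    ext i
    simp [vec, h]

theorem IsRodDataSet.det_ne_zero (hR : R.IsRodDataSet) (k : Fin L) (hu : R.vec k.castSucc ≠ 0)
    (hd : R.vec k.succ ≠ 0) :
    R.vec k.castSucc 0 * R.vec k.succ 1 - R.vec k.castSucc 1 * R.vec k.succ 0 ≠ 0 := by
  have := hR.corner_indep k ⟨vec_ne_zero_iff.1 hu, vec_ne_zero_iff.1 hd⟩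
  unfold cornerDet at this
  unfold vec
  exact_mod_cast this

/-- The potentials on the rod `l` as functions of `ψ = p`, given the values of `ψ` at the separating
points. -/
def rodPot (R : RodData L) (pts : Fin L → Fin 2 → ℝ) (l : Fin (L + 1)) (p : Fin 2 → ℝ) : Fin 5 → ℝ :=
  profile (R.vec l) (R.a l + R.zetaShift pts l) (R.b l + R.chiShift pts l) p

/-- The jump of the shift cancels the jump of the profile, and the constants for ζ and χ agree
across a corner. -/
theorem rodPot_corner (hR : R.IsRodDataSet) (pts : Fin L → Fin 2 → ℝ) {k : Fin L} (hk : R.IsCorner k) :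
    R.rodPot pts k.castSucc (pts k) = R.rodPot pts k.succ (pts k) := by
  have h1 : R.chiShift pts k.succ = R.chiShift pts k.castSucc
      + chiProfile (R.vec k.castSucc) (pts k) - chiProfile (R.vec k.succ) (pts k) := by
    rw [chiShift, Fin.induction_succ, if_pos hk]
    rfl
  have h2 : R.zetaShift pts k.succ = R.zetaShift pts k.castSucc
      + zetaProfile (R.vec k.castSucc) (pts k) - zetaProfile (R.vec k.succ) (pts k) := by
    rw [zetaShift, Fin.induction_succ, if_pos hk]
    rfl
  unfold rodPot profile
  rw [h1, h2, hR.a_const k hk, hR.b_const k hk]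
  ext i
  fin_cases i <;> simp <;> ring

/-- The potentials near a separating point. -/
theorem exists_endPot (hR : R.IsRodDataSet) (pts : Fin L → Fin 2 → ℝ) (k : Fin L) {p : ℝ → Fin 2 → ℝ}
    (hp : ContDiff ℝ ∞ p) (hk : ∀ᶠ h in 𝓝 (R.z k), p h = pts k) :
    ∃ W : ℝ → Fin 5 → ℝ, ContDiff ℝ ∞ W ∧ (∀ h, W h 3 = p h 0 ∧ W h 4 = p h 1) ∧
      (∃ y, ∀ᶠ h in 𝓝 (R.z k), W h = y) ∧
      (R.IsAxis k.castSucc → ∀ h, R.z k ≤ h → W h = R.rodPot pts k.castSucc (p h)) ∧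
      (R.IsAxis k.succ → ∀ h, h ≤ R.z k → W h = R.rodPot pts k.succ (p h)) := by
  have sm : ∀ l, ContDiff ℝ ∞ fun h => R.rodPot pts l (p h) := fun l => contDiff_profile _ _ _ hp
  have ev : ∀ l, ∀ᶠ h in 𝓝 (R.z k), R.rodPot pts l (p h) = R.rodPot pts l (pts k) := fun l => by
    filter_upwards [hk] with h hh
    rw [hh]
  by_cases hu : R.IsAxis k.castSucc
  · by_cases hd : R.IsAxis k.succ
    · have e := rodPot_corner hR pts ⟨hu, hd⟩
      have ev' := ev k.succ
      rw [← e] at ev'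
      obtain ⟨h1, h2⟩ := contDiff_ite_of_eventuallyEq (sm k.castSucc) (sm k.succ) (ev k.castSucc) ev'
      refine ⟨_, h1, fun h => ?_, ⟨_, h2⟩, fun _ h hh => if_pos hh, fun _ h hh => ?_⟩
      · split_ifs <;> exact ⟨rfl, rfl⟩
      · rcases hh.eq_or_lt with rfl | hh
        · simp only [le_refl, if_true]
          rw [hk.self_of_nhds, e]
        · exact if_neg (not_le.2 hh)
    · exact ⟨_, sm k.castSucc, fun h => ⟨rfl, rfl⟩, ⟨_, ev _⟩, fun _ _ _ => rfl, fun e => absurd e hd⟩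
  · by_cases hd : R.IsAxis k.succ
    · exact ⟨_, sm k.succ, fun h => ⟨rfl, rfl⟩, ⟨_, ev _⟩, fun e => absurd e hu, fun _ _ _ => rfl⟩
    · refine ⟨fun h => profile 0 0 0 (p h), contDiff_profile _ _ _ hp, fun h => ⟨rfl, rfl⟩,
        ⟨profile 0 0 0 (pts k), ?_⟩, fun e => absurd e hu, fun e => absurd e hd⟩
      filter_upwards [hk] with h hh
      rw [hh]

theorem sum_eventually_single {J : Type*} [Fintype J] [DecidableEq J] {η : J → ℝ → ℝ}
    (h1 : ∀ h, ∑ j, η j h = 1) {h : ℝ} {j : J} (hj : ∀ i, i ≠ j → ∀ᶠ h' in 𝓝 h, η i h' = 0) :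
    ∀ᶠ h' in 𝓝 h, η j h' = 1 ∧ ∀ i, i ≠ j → η i h' = 0 := by
  have : ∀ᶠ h' in 𝓝 h, ∀ i, i ≠ j → η i h' = 0 := by
    refine Filter.eventually_all.2 fun i => ?_
    by_cases hi : i = j
    · exact Filter.Eventually.of_forall fun _ e => absurd hi e
    · filter_upwards [hj i hi] with h' hh _ using hh
  filter_upwards [this] with h' hh
  refine ⟨?_, hh⟩
  rw [← h1 h', Finset.sum_eq_single j (fun i _ hi => hh i hi) (by simp)]

theorem notMem_piece_endPt {k : Fin L} {i : Fin L ⊕ Bool} (hi : i ≠ .inl k) :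
    R.z k ∉ R.piece i := by
  rcases i with j | _ | _
  · rintro ⟨h1, h2, -⟩
    rcases lt_trichotomy j k with h | rfl | h
    · exact lt_irrefl _ (h2 k h)
    · exact hi rfl
    · exact lt_irrefl _ (h1 k h)
  · rintro ⟨h, -⟩
    exact lt_irrefl _ (h.1 k k.2)
  · rintro ⟨h, -⟩
    exact lt_irrefl _ (h.2 k (Nat.zero_le _))

/-- The bounds by `outer` in the definition of the pieces serve this purpose. They leave one piece
at each end of the axis even when L = 0 and both end pieces belong to the same rod. -/
theorem notMem_piece_north {h : ℝ} (hh : R.outer ≤ h) {i : Fin L ⊕ Bool} (hi : i ≠ .inr true) :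
    h ∉ R.piece i := by
  rcases i with j | _ | _
  · rintro ⟨-, -, h3⟩
    linarith [le_abs_self h]
  · rintro ⟨-, h3⟩
    linarith
  · exact absurd rfl hi

theorem notMem_piece_south {h : ℝ} (hh : h ≤ -R.outer) {i : Fin L ⊕ Bool} (hi : i ≠ .inr false) :
    h ∉ R.piece i := by
  rcases i with j | _ | _
  · rintro ⟨-, -, h3⟩
    linarith [neg_abs_le h]
  · exact absurd rfl hi
  · rintro ⟨-, h3⟩
    linarith

variable {η : Fin L ⊕ Bool → ℝ → ℝ}

theorem IsAxisPartition.eventually_endPt (H : R.IsAxisPartition η) (k : Fin L) :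
    ∀ᶠ h in 𝓝 (R.z k), η (.inl k) h = 1 ∧ ∀ i, i ≠ .inl k → η i h = 0 := by
  classical
  exact sum_eventually_single H.sum_eq_one fun i hi => H.eventually_eq_zero i _ (notMem_piece_endPt hi)

theorem IsAxisPartition.north (H : R.IsAxisPartition η) {h : ℝ} (hh : R.outer ≤ h) :
    η (.inr true) h = 1 ∧ ∀ i, i ≠ .inr true → η i h = 0 := by
  classical
  exact (sum_eventually_single H.sum_eq_one fun i hi =>
    H.eventually_eq_zero i h (notMem_piece_north hh hi)).self_of_nhds

theorem IsAxisPartition.south (H : R.IsAxisPartition η) {h : ℝ} (hh : h ≤ -R.outer) :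
    η (.inr false) h = 1 ∧ ∀ i, i ≠ .inr false → η i h = 0 := by
  classical
  exact (sum_eventually_single H.sum_eq_one fun i hi =>
    H.eventually_eq_zero i h (notMem_piece_south hh hi)).self_of_nhds

theorem sum_smul_eq {J V : Type*} [Fintype J] [AddCommGroup V] [Module ℝ V] {w : J → ℝ} {f : J → V} {y : V}
    (h1 : ∑ j, w j = 1) (hf : ∀ j, w j = 0 ∨ f j = y) : ∑ j, w j • f j = y := by
  have : ∀ j, w j • f j = w j • y := fun j => by
    rcases hf j with h | h
    · rw [h, zero_smul, zero_smul]
    · rw [h]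
  simp only [this, ← Finset.sum_smul, h1, one_smul]

theorem sum_smul_single {J V : Type*} [Fintype J] [AddCommGroup V] [Module ℝ V] {w : J → ℝ}
    {f : J → V} {j : J} (h1 : w j = 1) (hj : ∀ i, i ≠ j → w i = 0) : ∑ i, w i • f i = f j := by
  rw [Finset.sum_eq_single j (fun i _ hi => by rw [hj i hi, zero_smul]) (by simp), h1, one_smul]

/-- The position of an interior point of the rod `l` in the piece around a separating point. -/
theorem Inside.mem_piece_inl (hz : StrictAnti R.z) {l : Fin (L + 1)} {h : ℝ} (H : R.Inside l h)
    {k : Fin L} (hk : h ∈ R.piece (.inl k)) :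
    (l = k.castSucc ∧ R.z k < h) ∨ (l = k.succ ∧ h < R.z k) := by
  have hne : h ≠ R.z k := by
    rintro rfl
    rcases lt_or_ge (k : ℕ) l with hl | hl
    · exact lt_irrefl _ (H.1 k hl)
    · exact lt_irrefl _ (H.2 k hl)
  rcases lt_or_gt_of_ne hne with hh | hh
  · exact Or.inr ⟨H.succ_of_lt hz hk.2.1 hh, hh⟩
  · exact Or.inl ⟨H.castSucc_of_gt hz hk.1 hh, hh⟩

theorem Inside.mem_piece_true {l : Fin (L + 1)} {h : ℝ} (H : R.Inside l h)
    (hk : h ∈ R.piece (.inr true)) : l = 0 := hk.1.unique H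

theorem Inside.mem_piece_false {l : Fin (L + 1)} {h : ℝ} (H : R.Inside l h)
    (hk : h ∈ R.piece (.inr false)) : l = Fin.last L := hk.1.unique H

theorem IsAxisPartition.eq_zero_or_mem (H : R.IsAxisPartition η) (i : Fin L ⊕ Bool) (h : ℝ) :
    η i h = 0 ∨ h ∈ R.piece i := by
  by_cases hh : h ∈ R.piece i
  · exact Or.inr hh
  · exact Or.inl (H.eventually_eq_zero i h hh).self_of_nhds

/-- The components `ψ` of the potentials `(ζ, χ, ψ)`. -/
def psiPart (y : Fin 5 → ℝ) : Fin 2 → ℝ := ![y 3, y 4]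

theorem dot_inv_smul {v : Fin 2 → ℝ} (hv : v ≠ 0) (r : ℝ) : v ⬝ᵥ ((v ⬝ᵥ v)⁻¹ * r) • v = r := by
  have := (dot_self_pos hv).ne'
  rw [dotProduct_smul, smul_eq_mul]
  field_simp

/-- Values of `ψ` at the two ends of the axis. -/
theorem exists_farPsi {u d : Fin 2 → ℝ} (hu : u ≠ 0) (hd : d ≠ 0) (r s : ℝ) :
    ∃ p p' : Fin 2 → ℝ, u ⬝ᵥ p = r ∧ d ⬝ᵥ p' = s ∧ (u 0 * d 1 - u 1 * d 0 ≠ 0 → p' = p) ∧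
      (u 0 * d 1 - u 1 * d 0 = 0 → ∃ δ : ℝ, p' - p = δ • u) := by
  by_cases h : u 0 * d 1 - u 1 * d 0 = 0
  · have hmem : d ∈ Submodule.span ℝ {u} := by
      rw [← hat_dot_eq_zero_iff hu]
      simp only [hat, dotProduct, Fin.sum_univ_two, Matrix.cons_val_zero, Matrix.cons_val_one]
      linear_combination h
    obtain ⟨m, hm⟩ := Submodule.mem_span_singleton.1 hmem
    refine ⟨_, _, dot_inv_smul hu r, dot_inv_smul hd s, fun e => absurd h e, fun _ => ?_⟩
    refine ⟨(d ⬝ᵥ d)⁻¹ * s * m - (u ⬝ᵥ u)⁻¹ * r, ?_⟩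
    nth_rewrite 3 [← hm]
    rw [sub_smul, smul_smul]
  · obtain ⟨p, h1, h2⟩ := exists_dot_eq (fun _ _ => h) r s
    exact ⟨p, p, h1 hu, h2 hd, fun _ => rfl, fun e => absurd e h⟩

/-- Inside a rod only the pieces of its own ends are active. The ψ-values attached to these all
satisfy the linear condition of the rod, hence so does their average. All active choices of ζ and χ
are then the same function of this average, so averaging does not change them; only on horizon rods
is there a genuine interpolation. -/
theorem exists_axisPotentials (hR : R.IsRodDataSet) (H : R.IsAxisPartition η) :
    ∃ P : ℝ → Fin 5 → ℝ, ContDiff ℝ ∞ P ∧ (∀ k, ∃ y, ∀ᶠ h in 𝓝 (R.z k), P h = y) ∧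
      (∀ l, R.IsAxis l → ∀ x ∈ R.rod l, R.vec l ⬝ᵥ psiPart (P (x 2)) = R.c l ∧
        P (x 2) = R.rodPot (fun k => psiPart (P (R.z k))) l (psiPart (P (x 2)))) ∧
      (∀ h, R.outer ≤ h → P h = P R.outer) ∧ (∀ h, h ≤ -R.outer → P h = P (-R.outer)) ∧
      (R.vec 0 0 * R.vec (Fin.last L) 1 - R.vec 0 1 * R.vec (Fin.last L) 0 ≠ 0 →
        psiPart (P (-R.outer)) = psiPart (P R.outer)) ∧
      (R.vec 0 0 * R.vec (Fin.last L) 1 - R.vec 0 1 * R.vec (Fin.last L) 0 = 0 →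
        ∃ δ : ℝ, psiPart (P (-R.outer)) - psiPart (P R.outer) = δ • R.vec 0) := by
  have hz := hR.z_anti
  -- The value of ψ at a separating point satisfies two equations at a corner, one at a pole and
  -- none between two horizon rods.
  choose pts hu hd using fun k : Fin L =>
    exists_dot_eq (hR.det_ne_zero k) (R.c k.castSucc) (R.c k.succ)
  obtain ⟨pN, pS, hN, hS, hne, heq⟩ := exists_farPsi (vec_ne_zero_iff.2 hR.first_axis)
    (vec_ne_zero_iff.2 hR.last_axis) (R.c 0) (R.c (Fin.last L))
  set pv : Fin L ⊕ Bool → Fin 2 → ℝ := Sum.elim pts fun b => bif b then pN else pS with hpv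
  set p : ℝ → Fin 2 → ℝ := fun h => ∑ i, η i h • pv i with hp
  have psm : ContDiff ℝ ∞ p := ContDiff.sum fun i _ => (H.smooth i).smul contDiff_const
  have pk : ∀ k, ∀ᶠ h in 𝓝 (R.z k), p h = pts k := fun k => by
    filter_upwards [H.eventually_endPt k] with h hh
    exact sum_smul_single (w := fun i => η i h) hh.1 hh.2
  choose W hW1 hW2 hW3 hW4 hW5 using fun k => exists_endPot hR pts k psm (pk k)
  set V : Fin L ⊕ Bool → ℝ → Fin 5 → ℝ := Sum.elim W fun b h =>
    bif b then R.rodPot pts 0 (p h) else R.rodPot pts (Fin.last L) (p h) with hV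
  have Vsm : ∀ i, ContDiff ℝ ∞ (V i) := by
    rintro (k | _ | _)
    · exact hW1 k
    · exact contDiff_profile _ _ _ psm
    · exact contDiff_profile _ _ _ psm
  have V34 : ∀ i h, V i h 3 = p h 0 ∧ V i h 4 = p h 1 := by
    rintro (k | _ | _) h
    · exact hW2 k h
    · exact ⟨rfl, rfl⟩
    · exact ⟨rfl, rfl⟩
  set P : ℝ → Fin 5 → ℝ := fun h => ∑ i, η i h • V i h with hP
  -- Every V i has the same ψ-components p, and the weights sum to 1.
  have Pp : ∀ h, psiPart (P h) = p h := fun h => by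
    have e : ∀ j, P h j = ∑ i, η i h * V i h j := fun j => by
      simp only [hP, Finset.sum_apply, Pi.smul_apply, smul_eq_mul]
    ext j
    fin_cases j
    · change P h 3 = p h 0
      rw [e]
      simp only [fun i => (V34 i h).1, ← Finset.sum_mul, H.sum_eq_one, one_mul]
    · change P h 4 = p h 1
      rw [e]
      simp only [fun i => (V34 i h).2, ← Finset.sum_mul, H.sum_eq_one, one_mul]
  have pz : ∀ k, p (R.z k) = pts k := fun k => (pk k).self_of_nhds
  have pnorth : ∀ h, R.outer ≤ h → p h = pN := fun h hh =>
    sum_smul_single (w := fun i => η i h) (H.north hh).1 (H.north hh).2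
  have psouth : ∀ h, h ≤ -R.outer → p h = pS := fun h hh =>
    sum_smul_single (w := fun i => η i h) (H.south hh).1 (H.south hh).2
  have Pnorth : ∀ h, R.outer ≤ h → P h = R.rodPot pts 0 pN := fun h hh => by
    rw [← pnorth h hh]
    exact sum_smul_single (w := fun i => η i h) (f := fun i => V i h) (H.north hh).1 (H.north hh).2
  have Psouth : ∀ h, h ≤ -R.outer → P h = R.rodPot pts (Fin.last L) pS := fun h hh => by
    rw [← psouth h hh]
    exact sum_smul_single (w := fun i => η i h) (f := fun i => V i h) (H.south hh).1 (H.south hh).2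
  have Pend : ∀ k, ∀ᶠ h in 𝓝 (R.z k), P h = W k h := fun k => by
    filter_upwards [H.eventually_endPt k] with h hh
    exact sum_smul_single (w := fun i => η i h) (f := fun i => V i h) hh.1 hh.2
  refine ⟨P, ContDiff.sum fun i _ => (H.smooth i).smul (Vsm i), fun k => ?_, fun l hl x hx => ?_,
    fun h hh => ?_, fun h hh => ?_, fun e => ?_, fun e => ?_⟩
  · obtain ⟨y, hy⟩ := hW3 k
    refine ⟨y, ?_⟩
    filter_upwards [Pend k, hy] with h h1 h2
    rw [h1, h2]
  · simp only [Pp, pz]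
    have hr := (mem_rod_iff.1 hx).1
    rcases inside_or_eq hz (x 2) with ⟨k, hk⟩ | ⟨l', H'⟩
    · rw [hk, pz, (Pend k).self_of_nhds]
      rcases (mem_rod_endPt hz hr hk).1 hx with rfl | rfl
      · exact ⟨hu k (vec_ne_zero_iff.2 hl), by rw [hW4 k hl _ le_rfl, pz]⟩
      · exact ⟨hd k (vec_ne_zero_iff.2 hl), by rw [hW5 k hl _ le_rfl, pz]⟩
    · obtain rfl := H'.eq_of_mem_rod hx
      have key : ∀ i, η i (x 2) = 0 ∨ (R.vec l ⬝ᵥ pv i = R.c l ∧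
          V i (x 2) = R.rodPot pts l (p (x 2))) := by
        intro i
        refine (H.eq_zero_or_mem i (x 2)).imp_right fun hi => ?_
        rcases i with k | _ | _
        · rcases H'.mem_piece_inl hz hi with ⟨rfl, hh⟩ | ⟨rfl, hh⟩
          · exact ⟨hu k (vec_ne_zero_iff.2 hl), hW4 k hl _ hh.le⟩
          · exact ⟨hd k (vec_ne_zero_iff.2 hl), hW5 k hl _ hh.le⟩
        · obtain rfl := H'.mem_piece_false hi
          exact ⟨hS, rfl⟩
        · obtain rfl := H'.mem_piece_true hi
          exact ⟨hN, rfl⟩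
      refine ⟨?_, sum_smul_eq (H.sum_eq_one _) fun i => (key i).imp_right And.right⟩
      have : R.vec l ⬝ᵥ p (x 2) = ∑ i, η i (x 2) • (R.vec l ⬝ᵥ pv i) := by
        simp only [hp, dotProduct_sum, dotProduct_smul]
      rw [this]
      exact sum_smul_eq (H.sum_eq_one _) fun i => (key i).imp_right And.left
  · rw [Pnorth h hh, Pnorth _ le_rfl]
  · rw [Psouth h hh, Psouth _ le_rfl]
  · rw [Pp, Pp, pnorth _ le_rfl, psouth _ le_rfl, hne e]
  · rw [Pp, Pp, pnorth _ le_rfl, psouth _ le_rfl]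
    exact heq e

end RodData

/-! ### The models at infinity -/

/-- The model along a whole line with rod structure `v`. -/
def lineModel (v : Fin 2 → ℝ) : ℝ × ℝ → Fin 3 → ℝ := frameMat v (hat v) (fun q => q.1) fun _ => 1

theorem regular_lineModel {v : Fin 2 → ℝ} (hv : v ≠ 0) {q : ℝ × ℝ} (hq : 0 < q.1) :
    Regular (lineModel v) q :=
  regular_frameMat (by rw [det_hat]; exact (dot_self_pos hv).ne') contDiffAt_fst contDiffAt_const hq
    one_pos

theorem rodForm_lineModel {u v : Fin 2 → ℝ} (hu : u ≠ 0) (hv : v ≠ 0)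
    (huv : u 0 * v 1 - u 1 * v 0 = 0) (h : ℝ) : RodForm v (lineModel u) h := by
  have hmem : u ∈ Submodule.span ℝ {v} := by
    rw [← hat_dot_eq_zero_iff hv]
    simp only [hat, dotProduct, Fin.sum_univ_two, Matrix.cons_val_zero, Matrix.cons_val_one]
    linear_combination -huv
  obtain ⟨m, rfl⟩ := Submodule.mem_span_singleton.1 hmem
  have hm : m ≠ 0 := by rintro rfl; simp at hu
  refine RodForm.of_frame (α := m • v) hv ?_ (g := fun _ => 1) (d := fun _ => m ^ 2) contDiffAt_const
    contDiffAt_const one_pos (by positivity) (Filter.Eventually.of_forall fun q => ?_)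
  · rw [smul_dotProduct, smul_eq_mul]
    exact mul_ne_zero hm (dot_self_pos hv).ne'
  · ext i
    fin_cases i <;> simp [lineModel, frameMat, sqVec, hat] <;> ring

/-- A model with rod structures `u` and `d` at the northern and southern ends of the axis. -/
structure IsFarModel (u d : Fin 2 → ℝ) (f : ℝ × ℝ → Fin 3 → ℝ) : Prop where
  regular : ∀ q : ℝ × ℝ, 0 < q.1 → Regular f q
  north : ∀ h, 0 < h → RodForm u f h
  south : ∀ h, h < 0 → RodForm d f h
  tension : ∀ y w : Fin 5 → ℝ,
    (u 0 * d 1 - u 1 * d 0 ≠ 0 → w 3 = 0 ∧ w 4 = 0) →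
    (u 0 * d 1 - u 1 * d 0 = 0 → ∃ δ, w 3 = δ * u 0 ∧ w 4 = δ * u 1) →
    ∃ C, 0 ≤ C ∧ ∀ (X : ℝ × ℝ → Fin 8 → ℝ) (p : E3), 0 < rhoSq p → 1 ≤ ‖p‖ →
      (X =ᶠ[𝓝 (cyl p)] fun q => join (f q) (y + angStep (cosAng q) • w)) →
      tensionNorm (fun x => X (cyl x)) p ≤ C * ‖p‖ ^ (-3 : ℤ)

theorem join_farVal (α β : Fin 2 → ℝ) (D₁ D₂ : ℝ × ℝ → ℝ) (q : ℝ × ℝ) (y w : Fin 5 → ℝ) (l : ℝ) :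
    join (frameMat α β D₁ D₂ q) (potAct α β y + l • potAct α β w) =
      act α β (farVal (D₁ q) (D₂ q) y w l) := by
  rw [← potAct_smul, ← potAct_add, join_frameMat]
  rfl

/-- For independent structures the corner model at the origin is used and ψ must not change, because
F⁻¹ decays only like 1/r. For parallel structures the model is ρ² uuᵀ + ûûᵀ, and a change of ψ along
u is harmless. -/
theorem exists_isFarModel {u d : Fin 2 → ℝ} (hu : u ≠ 0) (hd : d ≠ 0) : ∃ f, IsFarModel u d f := by
  by_cases hx : u 0 * d 1 - u 1 * d 0 = 0
  · have hdet : u 0 * hat u 1 - u 1 * hat u 0 ≠ 0 := by rw [det_hat]; exact (dot_self_pos hu).ne'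
    refine ⟨lineModel u, fun q hq => regular_lineModel hu hq,
      fun h _ => rodForm_lineModel hu hu (by ring) h, fun h _ => rodForm_lineModel hu hd hx h,
      fun y w _ hw => ?_⟩
    obtain ⟨y, rfl⟩ := exists_potAct hdet y
    obtain ⟨w, rfl⟩ := exists_potAct hdet w
    obtain ⟨δ, e0, e1⟩ := hw hx
    have hw4 : w 4 = 0 := by
      simp only [potAct, Matrix.cons_val] at e0 e1
      have : (u 0 * hat u 1 - u 1 * hat u 0) * w 4 = 0 := by linear_combination u 0 * e1 - u 1 * e0
      exact (mul_eq_zero.1 this).resolve_left hdet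
    obtain ⟨C, hC, hX⟩ := tensionNorm_far_rod hdet (y := y) hw4
    refine ⟨C, hC, fun X p hp h1 e => hX X p hp h1 ?_⟩
    simpa only [lineModel, join_farVal] using e
  · have hdet : hat d 0 * hat u 1 - hat d 1 * hat u 0 ≠ 0 := by
      intro h0
      apply hx
      simp only [hat, Matrix.cons_val_zero, Matrix.cons_val_one] at h0
      linear_combination -h0
    have M := isEndModel_corner hx 0
    refine ⟨_, M.regular, fun h hh => (M.above h hh).2 hu, fun h hh => (M.below h hh).2 hd,
      fun y w hw _ => ?_⟩
    obtain ⟨y, rfl⟩ := exists_potAct hdet y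
    obtain ⟨w, rfl⟩ := exists_potAct hdet w
    obtain ⟨e0, e1⟩ := hw hx
    simp only [potAct, Matrix.cons_val] at e0 e1
    have hw3 : w 3 = 0 := by
      have : (hat d 0 * hat u 1 - hat d 1 * hat u 0) * w 3 = 0 := by
        linear_combination hat u 1 * e0 - hat u 0 * e1
      exact (mul_eq_zero.1 this).resolve_left hdet
    have hw4 : w 4 = 0 := by
      have : (hat d 0 * hat u 1 - hat d 1 * hat u 0) * w 4 = 0 := by
        linear_combination hat d 0 * e1 - hat d 1 * e0
      exact (mul_eq_zero.1 this).resolve_left hdet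
    obtain ⟨C, hC, hX⟩ := tensionNorm_far_corner hdet (y := y) hw3 hw4
    refine ⟨C, hC, fun X p hp h1 e => hX X p hp h1 ?_⟩
    simpa only [join_farVal] using e

/-! ### The cut-off between the bounded region and infinity -/

/-- A smooth function of `ρ² + z²` that vanishes for `ρ² + z² ≤ B²` and is `1` for
`B² + 1 ≤ ρ² + z²`. -/
def farStep (B : ℝ) (q : ℝ × ℝ) : ℝ := Real.smoothTransition (q.1 + q.2 ^ 2 - B ^ 2)

theorem contDiff_farStep (B : ℝ) : ContDiff ℝ ∞ (farStep B) :=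
  Real.smoothTransition.contDiff.comp (by fun_prop)

theorem farStep_nonneg (B : ℝ) (q : ℝ × ℝ) : 0 ≤ farStep B q := Real.smoothTransition.nonneg _

theorem farStep_le_one (B : ℝ) (q : ℝ × ℝ) : farStep B q ≤ 1 := Real.smoothTransition.le_one _

theorem farStep_eventually_zero {B : ℝ} {q : ℝ × ℝ} (h : q.1 + q.2 ^ 2 < B ^ 2) :
    ∀ᶠ q' in 𝓝 q, farStep B q' = 0 := by
  have : ContinuousAt (fun q : ℝ × ℝ => q.1 + q.2 ^ 2) q := by fun_prop
  filter_upwards [this.eventually (gt_mem_nhds h)] with q' h'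
  exact Real.smoothTransition.zero_of_nonpos (by linarith)

theorem farStep_eventually_one {B : ℝ} {q : ℝ × ℝ} (h : B ^ 2 + 1 < q.1 + q.2 ^ 2) :
    ∀ᶠ q' in 𝓝 q, farStep B q' = 1 := by
  have : ContinuousAt (fun q : ℝ × ℝ => q.1 + q.2 ^ 2) q := by fun_prop
  filter_upwards [this.eventually (lt_mem_nhds h)] with q' h'
  exact Real.smoothTransition.one_of_one_le (by linarith)

theorem contDiffAt_cosAng {q : ℝ × ℝ} (h : 0 < q.1 + q.2 ^ 2) : ContDiffAt ℝ ∞ cosAng q := by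
  have h' : 0 < q.1 + (q.2 - 0) ^ 2 := by simpa using h
  exact contDiffAt_snd.div (contDiffAt_rad h') (rad_pos h').ne'

theorem cosAng_axis {h : ℝ} : cosAng (0, h) = h / |h| := by
  simp [cosAng, rad, Real.sqrt_sq_eq_abs]

theorem angStep_north {h : ℝ} (hh : 0 < h) : ∀ᶠ q in 𝓝 ((0 : ℝ), h), angStep (cosAng q) = 0 := by
  have hc : ContinuousAt cosAng (0, h) := (contDiffAt_cosAng (by positivity)).continuousAt
  have h1 : (1 / 2 : ℝ) < cosAng (0, h) := by
    rw [cosAng_axis, abs_of_pos hh, div_self hh.ne']; norm_num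
  filter_upwards [hc.eventually (lt_mem_nhds h1)] with q hq using angStep_of_ge hq.le

theorem angStep_south {h : ℝ} (hh : h < 0) : ∀ᶠ q in 𝓝 ((0 : ℝ), h), angStep (cosAng q) = 1 := by
  have hc : ContinuousAt cosAng (0, h) := (contDiffAt_cosAng (by have := hh.ne; simp only [zero_add]; positivity)).continuousAt
  have h1 : cosAng (0, h) < -1 / 2 := by
    rw [cosAng_axis, abs_of_neg hh, div_neg, div_self hh.ne]; norm_num
  filter_upwards [hc.eventually (gt_mem_nhds h1)] with q hq using angStep_of_le hq.le

/-! ### Gluing -/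

namespace RodData

variable {L : ℕ} (R : RodData L)

/-- The radius outside of which the asymptotic model is used. -/
def farRadius : ℝ := R.outer + 1

/-- The weights with which the models are glued. -/
def weight (η : Fin L ⊕ Bool → ℝ → ℝ) : Option (Fin L ⊕ Bool) → ℝ × ℝ → ℝ
  | none => farStep R.farRadius
  | some i => fun q => (1 - farStep R.farRadius q) * η i q.2

/-- The models that are glued. -/
def model (f : Fin L → ℝ × ℝ → Fin 3 → ℝ) (g : ℝ × ℝ → Fin 3 → ℝ) :
    Option (Fin L ⊕ Bool) → ℝ × ℝ → Fin 3 → ℝ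
  | none => g
  | some (.inl k) => f k
  | some (.inr true) => lineModel (R.vec 0)
  | some (.inr false) => lineModel (R.vec (Fin.last L))

/-- The matrix `F` of the glued map. -/
def glue (η : Fin L ⊕ Bool → ℝ → ℝ) (f : Fin L → ℝ × ℝ → Fin 3 → ℝ) (g : ℝ × ℝ → Fin 3 → ℝ)
    (q : ℝ × ℝ) : Fin 3 → ℝ := ∑ j, R.weight η j q • R.model f g j q

/-- The potentials of the glued map. -/
def gluePot (P : ℝ → Fin 5 → ℝ) (q : ℝ × ℝ) : Fin 5 → ℝ :=
  (1 - farStep R.farRadius q) • P q.2 + farStep R.farRadius q •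
    (P R.outer + angStep (cosAng q) • (P (-R.outer) - P R.outer))

variable {R} {η : Fin L ⊕ Bool → ℝ → ℝ} {f : Fin L → ℝ × ℝ → Fin 3 → ℝ} {g : ℝ × ℝ → Fin 3 → ℝ}
  {P : ℝ → Fin 5 → ℝ}

theorem IsAxisPartition.contDiff_weight (H : R.IsAxisPartition η) (j : Option (Fin L ⊕ Bool)) :
    ContDiff ℝ ∞ (R.weight η j) := by
  rcases j with _ | i
  · exact contDiff_farStep _
  · exact (contDiff_const.sub (contDiff_farStep _)).mul ((H.smooth i).comp contDiff_snd)

theorem IsAxisPartition.weight_nonneg (H : R.IsAxisPartition η) (j : Option (Fin L ⊕ Bool))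
    (q : ℝ × ℝ) : 0 ≤ R.weight η j q := by
  rcases j with _ | i
  · exact farStep_nonneg _ _
  · exact mul_nonneg (sub_nonneg.2 (farStep_le_one _ _)) (H.nonneg i _)

theorem IsAxisPartition.sum_weight (H : R.IsAxisPartition η) (q : ℝ × ℝ) :
    ∑ j, R.weight η j q = 1 := by
  rw [Fintype.sum_option]
  simp only [weight, ← Finset.mul_sum, H.sum_eq_one]
  ring

theorem IsAxisPartition.weight_eventually_zero (H : R.IsAxisPartition η) {i : Fin L ⊕ Bool}
    {q : ℝ × ℝ} (h : q.2 ∉ R.piece i) : ∀ᶠ q' in 𝓝 q, R.weight η (some i) q' = 0 := by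
  have := continuousAt_snd.eventually (H.eventually_eq_zero i q.2 h)
  filter_upwards [this] with q' h'
  simp [weight, h']

theorem regular_glue (hR : R.IsRodDataSet) (H : R.IsAxisPartition η)
    (hf : ∀ k, IsEndModel (R.vec k.castSucc) (R.vec k.succ) (R.z k) (f k))
    (hg : IsFarModel (R.vec 0) (R.vec (Fin.last L)) g) {q : ℝ × ℝ} (hq : 0 < q.1) :
    Regular (R.glue η f g) q := by
  refine Regular.sum (fun j => (H.contDiff_weight j).contDiffAt) (fun j => H.weight_nonneg j q)
    (H.sum_weight q) fun j => Or.inr ?_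
  rcases j with _ | k | _ | _
  · exact hg.regular q hq
  · exact (hf k).regular q hq
  · exact regular_lineModel (vec_ne_zero_iff.2 hR.last_axis) hq
  · exact regular_lineModel (vec_ne_zero_iff.2 hR.first_axis) hq

/-- Each model either has vanishing weight near the point or has the form prescribed by the rod l.
The far model is active only at heights at least `farRadius` in absolute value, which belong to the
two semi-infinite rods. -/
theorem axisForm_glue (hR : R.IsRodDataSet) (H : R.IsAxisPartition η)
    (hf : ∀ k, IsEndModel (R.vec k.castSucc) (R.vec k.succ) (R.z k) (f k))
    (hg : IsFarModel (R.vec 0) (R.vec (Fin.last L)) g) {l : Fin (L + 1)} {h : ℝ}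
    (hl : R.Inside l h) : AxisForm (R.vec l) (R.glue η f g) h := by
  have h0 := vec_ne_zero_iff.2 hR.first_axis
  have h1 := vec_ne_zero_iff.2 hR.last_axis
  have hA := R.one_le_outer
  have key : ∀ j, (∀ᶠ q in 𝓝 ((0 : ℝ), h), R.weight η j q = 0) ∨ AxisForm (R.vec l) (R.model f g j) h := by
    rintro (_ | i)
    · by_cases hh : |h| < R.farRadius
      · left
        refine farStep_eventually_zero ?_
        simpa using sq_lt_sq.2 (hh.trans_le (le_abs_self _))
      · right
        unfold farRadius at hh
        rcases le_abs.1 (not_lt.1 hh) with hh | hh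
        · obtain rfl := (inside_zero (R := R) (h := h) (by linarith)).unique hl
          exact axisForm_of_ne h0 (hg.north h (by linarith))
        · obtain rfl := (inside_last (R := R) (h := h) (by linarith)).unique hl
          exact axisForm_of_ne h1 (hg.south h (by linarith))
    · by_cases hi : h ∈ R.piece i
      · right
        rcases i with k | _ | _
        · rcases hl.mem_piece_inl hR.z_anti hi with ⟨rfl, hh⟩ | ⟨rfl, hh⟩
          · exact (hf k).above h hh
          · exact (hf k).below h hh
        · obtain rfl := hl.mem_piece_false hi
          exact axisForm_of_ne h1 (rodForm_lineModel h1 h1 (by ring) h)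
        · obtain rfl := hl.mem_piece_true hi
          exact axisForm_of_ne h0 (rodForm_lineModel h0 h0 (by ring) h)
      · exact Or.inl (H.weight_eventually_zero hi)
  constructor
  · intro hv
    exact Regular.sum (fun j => (H.contDiff_weight j).contDiffAt) (fun j => H.weight_nonneg j _)
      (H.sum_weight _) fun j => (key j).imp_right fun h => h.1 hv
  · intro hv
    exact RodForm.sum (fun j => (H.contDiff_weight j).contDiffAt) (fun j => H.weight_nonneg j _)
      (H.sum_weight _) fun j => (key j).imp_right fun h => h.2 hv

/-- Near a separating point a single weight is 1 and the others are 0, so the exact harmonic model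
survives the gluing there. -/
theorem glue_eventually_endPt (H : R.IsAxisPartition η) (k : Fin L) :
    R.glue η f g =ᶠ[𝓝 (0, R.z k)] f k := by
  have h1 : ∀ᶠ q in 𝓝 ((0 : ℝ), R.z k), farStep R.farRadius q = 0 := by
    refine farStep_eventually_zero ?_
    have := R.abs_z_lt_outer k
    have := R.one_le_outer
    have hh : |R.z k| < |R.farRadius| := by
      refine lt_of_lt_of_le ?_ (le_abs_self _)
      unfold farRadius
      linarith
    simpa using sq_lt_sq.2 hh
  filter_upwards [h1, continuousAt_snd.eventually (H.eventually_endPt k)] with q e1 e2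
  refine sum_smul_single (w := fun j => R.weight η j q) (f := fun j => R.model f g j q)
    (j := some (.inl k)) ?_ ?_
  · simp only [weight, e1, e2.1]
    norm_num
  · rintro (_ | i) hi
    · exact e1
    · simp only [weight]
      rw [e2.2 i fun e => hi (by rw [e]), mul_zero]

theorem glue_eventually_far {q : ℝ × ℝ} (hq : R.farRadius ^ 2 + 1 < q.1 + q.2 ^ 2) :
    R.glue η f g =ᶠ[𝓝 q] g ∧
      R.gluePot P =ᶠ[𝓝 q] fun q => P R.outer + angStep (cosAng q) • (P (-R.outer) - P R.outer) := by
  constructor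
  · filter_upwards [farStep_eventually_one hq] with q' e1
    refine sum_smul_single (w := fun j => R.weight η j q') (f := fun j => R.model f g j q')
      (j := none) e1 ?_
    rintro (_ | i) hi
    · exact absurd rfl hi
    · simp [weight, e1]
  · filter_upwards [farStep_eventually_one hq] with q' e1
    simp [gluePot, e1]

/-- Where the radial cut-off acts near the axis, both P and the angular step are already constant,
so the inner and the outer potentials agree. Thus near the whole axis the potentials depend on z
alone. -/
theorem gluePot_eventually_axis (hN : ∀ h, R.outer ≤ h → P h = P R.outer)
    (hS : ∀ h, h ≤ -R.outer → P h = P (-R.outer)) (h : ℝ) :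
    ∀ᶠ q in 𝓝 ((0 : ℝ), h), R.gluePot P q = P q.2 := by
  have hA := R.one_le_outer
  by_cases hh : |h| < R.farRadius
  · have : (0, h).1 + (0, h).2 ^ 2 < R.farRadius ^ 2 := by
      simpa using sq_lt_sq.2 (hh.trans_le (le_abs_self _))
    filter_upwards [farStep_eventually_zero this] with q hq
    simp [gluePot, hq]
  · unfold farRadius at hh
    rcases le_abs.1 (not_lt.1 hh) with hh | hh
    · filter_upwards [angStep_north (show 0 < h by linarith),
        continuousAt_snd.eventually (lt_mem_nhds (show R.outer < h by linarith))] with q e1 e2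
      rw [gluePot, e1, hN q.2 e2.le, zero_smul, add_zero, ← add_smul]
      simp
    · filter_upwards [angStep_south (show h < 0 by linarith),
        continuousAt_snd.eventually (gt_mem_nhds (show h < -R.outer by linarith))] with q e1 e2
      rw [gluePot, e1, hS q.2 e2.le, one_smul, add_sub_cancel, ← add_smul]
      simp

/-- The function cos θ is singular at the origin, and its formula is used only where ρ > 0. On the
axis the preceding local description replaces it. -/
theorem contDiffAt_gluePot (hP : ContDiff ℝ ∞ P) (hN : ∀ h, R.outer ≤ h → P h = P R.outer)
    (hS : ∀ h, h ≤ -R.outer → P h = P (-R.outer)) {q : ℝ × ℝ} (hq : 0 ≤ q.1) :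
    ContDiffAt ℝ ∞ (R.gluePot P) q := by
  have h1 : ContDiffAt ℝ ∞ (fun q : ℝ × ℝ => P q.2) q := (hP.comp contDiff_snd).contDiffAt
  rcases hq.eq_or_lt with hq | hq
  · obtain ⟨s, h⟩ := q
    obtain rfl : 0 = s := hq
    exact h1.congr_of_eventuallyEq (gluePot_eventually_axis hN hS h)
  · have h2 := (contDiff_farStep R.farRadius).contDiffAt (x := q)
    have h3 : ContDiffAt ℝ ∞ (fun q => angStep (cosAng q)) q :=
      (contDiff_angStep (n := ⊤)).contDiffAt.comp q (contDiffAt_cosAng (by positivity))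
    exact ((contDiffAt_const.sub h2).smul h1).add
      (h2.smul (contDiffAt_const.add (h3.smul contDiffAt_const)))

end RodData

theorem join_rodVal (v : Fin 2 → ℝ) (y₀ y₁ y₂ c s a b d t : ℝ) :
    join ((s * a) • sqVec v + (s * b) • symVec v (hat v) + d • sqVec (hat v)) (potAct v (hat v)
      ![y₀ + 2 / 3 * (1 / √3) * c ^ 2 * t, y₁ + 1 / 3 * (1 / √3) * c * t ^ 2, y₂ - 1 / √3 * c * t, c, t])
      = act v (hat v) (rodVal y₀ y₁ y₂ c s a b d t) := by
  ext i
  fin_cases i <;> simp [join, potAct, act, rodVal, sqVec, symVec]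

theorem contDiff_psiPart {P : ℝ → Fin 5 → ℝ} (hP : ContDiff ℝ ∞ P) :
    ContDiff ℝ ∞ fun h => RodData.psiPart (P h) := by
  refine contDiff_pi.2 fun i => ?_
  fin_cases i
  · exact contDiff_pi.1 hP 3
  · exact contDiff_pi.1 hP 4

/-- The tension is bounded near the interior of an axis rod. -/
theorem RodForm.tensionNorm_bounded {v : Fin 2 → ℝ} (hv : v ≠ 0) {F : ℝ × ℝ → Fin 3 → ℝ} {h : ℝ}
    (hF : RodForm v F h) {P : ℝ → Fin 5 → ℝ} (hP : ContDiff ℝ ∞ P) {A : Fin 2 → ℝ} {B c : ℝ}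
    (hprof : ∀ᶠ z in 𝓝 h, v ⬝ᵥ RodData.psiPart (P z) = c ∧ P z = profile v A B (RodData.psiPart (P z)))
    {X : ℝ × ℝ → Fin 8 → ℝ} (hX : ∀ᶠ q in 𝓝 ((0 : ℝ), h), X q = join (F q) (P q.2)) :
    ∃ C, ∀ᶠ q in 𝓝 ((0 : ℝ), h), ∀ p, cyl p = q → 0 < q.1 →
      tensionNorm (fun x => X (cyl x)) p ≤ C := by
  obtain ⟨a, b, d, ca, cb, cd, a0, d0, e⟩ := hF
  obtain ⟨y₀, y₁, y₂, c', hy⟩ := exists_profile_eq hv A B c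
  have hψ := contDiff_psiPart hP
  have ht : ContDiffAt ℝ ∞ (fun z => (v ⬝ᵥ v)⁻¹ * (RodData.psiPart (P z) ⬝ᵥ hat v)) h := by
    have h0 := (contDiff_pi.1 hψ 0).contDiffAt (x := h)
    have h1 := (contDiff_pi.1 hψ 1).contDiffAt (x := h)
    simp only [dotProduct, Fin.sum_univ_two]
    exact contDiffAt_const.mul ((h0.mul contDiffAt_const).add (h1.mul contDiffAt_const))
  refine tensionNorm_bounded_of_rod (α := v) (β := hat v) (y₀ := y₀) (y₁ := y₁) (y₂ := y₂) (c := c')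
    (by rw [det_hat]; exact (dot_self_pos hv).ne') ca cb cd ht a0 d0 ?_
  filter_upwards [hX, e, continuousAt_snd.eventually hprof] with q h1 h2 h3
  rw [h1, h2, ← join_rodVal]
  exact congrArg (join _) (h3.2.trans (hy _ h3.1))

theorem fMat_join_mulVec (f : Fin 3 → ℝ) (y : Fin 5 → ℝ) (w : Fin 2 → ℝ) :
    fMat (join f y) *ᵥ w = 0 ↔ InKer f w := by
  simp only [InKer, fMat, join, funext_iff, Fin.forall_fin_two]
  simp [Matrix.mulVec, dotProduct, Fin.sum_univ_two]

theorem det_fMat_join (f : Fin 3 → ℝ) (y : Fin 5 → ℝ) : (fMat (join f y)).det = detVec f := by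
  rw [det_fMat]; simp [detF, join, detVec]

theorem exists_fMat_join (i j : Fin 2) : ∃ k : Fin 3, ∀ f y, fMat (join f y) i j = f k := by
  fin_cases i <;> fin_cases j
  exacts [⟨0, fun _ _ => rfl⟩, ⟨1, fun _ _ => rfl⟩, ⟨1, fun _ _ => rfl⟩, ⟨2, fun _ _ => rfl⟩]

theorem rhoSq_nonneg (x : E3) : 0 ≤ rhoSq x := by unfold rhoSq; positivity

theorem cyl_axisPt (h : ℝ) : cyl (axisPt h) = (0, h) := by simp [cyl, rhoSq, axisPt]

theorem eq_axisPt {x : E3} (hx : rhoSq x = 0) : x = axisPt (x 2) := by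
  have h0 : x 0 = 0 := by
    unfold rhoSq at hx
    nlinarith [sq_nonneg (x 0), sq_nonneg (x 1)]
  have h1 : x 1 = 0 := by
    unfold rhoSq at hx
    nlinarith [sq_nonneg (x 0), sq_nonneg (x 1)]
  ext i
  fin_cases i <;> simp [axisPt, h0, h1]

theorem norm_sub_axisPt (x : E3) (c : ℝ) : ‖x - axisPt c‖ = rad c (cyl x) := by
  rw [EuclideanSpace.norm_eq, rad]
  simp [Fin.sum_univ_three, cyl, rhoSq, axisPt]

theorem norm_sq_eq (x : E3) : ‖x‖ ^ 2 = rhoSq x + x 2 ^ 2 := by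
  rw [norm_eq_rad, rad_sq] <;> simp only [sub_zero, cyl]
  have := rhoSq_nonneg x
  positivity

/-! ### The glued map: regularity, rod structure and potentials -/

namespace RodData

variable {L : ℕ} {R : RodData L} {η : Fin L ⊕ Bool → ℝ → ℝ} {f : Fin L → ℝ × ℝ → Fin 3 → ℝ}
  {g : ℝ × ℝ → Fin 3 → ℝ} {P : ℝ → Fin 5 → ℝ}

variable (R) in
/-- The glued map as a function of `(ρ², z)`. -/
def glueMap (η : Fin L ⊕ Bool → ℝ → ℝ) (f : Fin L → ℝ × ℝ → Fin 3 → ℝ) (g : ℝ × ℝ → Fin 3 → ℝ)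
    (P : ℝ → Fin 5 → ℝ) (q : ℝ × ℝ) : Fin 8 → ℝ := join (R.glue η f g q) (R.gluePot P q)

/-- The ingredients of the glued map. -/
structure IsGlueData (R : RodData L) (η : Fin L ⊕ Bool → ℝ → ℝ) (f : Fin L → ℝ × ℝ → Fin 3 → ℝ)
    (g : ℝ × ℝ → Fin 3 → ℝ) (P : ℝ → Fin 5 → ℝ) : Prop where
  rodData : R.IsRodDataSet
  partition : R.IsAxisPartition η
  endModel : ∀ k, IsEndModel (R.vec k.castSucc) (R.vec k.succ) (R.z k) (f k)
  farModel : IsFarModel (R.vec 0) (R.vec (Fin.last L)) g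
  smooth : ContDiff ℝ ∞ P
  const_endPt : ∀ k, ∃ y, ∀ᶠ h in 𝓝 (R.z k), P h = y
  rod : ∀ l, R.IsAxis l → ∀ x ∈ R.rod l, R.vec l ⬝ᵥ psiPart (P (x 2)) = R.c l ∧
    P (x 2) = R.rodPot (fun k => psiPart (P (R.z k))) l (psiPart (P (x 2)))
  north : ∀ h, R.outer ≤ h → P h = P R.outer
  south : ∀ h, h ≤ -R.outer → P h = P (-R.outer)
  far_ne : R.vec 0 0 * R.vec (Fin.last L) 1 - R.vec 0 1 * R.vec (Fin.last L) 0 ≠ 0 →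
    psiPart (P (-R.outer)) = psiPart (P R.outer)
  far_eq : R.vec 0 0 * R.vec (Fin.last L) 1 - R.vec 0 1 * R.vec (Fin.last L) 0 = 0 →
    ∃ δ : ℝ, psiPart (P (-R.outer)) - psiPart (P R.outer) = δ • R.vec 0

theorem exists_isGlueData (hR : R.IsRodDataSet) : ∃ η f g P, R.IsGlueData η f g P := by
  obtain ⟨η, H⟩ := exists_axisPartition hR.z_anti
  choose f hf using fun k => exists_isEndModel (hR.det_ne_zero k) (R.z k)
  obtain ⟨g, hg⟩ := exists_isFarModel (vec_ne_zero_iff.2 hR.first_axis) (vec_ne_zero_iff.2 hR.last_axis)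
  obtain ⟨P, h1, h2, h3, h4, h5, h6, h7⟩ := exists_axisPotentials hR H
  exact ⟨η, f, g, P, hR, H, hf, hg, h1, h2, h3, h4, h5, h6, h7⟩

namespace IsGlueData

theorem pot_axis (G : R.IsGlueData η f g P) (x : E3) (hx : rhoSq x = 0) : R.gluePot P (cyl x) = P (x 2) := by
  have : cyl x = (0, x 2) := by rw [cyl, hx]
  rw [this]
  exact (gluePot_eventually_axis G.north G.south (x 2)).self_of_nhds

theorem contDiff_pot (G : R.IsGlueData η f g P) : ContDiff ℝ ∞ fun x => R.gluePot P (cyl x) :=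
  contDiff_iff_contDiffAt.2 fun x =>
    (contDiffAt_gluePot G.smooth G.north G.south (rhoSq_nonneg x)).comp x contDiff_cyl.contDiffAt

theorem not_axis (G : R.IsGlueData η f g P) {x : E3} (hx : x ∉ R.axis) (h0 : rhoSq x = 0) :
    (∃ k, x 2 = R.z k ∧ R.vec k.castSucc = 0 ∧ R.vec k.succ = 0) ∨
      ∃ l, R.Inside l (x 2) ∧ R.vec l = 0 := by
  rcases inside_or_eq G.rodData.z_anti (x 2) with ⟨k, hk⟩ | ⟨l, hl⟩
  · refine Or.inl ⟨k, hk, ?_, ?_⟩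
    · by_contra e
      exact hx ⟨_, vec_ne_zero_iff.1 e, (mem_rod_endPt G.rodData.z_anti h0 hk).2 (Or.inl rfl)⟩
    · by_contra e
      exact hx ⟨_, vec_ne_zero_iff.1 e, (mem_rod_endPt G.rodData.z_anti h0 hk).2 (Or.inr rfl)⟩
  · refine Or.inr ⟨l, hl, ?_⟩
    by_contra e
    exact hx ⟨l, vec_ne_zero_iff.1 e, hl.mem_rod h0⟩

/-- A point of the z-axis outside Γ lies inside a horizon rod or between two of them, where the
models do not degenerate. -/
theorem regular (G : R.IsGlueData η f g P) {x : E3} (hx : x ∉ R.axis) : Regular (R.glue η f g) (cyl x) := by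
  rcases (rhoSq_nonneg x).eq_or_lt with h0 | h0
  · have e : cyl x = (0, x 2) := by rw [cyl, ← h0]
    rw [e]
    rcases G.not_axis hx h0.symm with ⟨k, hk, e1, e2⟩ | ⟨l, hl, e1⟩
    · rw [hk]
      obtain ⟨h1, h2⟩ := (G.endModel k).flat e1 e2
      have := glue_eventually_endPt (f := f) (g := g) G.partition k
      exact ⟨h1.congr_of_eventuallyEq this, by rw [this.self_of_nhds]; exact h2⟩
    · exact (axisForm_glue G.rodData G.partition G.endModel G.farModel hl).1 e1
  · exact regular_glue G.rodData G.partition G.endModel G.farModel h0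

theorem isAxisymMap (G : R.IsGlueData η f g P) : R.IsAxisymMap fun x => R.glueMap η f g P (cyl x) where
  mapsTo x hx := join_mem_target.2 (G.regular hx).2
  axisym x y h1 h2 := by simp only [cyl, h1, h2]

theorem contDiffAt_glue (G : R.IsGlueData η f g P) {x : E3} (hx : x ∉ R.endPts) : ContDiffAt ℝ ∞ (R.glue η f g) (cyl x) := by
  by_cases hax : x ∈ R.axis
  · obtain ⟨l, hl, hx'⟩ := hax
    have h0 := (mem_rod_iff.1 hx').1
    have e : cyl x = (0, x 2) := by rw [cyl, h0]
    rw [e]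
    rcases inside_or_eq G.rodData.z_anti (x 2) with ⟨k, hk⟩ | ⟨l', hl'⟩
    · exact absurd ⟨k, by rw [← hk]; exact eq_axisPt h0⟩ hx
    · obtain rfl := hl'.eq_of_mem_rod hx'
      exact ((axisForm_glue G.rodData G.partition G.endModel G.farModel hl').2
        (vec_ne_zero_iff.2 hl)).contDiffAt
  · exact (G.regular hax).1

theorem isSmoothMap (G : R.IsGlueData η f g P) : R.IsSmoothMap fun x => R.glueMap η f g P (cyl x) where
  zeta := by
    refine contDiff_pi.2 fun i => ?_
    fin_cases i
    · exact contDiff_pi.1 G.contDiff_pot 0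
    · exact contDiff_pi.1 G.contDiff_pot 1
  chi := contDiff_pi.1 G.contDiff_pot 2
  psi := by
    refine contDiff_pi.2 fun i => ?_
    fin_cases i
    · exact contDiff_pi.1 G.contDiff_pot 3
    · exact contDiff_pi.1 G.contDiff_pot 4
  f i j := by
    obtain ⟨k, hk⟩ := exists_fMat_join i j
    simp only [glueMap, hk]
    intro x hx
    exact ((contDiffAt_pi.1 (G.contDiffAt_glue hx) k).comp x
      contDiff_cyl.contDiffAt).contDiffWithinAt
  f_endPt k i j := by
    obtain ⟨n, hn⟩ := exists_fMat_join i j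
    obtain ⟨s, hs, e⟩ := (G.endModel k).smooth
    refine ⟨fun t => s t n, contDiff_pi.1 hs n, ?_⟩
    have hc : Filter.Tendsto cyl (𝓝 (axisPt (R.z k))) (𝓝 (0, R.z k)) := by
      rw [← cyl_axisPt]
      exact (contDiff_cyl (n := 0)).continuous.continuousAt
    filter_upwards [hc.eventually (glue_eventually_endPt (f := f) (g := g) G.partition k)] with x hx
    simp only [glueMap, hn, hx, e, norm_sub_axisPt]
    rfl

theorem span_inside {l : Fin (L + 1)} {h : ℝ} (hl : R.Inside l h) :
    {u | ∃ l, axisPt h ∈ R.rod l ∧ u = R.vec l} = {R.vec l} := by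
  have hh : (axisPt h) 2 = h := by simp [axisPt]
  have h0 : rhoSq (axisPt h) = 0 := by simp [rhoSq, axisPt]
  rw [← hh] at hl
  ext u
  constructor
  · rintro ⟨l', hl', rfl⟩
    rw [hl.eq_of_mem_rod hl']
    rfl
  · rintro rfl
    exact ⟨l, hl.mem_rod h0, rfl⟩

theorem span_endPt (G : R.IsGlueData η f g P) (k : Fin L) : {u | ∃ l, axisPt (R.z k) ∈ R.rod l ∧ u = R.vec l} =
    {R.vec k.castSucc, R.vec k.succ} := by
  have hh : (axisPt (R.z k)) 2 = R.z k := by simp [axisPt]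
  have h0 : rhoSq (axisPt (R.z k)) = 0 := by simp [rhoSq, axisPt]
  ext u
  simp only [Set.mem_ofPred_eq, mem_rod_endPt G.rodData.z_anti h0 hh, Set.mem_insert_iff,
    Set.mem_singleton_iff]
  constructor
  · rintro ⟨l, rfl | rfl, rfl⟩
    exacts [Or.inl rfl, Or.inr rfl]
  · rintro (rfl | rfl)
    exacts [⟨_, Or.inl rfl, rfl⟩, ⟨_, Or.inr rfl, rfl⟩]

theorem hasRodStructure (G : R.IsGlueData η f g P) : R.HasRodStructure fun x => R.glueMap η f g P (cyl x) where
  ker h w := by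
    rw [cyl_axisPt, glueMap, fMat_join_mulVec]
    rcases inside_or_eq G.rodData.z_anti h with ⟨k, rfl⟩ | ⟨l, hl⟩
    · rw [G.span_endPt, (glue_eventually_endPt G.partition k).self_of_nhds, (G.endModel k).ker]
    · rw [span_inside hl]
      have hA := axisForm_glue G.rodData G.partition G.endModel G.farModel hl
      by_cases hv : R.vec l = 0
      · rw [(hA.1 hv).inKer_iff, hv, Submodule.span_zero_singleton, Submodule.mem_bot]
      · exact (hA.2 hv).inKer_iff hv w
  det x hx := by
    obtain ⟨⟨l, hl, hxl⟩, hxh⟩ := hx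
    have h0 := (mem_rod_iff.1 hxl).1
    have e : cyl x = (0, x 2) := by rw [cyl, h0]
    have hc : Filter.Tendsto cyl (𝓝 x) (𝓝 (0, x 2)) := by
      rw [← e]
      exact (contDiff_cyl (n := 0)).continuous.continuousAt
    simp only [glueMap, det_fMat_join]
    have key : ∃ m > 0, ∃ M > 0, ∀ᶠ q in 𝓝 ((0 : ℝ), x 2), 0 ≤ q.1 →
        m * q.1 ≤ detVec (R.glue η f g q) ∧ detVec (R.glue η f g q) ≤ M * q.1 := by
      rcases inside_or_eq G.rodData.z_anti (x 2) with ⟨k, hk⟩ | ⟨l', hl'⟩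
      -- A separating point on no horizon rod is a corner, and there det F is an exact multiple of
      -- ρ².
      · have ax : ∀ l', x ∈ R.rod l' → R.vec l' ≠ 0 := fun l' hl' =>
          vec_ne_zero_iff.2 (by_contra fun hn => hxh ⟨l', hn, hl'⟩)
        have hm := fun l' => mem_rod_endPt (l := l') G.rodData.z_anti h0 hk
        obtain ⟨m, hm0, hm⟩ := (G.endModel k).det (ax _ ((hm _).2 (Or.inl rfl)))
          (ax _ ((hm _).2 (Or.inr rfl)))
        rw [hk]
        refine ⟨m, hm0, m, hm0, ?_⟩
        filter_upwards [glue_eventually_endPt (f := f) (g := g) G.partition k] with q hq hq0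
        rw [hq, hm q hq0]
        exact ⟨le_rfl, le_rfl⟩
      · obtain rfl := hl'.eq_of_mem_rod hxl
        have hv := vec_ne_zero_iff.2 hl
        exact ((axisForm_glue G.rodData G.partition G.endModel G.farModel hl').2
          hv).detVec_comparable hv
    obtain ⟨m, hm, M, hM, h⟩ := key
    exact ⟨m, hm, M, hM, (hc.eventually h).mono fun y hy => hy (rhoSq_nonneg y)⟩

theorem psiPot_eq (G : R.IsGlueData η f g P) (x : E3) (hx : rhoSq x = 0) :
    psiPot (R.glueMap η f g P (cyl x)) = psiPart (P (x 2)) := by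
  rw [← G.pot_axis x hx]
  rfl

theorem hasPotentialConstants (G : R.IsGlueData η f g P) :
    R.HasPotentialConstants fun x => R.glueMap η f g P (cyl x) := by
  have hpts : (fun i => psiPot (R.glueMap η f g P (cyl (axisPt (R.z i))))) =
      fun k => psiPart (P (R.z k)) := by
    funext k
    rw [G.psiPot_eq _ (by simp [rhoSq, axisPt])]
    simp [axisPt]
  refine ⟨fun l hl x hx => ?_, fun l hl x hx => ?_, fun l hl x hx => ?_⟩
  · rw [G.psiPot_eq x (mem_rod_iff.1 hx).1]
    exact (G.rod l hl x hx).1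
  · have h0 := (mem_rod_iff.1 hx).1
    rw [hpts, G.psiPot_eq x h0]
    have : chiPot (R.glueMap η f g P (cyl x)) = P (x 2) 2 := by
      rw [← G.pot_axis x h0]
      rfl
    rw [this, (G.rod l hl x hx).2]
    simp only [rodPot, profile, Matrix.cons_val]
    exact add_right_comm _ _ _
  · have h0 := (mem_rod_iff.1 hx).1
    rw [hpts, G.psiPot_eq x h0]
    have : zetaPot (R.glueMap η f g P (cyl x)) = ![P (x 2) 0, P (x 2) 1] := by
      rw [← G.pot_axis x h0]
      rfl
    rw [this]
    have e := (G.rod l hl x hx).2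
    ext i
    fin_cases i
    · have := congrFun e 0
      simp only [rodPot, profile, Matrix.cons_val_zero, Pi.add_apply] at this
      simp only [Fin.zero_eta, Matrix.cons_val_zero, Pi.add_apply]
      rw [this]
      exact add_right_comm _ _ _
    · have := congrFun e 1
      simp only [rodPot, profile, Matrix.cons_val_one, Pi.add_apply] at this
      simp only [Fin.mk_one, Matrix.cons_val_one, Matrix.cons_val_zero, Pi.add_apply]
      rw [this]
      exact add_right_comm _ _ _

/-! ### Bounds for the tension of the glued map -/

theorem contDiffAt_glueMap {q : ℝ × ℝ} (hF : ContDiffAt ℝ ∞ (R.glue η f g) q)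
    (hP : ContDiffAt ℝ ∞ (R.gluePot P) q) (A : Fin 8) :
    ContDiffAt ℝ ∞ (fun q => R.glueMap η f g P q A) q := by
  have hF' := contDiffAt_pi.1 hF
  have hP' := contDiffAt_pi.1 hP
  fin_cases A
  exacts [hF' 0, hF' 1, hF' 2, hP' 0, hP' 1, hP' 2, hP' 3, hP' 4]

theorem tensionNorm_bounded_of_regular (G : R.IsGlueData η f g P) {q : ℝ × ℝ} (hq : 0 ≤ q.1)
    (H : Regular (R.glue η f g) q) : ∃ C, ∀ᶠ q' in 𝓝 q, ∀ p, cyl p = q' →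
      tensionNorm (fun x => R.glueMap η f g P (cyl x)) p ≤ C :=
  tensionNorm_bounded_of_smooth
    (contDiffAt_glueMap H.1 (contDiffAt_gluePot G.smooth G.north G.south hq)) (join_mem_target.2 H.2)

theorem tensionNorm_bounded_rod (G : R.IsGlueData η f g P) {l : Fin (L + 1)} {h : ℝ}
    (hl : R.Inside l h) (hv : R.vec l ≠ 0) : ∃ C, ∀ᶠ q in 𝓝 ((0 : ℝ), h), ∀ p, cyl p = q →
      p ∉ R.axis → tensionNorm (fun x => R.glueMap η f g P (cyl x)) p ≤ C := by
  have hF := (axisForm_glue G.rodData G.partition G.endModel G.farModel hl).2 hv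
  obtain ⟨C, hC⟩ := hF.tensionNorm_bounded hv G.smooth (A := R.a l + R.zetaShift (fun k =>
      psiPart (P (R.z k))) l) (B := R.b l + R.chiShift (fun k => psiPart (P (R.z k))) l) (c := R.c l)
    (hl.eventually.mono fun z hz => by
      have := G.rod l (vec_ne_zero_iff.1 hv) (axisPt z) (Inside.mem_rod (x := axisPt z)
        (by simpa [axisPt] using hz) (by simp [rhoSq, axisPt]))
      simpa [axisPt, rodPot] using this)
    (X := R.glueMap η f g P) ((gluePot_eventually_axis G.north G.south h).mono fun q hq => by
      rw [glueMap, hq])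
  refine ⟨C, ?_⟩
  filter_upwards [hC, continuousAt_snd.eventually hl.eventually] with q h1 h2 p hp hax
  refine h1 p hp ?_
  subst hp
  refine lt_of_le_of_ne (rhoSq_nonneg p) fun h0 => hax ⟨l, vec_ne_zero_iff.1 hv, ?_⟩
  exact Inside.mem_rod h2 h0.symm

/-- At corners and poles no estimate is needed: nearby the map is a model with constant potentials,
so its tension is zero off Γ. Between two horizon rods the map is regular. -/
theorem tensionNorm_bounded_endPt (G : R.IsGlueData η f g P) (k : Fin L) :
    ∃ C, ∀ᶠ q in 𝓝 ((0 : ℝ), R.z k), ∀ p, cyl p = q →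
      p ∉ R.axis → tensionNorm (fun x => R.glueMap η f g P (cyl x)) p ≤ C := by
  have hF := glue_eventually_endPt (f := f) (g := g) G.partition k
  by_cases hv : R.vec k.castSucc ≠ 0 ∨ R.vec k.succ ≠ 0
  · obtain ⟨y, hy⟩ := G.const_endPt k
    refine ⟨0, ?_⟩
    filter_upwards [hF.eventually_nhds,
      (gluePot_eventually_axis G.north G.south (R.z k)).eventually_nhds,
      (continuousAt_snd.eventually hy).eventually_nhds] with q h1 h2 h3 p hp hax
    subst hp
    refine ((G.endModel k).tension hv y (R.glueMap η f g P) p ?_ ?_ ?_).le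
    · filter_upwards [h1, h2, h3] with q' e1 e2 e3
      rw [glueMap, e1, e2, e3]
    · refine lt_of_le_of_ne (add_nonneg (rhoSq_nonneg p) (sq_nonneg _)) fun h0 => hax ?_
      have hp0 : rhoSq p = 0 := by nlinarith [rhoSq_nonneg p, sq_nonneg (p 2 - R.z k)]
      have hpz : p 2 = R.z k := by
        rw [hp0, zero_add] at h0
        exact sub_eq_zero.1 (pow_eq_zero_iff two_ne_zero |>.1 h0.symm)
      have hm := fun l => mem_rod_endPt (l := l) G.rodData.z_anti hp0 hpz
      rcases hv with hv | hv
      · exact ⟨_, vec_ne_zero_iff.1 hv, (hm _).2 (Or.inl rfl)⟩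
      · exact ⟨_, vec_ne_zero_iff.1 hv, (hm _).2 (Or.inr rfl)⟩
    · rw [← h1.self_of_nhds]
      exact (G.regular hax).2
  · push Not at hv
    obtain ⟨h1, h2⟩ := (G.endModel k).flat hv.1 hv.2
    obtain ⟨C, hC⟩ := G.tensionNorm_bounded_of_regular (q := (0, R.z k)) le_rfl
      ⟨h1.congr_of_eventuallyEq hF, by rw [hF.self_of_nhds]; exact h2⟩
    exact ⟨C, hC.mono fun q hq p hp _ => hq p hp⟩

theorem tensionNorm_locally_bounded (G : R.IsGlueData η f g P) (x : E3) :
    ∃ C, ∀ᶠ p in 𝓝 x, p ∉ R.axis → tensionNorm (fun x => R.glueMap η f g P (cyl x)) p ≤ C := by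
  have key : ∃ C, ∀ᶠ q in 𝓝 (cyl x), ∀ p, cyl p = q →
      p ∉ R.axis → tensionNorm (fun x => R.glueMap η f g P (cyl x)) p ≤ C := by
    rcases (rhoSq_nonneg x).eq_or_lt with h0 | h0
    · have e : cyl x = (0, x 2) := by rw [cyl, ← h0]
      rw [e]
      rcases inside_or_eq G.rodData.z_anti (x 2) with ⟨k, hk⟩ | ⟨l, hl⟩
      · rw [hk]
        exact G.tensionNorm_bounded_endPt k
      · by_cases hv : R.vec l = 0
        · obtain ⟨C, hC⟩ := G.tensionNorm_bounded_of_regular (q := (0, x 2)) le_rfl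
            ((axisForm_glue G.rodData G.partition G.endModel G.farModel hl).1 hv)
          exact ⟨C, hC.mono fun q hq p hp _ => hq p hp⟩
        · exact G.tensionNorm_bounded_rod hl hv
    · obtain ⟨C, hC⟩ := G.tensionNorm_bounded_of_regular (q := cyl x) h0.le
        (regular_glue G.rodData G.partition G.endModel G.farModel h0)
      exact ⟨C, hC.mono fun q hq p hp _ => hq p hp⟩
  obtain ⟨C, hC⟩ := key
  have hc : ContinuousAt cyl x := (contDiff_cyl (n := 0)).continuous.continuousAt
  exact ⟨C, (hc.eventually hC).mono fun p hp => hp p rfl⟩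

theorem tensionNorm_bounded_on_ball (G : R.IsGlueData η f g P) (r : ℝ) :
    ∃ C, ∀ p, ‖p‖ ≤ r → p ∉ R.axis →
      tensionNorm (fun x => R.glueMap η f g P (cyl x)) p ≤ C := by
  choose C hC using G.tensionNorm_locally_bounded
  obtain ⟨t, -, ht⟩ := (isCompact_closedBall (0 : E3) r).elim_nhds_subcover
    (fun x => {p | p ∉ R.axis → tensionNorm (fun x => R.glueMap η f g P (cyl x)) p ≤ C x})
    fun x _ => hC x
  refine ⟨∑ x ∈ t, |C x|, fun p hp hax => ?_⟩
  obtain ⟨x, hx, hpx⟩ := Set.mem_iUnion₂.1 (ht (mem_closedBall_zero_iff.2 hp))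
  exact (hpx hax).trans ((le_abs_self _).trans
    (Finset.single_le_sum (f := fun x => |C x|) (fun _ _ => abs_nonneg _) hx))

/-- Far out the glued map coincides with the asymptotic model. Points outside Γ have ρ > 0 there,
since both semi-infinite rods are axis rods. -/
theorem tensionNorm_decay (G : R.IsGlueData η f g P) : ∃ C r₀ : ℝ, 0 ≤ C ∧ 1 ≤ r₀ ∧ ∀ p, p ∉ R.axis →
    r₀ ≤ ‖p‖ → tensionNorm (fun x => R.glueMap η f g P (cyl x)) p ≤ C * ‖p‖ ^ (-3 : ℤ) := by
  obtain ⟨C, hC0, hC⟩ := G.farModel.tension (P R.outer) (P (-R.outer) - P R.outer)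
    (fun e => by
      have := G.far_ne e
      exact ⟨sub_eq_zero.2 (congrFun this 0), sub_eq_zero.2 (congrFun this 1)⟩)
    (fun e => by
      obtain ⟨δ, hδ⟩ := G.far_eq e
      exact ⟨δ, congrFun hδ 0, congrFun hδ 1⟩)
  have hA := R.one_le_outer
  have hB : R.farRadius = R.outer + 1 := rfl
  -- The radial cut-off is complete once r² exceeds `farRadius`² + 1, and (B + 1)² > B² + 1 for B >
  -- 0.
  refine ⟨C, R.farRadius + 1, hC0, by linarith, fun p hax hp => ?_⟩
  have hn : R.farRadius ^ 2 + 1 < rhoSq p + p 2 ^ 2 := by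
    rw [← norm_sq_eq]
    nlinarith
  obtain ⟨e1, e2⟩ := glue_eventually_far (η := η) (f := f) (g := g) (P := P) (q := cyl p) hn
  refine hC (R.glueMap η f g P) p ?_ (by linarith) ?_
  · refine lt_of_le_of_ne (rhoSq_nonneg p) fun h0 => hax ?_
    rw [← h0, zero_add] at hn
    have habs : R.outer ≤ |p 2| := by
      refine (le_abs_self _).trans (sq_le_sq.1 ?_)
      nlinarith
    rcases le_abs.1 habs with h | h
    · exact ⟨0, G.rodData.first_axis, (inside_zero h).mem_rod h0.symm⟩
    · exact ⟨Fin.last L, G.rodData.last_axis, (inside_last (by linarith)).mem_rod h0.symm⟩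
  · filter_upwards [e1, e2] with q h1 h2
    rw [glueMap, h1, h2]

theorem tensionNorm_bounded (G : R.IsGlueData η f g P) : ∃ C, ∀ p, p ∉ R.axis →
    tensionNorm (fun x => R.glueMap η f g P (cyl x)) p ≤ C := by
  obtain ⟨C, r₀, hC, hr, h⟩ := G.tensionNorm_decay
  obtain ⟨C', h'⟩ := G.tensionNorm_bounded_on_ball r₀
  refine ⟨max C C', fun p hax => ?_⟩
  rcases le_total ‖p‖ r₀ with hp | hp
  · exact (h' p hp hax).trans (le_max_right _ _)
  · refine (h p hax hp).trans (le_max_of_le_left ?_)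
    refine mul_le_of_le_one_right hC ?_
    rw [zpow_neg]
    exact inv_le_one_of_one_le₀ (one_le_pow₀ (hr.trans hp))

end IsGlueData

end RodData

end Sugra

end

theorem proposition5 (L : ℕ) (R : Sugra.RodData L) (hR : R.IsRodDataSet)
    (hcompat : R.GenCompatible) :
    ∃ X : Sugra.E3 → Fin 8 → ℝ,
      R.IsAxisymMap X ∧ R.IsSmoothMap X ∧ R.HasRodStructure X ∧ R.HasPotentialConstants X ∧
      (∃ C : ℝ, ∀ x ∈ R.axisᶜ, Sugra.tensionNorm X x ≤ C) ∧
      (∃ C r₀ : ℝ, 0 < r₀ ∧ ∀ x ∈ R.axisᶜ, r₀ ≤ ‖x‖ →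
        Sugra.tensionNorm X x ≤ C * ‖x‖ ^ (-3 : ℤ)) := by
  obtain ⟨η, f, g, P, G⟩ := Sugra.RodData.exists_isGlueData hR
  refine ⟨_, G.isAxisymMap, G.isSmoothMap, G.hasRodStructure, G.hasPotentialConstants,
    G.tensionNorm_bounded, ?_⟩
  obtain ⟨C, r₀, -, hr, h⟩ := G.tensionNorm_decay
  exact ⟨C, r₀, one_pos.trans_le hr, h⟩
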